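/- Let $B>0$, $a>0$, and let $V=V(r_\perp,z)$ be a real-valued axially symmetric potential on $\mathbb R^3$, where $r_\perp=\sqrt{x^2+y^2}$, that is periodic, $V(r_\perp,z+a)=V(r_\perp,z)$. Assume that $V$ is locally square integrable on $\mathbb R^3$, that there are constants $R>0$ and $K$ with $$\int_n^{n+1}dz\int_{r_\perp<R}dx\,dy\,|V|^2\le K^2\qquad\text{for all } n\in\mathbb Z,$$ and that there are constants $C$ and $C_V<B^2/4$ with $$|V(r_\perp,z)|\le C+C_V\,r_\perp^2\qquad\text{for all } r_\perp>R.$$ For $\alpha\in\mathbb R$ and $m\in\mathbb Z$ let $\mathcal H_{\alpha,m}$ be the Hilbert space of functions $\psi$ on $\mathbb R^3$ that satisfy $\psi(x,y,z+a)=e^{i\alpha}\psi(x,y,z)$, have angular momentum $L_z=-i(x\partial_y-y\partial_x)$ equal to $m$ (that is, rotation of the argument by the angle $\theta$ around the $z$-axis multiplies $\psi$ by $e^{im\theta}$), and have finite norm $\|\psi\|^2=\int_{\mathbb R^2}dx\,dy\int_0^a|\psi|^2dz$. Let $H_{\alpha,m}$ be the operator in $\mathcal H_{\alpha,m}$ that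 is the closure of $$H=-\Delta-B\,L_z+\frac{B^2}{4}r_\perp^2+V(r_\perp,z),$$ defined on the smooth functions in $\mathcal H_{\alpha,m}$ that vanish for all sufficiently large $r_\perp$. Then $H_{\alpha,m}$ is self-adjoint and has purely discrete spectrum: every point of its spectrum is an isolated point of the spectrum and an eigenvalue of finite multiplicity. -/

import Mathlib

open MeasureTheory Set
open scoped ContDiff

noncomputable section

namespace BlochLandau

/-! ### Configuration space

The point `(x, y, z)` of physical space is written `(x + i y, z) : ℂ × ℝ`; thus `r_⊥ = ‖p.1‖` and
the measure `volume` on `ℂ × ℝ` is three-dimensional Lebesgue measure. -/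

/-- Lebesgue measure on the unit cell `0 ≤ z < a`. -/
def cellMeasure (a : ℝ) : Measure (ℂ × ℝ) :=
  (volume : Measure (ℂ × ℝ)).restrict (univ ×ˢ Ico 0 a)

/-- Rotation by the angle `θ` around the `z`-axis. -/
def rot (θ : ℝ) (p : ℂ × ℝ) : ℂ × ℝ := (rotation (Circle.exp θ) p.1, p.2)

theorem measurePreserving_rot (a θ : ℝ) :
    MeasurePreserving (rot θ) (cellMeasure a) (cellMeasure a) := by
  have h : MeasurePreserving (rot θ) (volume : Measure (ℂ × ℝ)) volume :=
    (rotation (Circle.exp θ)).measurePreserving.prod (MeasurePreserving.id volume)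
  have h2 := h.restrict_preimage
    (s := (univ : Set ℂ) ×ˢ Ico (0 : ℝ) a) (MeasurableSet.univ.prod measurableSet_Ico)
  have h3 : rot θ ⁻¹' ((univ : Set ℂ) ×ˢ Ico (0 : ℝ) a) = univ ×ˢ Ico 0 a := by
    ext p; simp [rot]
  rw [h3] at h2
  exact h2

/-! ### Hilbert spaces -/

/-- The space of functions with `ψ(x, y, z + a) = exp(iα) ψ(x, y, z)` and finite norm
`‖ψ‖² = ∫ dx dy ∫₀ᵃ dz |ψ|²`. Such a function is uniquely determined by its restriction to the unit
cell, which may be any square integrable function there, so the space is `L²` of the cell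
(for every `α`; the phase `α` enters through the domain of the Hamiltonian). -/
abbrev BlochSpace (a : ℝ) : Type := Lp ℂ 2 (cellMeasure a)

/-- The sector `L_z = m`: the functions with `ψ ∘ rot θ = exp(imθ) ψ` for every angle `θ`. -/
def sector (a : ℝ) (m : ℤ) : Submodule ℂ (BlochSpace a) :=
  ⨅ θ : ℝ, LinearMap.ker
    (((Lp.compMeasurePreservingₗᵢ ℂ (rot θ) (measurePreserving_rot a θ)).toContinuousLinearMap
      - Complex.exp (Complex.I * m * θ) • ContinuousLinearMap.id ℂ (BlochSpace a) :
      BlochSpace a →L[ℂ] BlochSpace a) : BlochSpace a →ₗ[ℂ] BlochSpace a)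

theorem isClosed_sector (a : ℝ) (m : ℤ) : IsClosed (sector a m : Set (BlochSpace a)) := by
  unfold sector
  rw [Submodule.coe_iInf]
  exact isClosed_iInter fun θ => ContinuousLinearMap.isClosed_ker _

instance (a : ℝ) (m : ℤ) : CompleteSpace (sector a m) :=
  (isClosed_sector a m).completeSpace_coe

/-! ### The differential expression -/

/-- `∂/∂x`. -/
def dX (ψ : ℂ × ℝ → ℂ) (p : ℂ × ℝ) : ℂ := fderiv ℝ ψ p (1, 0)

/-- `∂/∂y`. -/
def dY (ψ : ℂ × ℝ → ℂ) (p : ℂ × ℝ) : ℂ := fderiv ℝ ψ p (Complex.I, 0)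

/-- `∂/∂z`. -/
def dZ (ψ : ℂ × ℝ → ℂ) (p : ℂ × ℝ) : ℂ := fderiv ℝ ψ p (0, 1)

/-- The Laplacian of three-dimensional space. -/
def lap (ψ : ℂ × ℝ → ℂ) (p : ℂ × ℝ) : ℂ := dX (dX ψ) p + dY (dY ψ) p + dZ (dZ ψ) p

/-- The angular momentum `L_z = -i (x ∂/∂y - y ∂/∂x)`. -/
def angMom (ψ : ℂ × ℝ → ℂ) (p : ℂ × ℝ) : ℂ :=
  -Complex.I * ((p.1.re : ℂ) * dY ψ p - (p.1.im : ℂ) * dX ψ p)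

/-- `H ψ = -Δψ - B L_z ψ + (B²/4) r_⊥² ψ + V(r_⊥, z) ψ`. -/
def hamExpr (B : ℝ) (V : ℝ → ℝ → ℝ) (ψ : ℂ × ℝ → ℂ) (p : ℂ × ℝ) : ℂ :=
  -lap ψ p - (B : ℂ) * angMom ψ p + ((B ^ 2 / 4 * ‖p.1‖ ^ 2 : ℝ) : ℂ) * ψ p
    + ((V ‖p.1‖ p.2 : ℝ) : ℂ) * ψ p

/-- Smooth Bloch functions with quasi-momentum `α`, angular momentum `m` and bounded support in
the directions perpendicular to the `z`-axis. -/
structure IsBlochCore (a α : ℝ) (m : ℤ) (ψ : ℂ × ℝ → ℂ) : Prop where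
  smooth : ContDiff ℝ ∞ ψ
  bloch : ∀ w z, ψ (w, z + a) = Complex.exp (Complex.I * α) * ψ (w, z)
  angular : ∀ θ p, ψ (rot θ p) = Complex.exp (Complex.I * m * θ) * ψ p
  support : ∃ ρ : ℝ, ∀ w z, ρ < ‖w‖ → ψ (w, z) = 0

theorem IsBlochCore.add {a α : ℝ} {m : ℤ} {ψ φ : ℂ × ℝ → ℂ} (hψ : IsBlochCore a α m ψ)
    (hφ : IsBlochCore a α m φ) : IsBlochCore a α m (ψ + φ) := by
  refine ⟨hψ.smooth.add hφ.smooth, fun w z => ?_, fun θ p => ?_, ?_⟩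
  · simp only [Pi.add_apply, hψ.bloch, hφ.bloch]; ring
  · simp only [Pi.add_apply, hψ.angular, hφ.angular]; ring
  · obtain ⟨ρ, h⟩ := hψ.support
    obtain ⟨σ, k⟩ := hφ.support
    refine ⟨max ρ σ, fun w z hw => ?_⟩
    simp [h w z (lt_of_le_of_lt (le_max_left _ _) hw), k w z (lt_of_le_of_lt (le_max_right _ _) hw)]

theorem IsBlochCore.smul {a α : ℝ} {m : ℤ} {ψ : ℂ × ℝ → ℂ} (c : ℂ)
    (hψ : IsBlochCore a α m ψ) : IsBlochCore a α m (c • ψ) := by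
  refine ⟨hψ.smooth.const_smul c, fun w z => ?_, fun θ p => ?_, ?_⟩
  · simp only [Pi.smul_apply, hψ.bloch, smul_eq_mul]; ring
  · simp only [Pi.smul_apply, hψ.angular, smul_eq_mul]; ring
  · obtain ⟨ρ, h⟩ := hψ.support
    exact ⟨ρ, fun w z hw => by simp [h w z hw]⟩

theorem isBlochCore_zero (a α : ℝ) (m : ℤ) : IsBlochCore a α m 0 :=
  ⟨contDiff_const, by simp, by simp, 0, by simp⟩

theorem contDiff_dir {ψ : ℂ × ℝ → ℂ} (hψ : ContDiff ℝ ∞ ψ) (v : ℂ × ℝ) :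
    ContDiff ℝ ∞ (fun p => fderiv ℝ ψ p v) :=
  (hψ.fderiv_right (m := ∞) (by simp)).clm_apply contDiff_const

theorem dir_add {ψ φ : ℂ × ℝ → ℂ} (hψ : ContDiff ℝ ∞ ψ) (hφ : ContDiff ℝ ∞ φ) (v : ℂ × ℝ) :
    (fun p => fderiv ℝ (ψ + φ) p v) = (fun p => fderiv ℝ ψ p v) + fun p => fderiv ℝ φ p v := by
  funext p
  rw [fderiv_add (hψ.differentiable (by simp) p) (hφ.differentiable (by simp) p)]
  rfl

theorem dir_smul {ψ : ℂ × ℝ → ℂ} (hψ : ContDiff ℝ ∞ ψ) (c : ℂ) (v : ℂ × ℝ) :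
    (fun p => fderiv ℝ (c • ψ) p v) = c • fun p => fderiv ℝ ψ p v := by
  funext p
  rw [fderiv_const_smul (hψ.differentiable (by simp) p)]
  rfl

theorem hamExpr_add (B : ℝ) (V : ℝ → ℝ → ℝ) {ψ φ : ℂ × ℝ → ℂ} (hψ : ContDiff ℝ ∞ ψ)
    (hφ : ContDiff ℝ ∞ φ) : hamExpr B V (ψ + φ) = hamExpr B V ψ + hamExpr B V φ := by
  have h1 : ∀ v, (fun p => fderiv ℝ (fun p => fderiv ℝ (ψ + φ) p v) p v)
      = (fun p => fderiv ℝ (fun p => fderiv ℝ ψ p v) p v)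
        + fun p => fderiv ℝ (fun p => fderiv ℝ φ p v) p v := fun v => by
    rw [dir_add hψ hφ, dir_add (contDiff_dir hψ v) (contDiff_dir hφ v)]
  funext p
  have hx := congrFun (h1 (1, 0)) p
  have hy := congrFun (h1 (Complex.I, 0)) p
  have hz := congrFun (h1 (0, 1)) p
  have kx := congrFun (dir_add hψ hφ (1, 0)) p
  have ky := congrFun (dir_add hψ hφ (Complex.I, 0)) p
  simp only [Pi.add_apply] at hx hy hz kx ky
  simp only [hamExpr, lap, angMom, dX, dY, dZ, Pi.add_apply] at *
  unfold dX dY dZ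
  rw [hx, hy, hz, kx, ky]
  ring

theorem hamExpr_smul (B : ℝ) (V : ℝ → ℝ → ℝ) {ψ : ℂ × ℝ → ℂ} (c : ℂ) (hψ : ContDiff ℝ ∞ ψ) :
    hamExpr B V (c • ψ) = c • hamExpr B V ψ := by
  have h1 : ∀ v, (fun p => fderiv ℝ (fun p => fderiv ℝ (c • ψ) p v) p v)
      = c • fun p => fderiv ℝ (fun p => fderiv ℝ ψ p v) p v := fun v => by
    rw [dir_smul hψ, dir_smul (contDiff_dir hψ v)]
  funext p
  have hx := congrFun (h1 (1, 0)) p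
  have hy := congrFun (h1 (Complex.I, 0)) p
  have hz := congrFun (h1 (0, 1)) p
  have kx := congrFun (dir_smul hψ c (1, 0)) p
  have ky := congrFun (dir_smul hψ c (Complex.I, 0)) p
  simp only [Pi.smul_apply, smul_eq_mul] at hx hy hz kx ky
  simp only [hamExpr, lap, angMom, Pi.smul_apply, smul_eq_mul]
  unfold dX dY dZ
  rw [hx, hy, hz, kx, ky]
  ring

/-! ### The operators -/

/-- The graph of the minimal operator: the pairs of `L²`-classes `(ψ, H ψ)` with `ψ` a smooth Bloch
function as in `IsBlochCore`. -/
def minimalGraph (B a : ℝ) (V : ℝ → ℝ → ℝ) (α : ℝ) (m : ℤ) :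
    Submodule ℂ (sector a m × sector a m) where
  carrier := {q | ∃ ψ, IsBlochCore a α m ψ ∧ (q.1 : BlochSpace a) =ᵐ[cellMeasure a] ψ ∧
    (q.2 : BlochSpace a) =ᵐ[cellMeasure a] hamExpr B V ψ}
  zero_mem' := by
    refine ⟨0, isBlochCore_zero a α m, Lp.coeFn_zero _ _ _, ?_⟩
    have h : hamExpr B V (0 : ℂ × ℝ → ℂ) = 0 := by
      simpa using hamExpr_smul B V (ψ := 0) 0 contDiff_const
    rw [h]
    exact Lp.coeFn_zero _ _ _
  add_mem' := by
    rintro q q' ⟨ψ, h, h1, h2⟩ ⟨ψ', h', h1', h2'⟩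
    refine ⟨ψ + ψ', h.add h', (Lp.coeFn_add _ _).trans (h1.add h1'), ?_⟩
    rw [hamExpr_add B V h.smooth h'.smooth]
    exact (Lp.coeFn_add _ _).trans (h2.add h2')
  smul_mem' := by
    rintro c q ⟨ψ, h, h1, h2⟩
    refine ⟨c • ψ, h.smul c, (Lp.coeFn_smul _ _).trans (h1.const_smul c), ?_⟩
    rw [hamExpr_smul B V c h.smooth]
    exact (Lp.coeFn_smul _ _).trans (h2.const_smul c)

/-- The set `minimalGraph` is the graph of a (single-valued) linear operator. -/
theorem minimalGraph_single_valued {B a : ℝ} (ha : 0 < a) {V : ℝ → ℝ → ℝ} {α : ℝ} {m : ℤ} :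
    ∀ q ∈ minimalGraph B a V α m, q.1 = 0 → q.2 = 0 := by
  rintro q ⟨ψ, h, h1, h2⟩ hq
  have hc : Continuous ψ := h.smooth.continuous
  have h0 : ψ =ᵐ[cellMeasure a] 0 := by
    refine h1.symm.trans ?_
    rw [hq]
    exact Lp.coeFn_zero _ _ _
  have hopen : EqOn ψ 0 (univ ×ˢ Ioo 0 a) := by
    refine Measure.eqOn_open_of_ae_eq (μ := volume) ?_ (isOpen_univ.prod isOpen_Ioo)
      hc.continuousOn continuousOn_const
    exact ae_restrict_of_ae_restrict_of_subset (prod_mono_right Ioo_subset_Ico_self) h0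
  have hcell : ∀ w z, z ∈ Icc 0 a → ψ (w, z) = 0 := by
    intro w z hz
    have hE : EqOn (fun z => ψ (w, z)) 0 (closure (Ioo 0 a)) :=
      EqOn.closure (fun t ht => hopen ⟨mem_univ _, ht⟩) (by fun_prop) continuous_const
    rw [closure_Ioo ha.ne] at hE
    exact hE hz
  have hshift : ∀ (n : ℕ) w z, ψ (w, z) = 0 ↔ ψ (w, z + n * a) = 0 := by
    intro n w z
    induction n with
    | zero => simp
    | succ n ih =>
      rw [ih, show z + ((n + 1 : ℕ) : ℝ) * a = (z + n * a) + a by push_cast; ring, h.bloch]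
      simp [Complex.exp_ne_zero]
  have hψ : ψ = 0 := by
    funext ⟨w, z⟩
    obtain ⟨k, hk, -⟩ := existsUnique_add_zsmul_mem_Ico ha z 0
    have hk' : ψ (w, z + k * a) = 0 := by
      refine hcell _ _ ?_
      simpa using Ico_subset_Icc_self hk
    rcases le_total 0 k with hk0 | hk0
    · lift k to ℕ using hk0
      exact (hshift k w z).2 (by simpa using hk')
    · obtain ⟨n, rfl⟩ : ∃ n : ℕ, k = -(n : ℤ) := ⟨(-k).toNat, by omega⟩
      have := (hshift n w _).1 hk'
      simpa using this
  have hH : hamExpr B V ψ = 0 := by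
    subst hψ
    simpa using hamExpr_smul B V (ψ := 0) 0 contDiff_const
  rw [hH] at h2
  exact Subtype.ext (Lp.ext (h2.trans (Lp.coeFn_zero _ _ _).symm))

/-- The Hamiltonian on smooth Bloch functions of quasi-momentum `α` and angular momentum `m`. -/
def minimalHam (B a : ℝ) (V : ℝ → ℝ → ℝ) (α : ℝ) (m : ℤ) : sector a m →ₗ.[ℂ] sector a m :=
  (minimalGraph B a V α m).toLinearPMap

/-- The operator `H_{α,m}`: the closure of the Hamiltonian on smooth Bloch functions of
quasi-momentum `α` and angular momentum `m`. -/
def blochHam (B a : ℝ) (V : ℝ → ℝ → ℝ) (α : ℝ) (m : ℤ) : sector a m →ₗ.[ℂ] sector a m :=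
  (minimalHam B a V α m).closure

/-! ### Discrete spectrum of unbounded operators -/

section Spectrum

variable {E : Type*} [NormedAddCommGroup E] [NormedSpace ℂ E]

/-- `c` is in the resolvent set of `T` if `T - c` is a bijection from the domain of `T` onto the
whole space with a bounded inverse `S`. -/
def IsResolventPoint (T : E →ₗ.[ℂ] E) (c : ℂ) : Prop :=
  ∃ S : E →L[ℂ] E, (∀ g, ∃ h : S g ∈ T.domain, T ⟨S g, h⟩ - c • S g = g) ∧
    ∀ f : T.domain, S (T f - c • (f : E)) = f

/-- The spectrum of an unbounded operator. -/
def unboundedSpectrum (T : E →ₗ.[ℂ] E) : Set ℂ := {c | ¬ IsResolventPoint T c}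

/-- The eigenspace `{f ∈ D(T) | T f = c f}`. -/
def eigenspace (T : E →ₗ.[ℂ] E) (c : ℂ) : Submodule ℂ T.domain :=
  LinearMap.ker (T.toFun - c • T.domain.subtype)

/-- Every point of the spectrum is an isolated point of the spectrum and an eigenvalue of
finite multiplicity. -/
def HasDiscreteSpectrum (T : E →ₗ.[ℂ] E) : Prop :=
  ∀ c ∈ unboundedSpectrum T,
    (∃ ε > 0, ∀ c' ∈ unboundedSpectrum T, c' ≠ c → ε ≤ ‖c' - c‖) ∧
    eigenspace T c ≠ ⊥ ∧ FiniteDimensional ℂ (eigenspace T c)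

end Spectrum

end BlochLandau

end

noncomputable section

namespace BlochLandau

section Abstract

open Filter Topology InnerProductSpace
open scoped ComplexInnerProductSpace

variable {E : Type*} [NormedAddCommGroup E] [InnerProductSpace ℂ E]

/-! ### Abstract criteria for self-adjointness and discreteness of the spectrum -/

/-! On the sector `L_z = m` the term `-B L_z` is the constant `-B m`, so up to a constant `H` is the
perturbation by `V` of the oscillator `A₀ = -Δ + B² r_⊥²/4`. Everything is done on the core of
smooth Bloch functions and carried to the closure.

Relative bound. Integration by parts on the cell gives `‖Δψ‖² + ‖(B²/4) r_⊥² ψ‖² ≤ ‖A₀ψ‖² + B² ‖ψ‖²`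
(`oscillator_bound`). A Fourier series in `z` and a planar Sobolev inequality give `sup |ψ| ≤ c_s
‖(s - Δ)ψ‖` with `c_s → 0` as `s → ∞` (`norm_le_sobolevConst`). The part of `V` with `r_⊥ ≤ R` is in
`L²` of the cell and so has relative bound as small as desired. The part with `r_⊥ > R` has relative
bound `4 max(C_V, 0) / B² < 1`. Together `‖(H - A₀)ψ‖ ≤ θ ‖A₀ψ‖ + b ‖ψ‖` with `θ < 1`
(`exists_relative_bound`).

Dense ranges. The operator `A₀` acts triangularly on `w^j conj(w)^l exp(-B r_⊥²/4) exp(iκz)`, so a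
vector orthogonal to the range of `A₀ - it`, `t ≠ 0`, has vanishing moments against all these
functions (`gaussMoment_recursion`). Such a vector is zero, by injectivity of the Fourier transform
in the plane and Parseval's identity in `z` (`ae_eq_zero_of_gaussMoment_eq_zero`); the same totality
makes the core dense. A Kato–Rellich argument keeps the ranges of `H ∓ it` dense for large `t`
(`range_orthogonal_eq_bot_of_relatively_bounded`), and for a closed symmetric operator this makes
`±it` resolvent points, which gives self-adjointness.

Compactness. The norm of `(H - it)ψ` controls both `sup |ψ|` and `‖r_⊥² ψ‖`. Boundedness of point
evaluations gives a Hilbert–Schmidt type bound on each bounded region of the cell, and the weight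
`r_⊥²` makes the remaining mass small. The resolvent is therefore a norm limit of finite rank
operators (`exists_small_of_graph_bound`, `isCompactOperator_of_small_on_orthogonal`), and
compactness of one resolvent gives discrete spectrum. -/

theorem norm_sq_sub_imaginary_smul {u v : E} (h : ⟪u, v⟫ = ⟪v, u⟫) (t : ℝ) :
    ‖u - (t * Complex.I : ℂ) • v‖ ^ 2 = ‖u‖ ^ 2 + t ^ 2 * ‖v‖ ^ 2 := by
  have him : (⟪u, v⟫).im = 0 := by
    have h1 := inner_conj_symm (𝕜 := ℂ) u v
    rw [← h] at h1
    exact Complex.conj_eq_iff_im.1 h1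
  rw [@norm_sub_sq ℂ, inner_smul_right, norm_smul]
  have h2 : RCLike.re ((t * Complex.I : ℂ) * ⟪u, v⟫) = 0 := by
    simp [him]
  rw [h2]
  simp [mul_pow]

/-- The map `(f, T f) ↦ T f - c f` is antilipschitz on the graph, which is complete because `T` is
closed. Its range is therefore closed, and being dense it is everything. The lower bound also gives
injectivity and the bound `δ⁻¹` for the inverse. -/
theorem isResolventPoint_of_bounded_below [CompleteSpace E] {T : E →ₗ.[ℂ] E} (hT : T.IsClosed)
    {c : ℂ} {δ : ℝ} (hδ : 0 < δ) (hb : ∀ f : T.domain, δ * ‖(f : E)‖ ≤ ‖T f - c • (f : E)‖)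
    (hd : Dense (range fun f : T.domain => T f - c • (f : E))) : IsResolventPoint T c := by
  let Ψ : T.graph →L[ℂ] E := ((ContinuousLinearMap.snd ℂ E E) -
    c • (ContinuousLinearMap.fst ℂ E E)).comp T.graph.subtypeL
  have hΨ : ∀ p : T.graph, Ψ p = p.1.2 - c • p.1.1 := fun p => rfl
  have hanti : ∀ p : T.graph, ‖p‖ ≤ (δ⁻¹ + 1 + ‖c‖ * δ⁻¹) * ‖Ψ p‖ := by
    rintro ⟨⟨x, y⟩, hp⟩
    obtain ⟨f, rfl, rfl⟩ := (LinearPMap.mem_graph_iff T).1 hp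
    have h1 : ‖(f : E)‖ ≤ δ⁻¹ * ‖T f - c • (f : E)‖ := by
      rw [inv_mul_eq_div, le_div_iff₀ hδ, mul_comm]
      exact hb f
    have h2 : ‖T f‖ ≤ ‖T f - c • (f : E)‖ + ‖c‖ * ‖(f : E)‖ := by
      have := norm_add_le (T f - c • (f : E)) (c • (f : E))
      rwa [sub_add_cancel, norm_smul] at this
    have h3 : 0 ≤ ‖T f - c • (f : E)‖ := norm_nonneg _
    have h4 : 0 ≤ ‖c‖ := norm_nonneg _
    have h5 : 0 ≤ δ⁻¹ := by positivity
    have h6 := mul_le_mul_of_nonneg_left h1 h4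
    change max ‖(f : E)‖ ‖T f‖ ≤ (δ⁻¹ + 1 + ‖c‖ * δ⁻¹) * ‖T f - c • (f : E)‖
    apply max_le
    · nlinarith [mul_nonneg (mul_nonneg h4 h5) h3]
    · nlinarith [mul_nonneg h5 h3]
  have hK : 0 ≤ δ⁻¹ + 1 + ‖c‖ * δ⁻¹ := by positivity
  have hanti' : AntilipschitzWith ⟨δ⁻¹ + 1 + ‖c‖ * δ⁻¹, hK⟩ Ψ :=
    Ψ.antilipschitz_of_bound hanti
  have : CompleteSpace T.graph := completeSpace_coe_iff_isComplete.2 (IsClosed.isComplete hT)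
  have hcl := hanti'.isClosed_range Ψ.uniformContinuous
  have hsurj : ∀ y, ∃ f : T.domain, T f - c • (f : E) = y := by
    intro y
    have hsub : range (fun f : T.domain => T f - c • (f : E)) ⊆ range Ψ := by
      rintro _ ⟨f, rfl⟩
      exact ⟨⟨(f, T f), T.mem_graph f⟩, rfl⟩
    have hy : y ∈ range Ψ := by
      have := closure_minimal hsub hcl (hd y)
      exact this
    obtain ⟨⟨⟨u, v⟩, hp⟩, rfl⟩ := hy
    obtain ⟨f, rfl, rfl⟩ := (LinearPMap.mem_graph_iff T).1 hp
    exact ⟨f, rfl⟩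
  let Φ : T.domain →ₗ[ℂ] E := T.toFun - c • T.domain.subtype
  have hΦ : ∀ f, Φ f = T f - c • (f : E) := fun f => rfl
  have hinj : Function.Injective Φ := by
    rw [injective_iff_map_eq_zero]
    intro f hf
    have := hb f
    rw [← hΦ, hf, norm_zero] at this
    have h0 : ‖(f : E)‖ ≤ 0 := by nlinarith
    exact Subtype.ext (norm_le_zero_iff.1 h0)
  let e := LinearEquiv.ofBijective Φ ⟨hinj, fun y => hsurj y⟩
  have he : ∀ g, T (e.symm g) - c • (e.symm g : E) = g := fun g => e.apply_symm_apply g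
  refine ⟨LinearMap.mkContinuous (T.domain.subtype ∘ₗ e.symm.toLinearMap) δ⁻¹ fun g => ?_,
    fun g => ⟨(e.symm g).2, he g⟩, fun f => ?_⟩
  · have := hb (e.symm g)
    rw [he g] at this
    rw [inv_mul_eq_div, le_div_iff₀ hδ, mul_comm]
    exact this
  · have : e.symm (T f - c • (f : E)) = f := e.symm_apply_apply f
    simp [this]

/-- For `y` in the domain of the adjoint, solve `(T - c) f = (T* - c) y` with `f` in the domain of
`T`. Then `y - f` is killed by `T* - c`, hence orthogonal to the range of `T - conj c`, which is the
whole space. So `y = f`. -/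
theorem isSelfAdjoint_of_resolvent [CompleteSpace E] {T : E →ₗ.[ℂ] E}
    (hd : Dense (T.domain : Set E)) (hs : T.IsFormalAdjoint T) {c : ℂ}
    (h1 : IsResolventPoint T c) (h2 : IsResolventPoint T (starRingEnd ℂ c)) :
    IsSelfAdjoint T := by
  rw [LinearPMap.isSelfAdjoint_def]
  have hle : T ≤ T.adjoint := hs.le_adjoint hd
  refine (le_antisymm hle ?_).symm
  obtain ⟨S, hS, -⟩ := h1
  obtain ⟨S', hS', -⟩ := h2
  refine ⟨fun y hy => ?_, ?_⟩
  · obtain ⟨hf, hf'⟩ := hS (T.adjoint ⟨y, hy⟩ - c • y)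
    set f := S (T.adjoint ⟨y, hy⟩ - c • y)
    obtain ⟨hx, hx'⟩ := hS' (y - f)
    set x := S' (y - f)
    have hzero : ⟪y - f, y - f⟫ = 0 := by
      have e1 : ⟪T.adjoint ⟨y, hy⟩, x⟫ = ⟪y, T ⟨x, hx⟩⟫ :=
        LinearPMap.adjoint_isFormalAdjoint hd ⟨y, hy⟩ ⟨x, hx⟩
      have e2 : ⟪T ⟨f, hf⟩, x⟫ = ⟪f, T ⟨x, hx⟩⟫ := hs ⟨f, hf⟩ ⟨x, hx⟩
      have e3 := congrArg (fun u => ⟪u, x⟫) hf'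
      simp only [inner_sub_left, inner_smul_left] at e3
      nth_rewrite 2 [← hx']
      simp only [inner_sub_left, inner_sub_right, inner_smul_right]
      rw [e1, e2] at e3
      linear_combination -e3
    have := sub_eq_zero.1 (inner_self_eq_zero.1 hzero)
    rw [this]
    exact hf
  · intro x y hxy
    exact (hle.2 hxy.symm).symm

/-- With `P` the orthogonal projection onto `W`, the operator `S P` has finite rank, and `S - S P`
sends `u` to `S (u - P u)`. For `u ∈ D` the vector `u - P u` stays in `D` because `W ≤ D`; density
of `D` extends the bound to all `u`. Thus `S` is a norm limit of finite rank operators. -/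
theorem isCompactOperator_of_small_on_orthogonal [CompleteSpace E] (S : E →L[ℂ] E)
    (D : Submodule ℂ E) (hD : Dense (D : Set E))
    (h : ∀ ε > 0, ∃ W ≤ D, FiniteDimensional ℂ W ∧ ∀ u ∈ D, u ∈ Wᗮ → ‖S u‖ ≤ ε * ‖u‖) :
    IsCompactOperator S := by
  have key : ∀ n : ℕ, ∃ F : E →L[ℂ] E, IsCompactOperator F ∧ ‖F - S‖ ≤ 1 / (n + 1 : ℝ) := by
    intro n
    obtain ⟨W, hWD, hfin, hW⟩ := h (1 / (n + 1 : ℝ)) (by positivity)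
    let F : E →L[ℂ] E := S.comp (W.subtypeL.comp W.orthogonalProjectionOnto)
    refine ⟨F, ?_, ?_⟩
    · have h1 : IsCompactOperator W.orthogonalProjectionOnto := by
        have : ProperSpace W := FiniteDimensional.proper ℂ W
        exact isCompactOperator_of_locallyCompactSpace_dom
          W.orthogonalProjectionOnto
      exact h1.clm_comp (S.comp W.subtypeL)
    · refine ContinuousLinearMap.opNorm_le_bound _ (by positivity) fun u => ?_
      have hcl : IsClosed {u : E | ‖(F - S) u‖ ≤ 1 / (n + 1 : ℝ) * ‖u‖} :=
        isClosed_le (by fun_prop) (by fun_prop)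
      refine closure_minimal (fun u hu => ?_) hcl (hD u)
      have hp : u - W.starProjection u ∈ Wᗮ := W.sub_starProjection_mem_orthogonal u
      have hp' : W.starProjection u ∈ W := W.starProjection_apply_mem u
      have h2 := hW _ (D.sub_mem hu (hWD hp')) hp
      have h3 : ‖u - W.starProjection u‖ ≤ ‖u‖ := by
        have h4 := W.norm_sq_eq_add_norm_sq_starProjection u
        have h5 : Wᗮ.starProjection u = u - W.starProjection u := by
          rw [Submodule.starProjection_orthogonal_val]
        rw [h5] at h4
        nlinarith [norm_nonneg u, norm_nonneg (u - W.starProjection u),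
          sq_nonneg ‖W.starProjection u‖]
      have h6 : (F - S) u = -(S (u - W.starProjection u)) := by
        simp [F, map_sub]
      change ‖(F - S) u‖ ≤ _
      rw [h6, norm_neg]
      exact h2.trans (mul_le_mul_of_nonneg_left h3 (by positivity))
  choose F hF hF' using key
  refine isCompactOperator_of_tendsto (l := atTop) (F := F) ?_ (Eventually.of_forall hF)
  rw [tendsto_iff_norm_sub_tendsto_zero]
  exact squeeze_zero (fun _ => norm_nonneg _) hF' tendsto_one_div_add_atTop_nhds_zero_nat

/-- A quadratic expression with uniformly bounded sums over orthonormal families is small on the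
orthogonal complement of a finite dimensional space. -/
theorem exists_finiteDimensional_small (D : Submodule ℂ E) (N : E → ℝ) (M : ℝ)
    (hN : ∀ (c : ℂ) (u : E), N (c • u) = ‖c‖ ^ 2 * N u)
    (hM : ∀ (n : ℕ) (f : Fin n → E), Orthonormal ℂ f → (∀ i, f i ∈ D) → ∑ i, N (f i) ≤ M)
    {ε : ℝ} (hε : 0 < ε) :
    ∃ W ≤ D, FiniteDimensional ℂ W ∧ ∀ u ∈ D, u ∈ Wᗮ → N u ≤ ε * ‖u‖ ^ 2 := by
  let s : Set ℝ := {x | ∃ (n : ℕ) (f : Fin n → E), Orthonormal ℂ f ∧ (∀ i, f i ∈ D) ∧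
    x = ∑ i, N (f i)}
  have hne : s.Nonempty :=
    ⟨_, 0, Fin.elim0, ⟨fun i => i.elim0, fun i => i.elim0⟩, fun i => i.elim0, rfl⟩
  have hbdd : BddAbove s := ⟨M, by rintro _ ⟨n, f, h1, h2, rfl⟩; exact hM n f h1 h2⟩
  -- Choose an orthonormal family whose sum is within `ε` of the supremum, and let `W` be its span.
  -- A unit vector of `D` orthogonal to `W` can be adjoined to the family, so it contributes less
  -- than `ε`.
  obtain ⟨_, ⟨n, f, hf, hfD, rfl⟩, hlt⟩ := exists_lt_of_lt_csSup hne (sub_lt_self (sSup s) hε)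
  refine ⟨Submodule.span ℂ (range f), Submodule.span_le.2 ?_, ?_, fun u hu huW => ?_⟩
  · rintro _ ⟨i, rfl⟩
    exact hfD i
  · exact FiniteDimensional.span_of_finite ℂ (finite_range f)
  · rcases eq_or_ne u 0 with rfl | hu0
    · have h0 : N 0 = 0 := by
        have := hN 0 0
        rw [smul_zero, norm_zero] at this
        linarith
      rw [h0]
      positivity
    have hun : ‖u‖ ≠ 0 := norm_ne_zero_iff.2 hu0
    set v : E := ((‖u‖⁻¹ : ℝ) : ℂ) • u
    have hv : ‖v‖ = 1 := by
      rw [norm_smul, Complex.norm_real, norm_inv, norm_norm, inv_mul_cancel₀ hun]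
    have horth : Orthonormal ℂ (Matrix.vecCons v f) := by
      rw [orthonormal_vecCons_iff]
      refine ⟨hv, fun i => ?_, hf⟩
      have := (Submodule.mem_orthogonal' _ u).1 huW (f i)
        (Submodule.subset_span (mem_range_self i))
      rw [inner_smul_left, this, mul_zero]
    have hmem : N v + ∑ i, N (f i) ∈ s := by
      refine ⟨n + 1, Matrix.vecCons v f, horth, fun i => ?_, ?_⟩
      · refine Fin.cases ?_ (fun j => ?_) i
        · exact D.smul_mem _ hu
        · exact hfD j
      · rw [Fin.sum_univ_succ]
        rfl
    have h1 := le_csSup hbdd hmem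
    have h2 : N v < ε := by linarith
    have h3 : N u = ‖u‖ ^ 2 * N v := by
      have : u = ((‖u‖ : ℝ) : ℂ) • v := by
        simp only [v]
        rw [smul_smul, ← Complex.ofReal_mul, mul_inv_cancel₀ hun]
        simp
      nth_rewrite 1 [this]
      rw [hN]
      simp
    rw [h3, mul_comm]
    exact mul_le_mul_of_nonneg_right h2.le (by positivity)

/-- Relatively bounded perturbations with bound less than one preserve density of the range. -/
theorem range_orthogonal_eq_bot_of_relatively_bounded {D : Type*} [AddCommGroup D] [Module ℂ D]
    [CompleteSpace E] (J A₀ A : D →ₗ[ℂ] E) (hs : ∀ x, ⟪A₀ x, J x⟫ = ⟪J x, A₀ x⟫) {θ b t : ℝ}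
    (hθ : 0 ≤ θ) (hb : 0 ≤ b) (ht : t ≠ 0)
    (hA : ∀ x, ‖A x - A₀ x‖ ≤ θ * ‖A₀ x‖ + b * ‖J x‖) (hlt : θ + b / |t| < 1)
    (h0 : (LinearMap.range (A₀ - (t * Complex.I : ℂ) • J))ᗮ = ⊥) :
    (LinearMap.range (A - (t * Complex.I : ℂ) • J))ᗮ = ⊥ := by
  rw [Submodule.eq_bot_iff]
  intro v hv
  have hdense : (LinearMap.range (A₀ - (t * Complex.I : ℂ) • J)).topologicalClosure = ⊤ := by
    rw [Submodule.topologicalClosure_eq_top_iff]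
    exact h0
  -- Let `w = (A₀ - it) x`. As `v` is orthogonal to `(A - it) x`, the product `⟪v, w⟫` equals `-⟪v,
  -- (A - A₀) x⟫`, and `‖w‖² = ‖A₀ x‖² + t² ‖J x‖²` bounds both terms of the relative bound.
  have hbound : ∀ w ∈ LinearMap.range (A₀ - (t * Complex.I : ℂ) • J),
      ‖⟪v, w⟫‖ ≤ ‖v‖ * ((θ + b / |t|) * ‖w‖) := by
    rintro _ ⟨x, rfl⟩
    have e1 : ⟪v, (A - (t * Complex.I : ℂ) • J) x⟫ = 0 :=
      (Submodule.mem_orthogonal' _ v).1 hv _ (LinearMap.mem_range_self _ x)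
    have e2 : ⟪v, (A₀ - (t * Complex.I : ℂ) • J) x⟫ = -⟪v, A x - A₀ x⟫ := by
      rw [← sub_eq_zero, sub_neg_eq_add, ← inner_add_right, ← e1]
      congr 1
      simp only [LinearMap.sub_apply, LinearMap.smul_apply]
      abel
    have e3 := norm_sq_sub_imaginary_smul (hs x) t
    set w := (A₀ - (t * Complex.I : ℂ) • J) x with hw
    have hw' : A₀ x - (t * Complex.I : ℂ) • J x = w := rfl
    rw [hw'] at e3
    have e4 : ‖A₀ x‖ ≤ ‖w‖ := by
      apply le_of_sq_le_sq _ (norm_nonneg _)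
      nlinarith [mul_nonneg (sq_nonneg t) (sq_nonneg ‖J x‖)]
    have htp : 0 < |t| := abs_pos.2 ht
    have e5 : ‖J x‖ ≤ ‖w‖ / |t| := by
      rw [le_div_iff₀ htp]
      apply le_of_sq_le_sq _ (norm_nonneg _)
      rw [mul_pow, sq_abs]
      nlinarith [sq_nonneg ‖A₀ x‖]
    rw [e2, norm_neg]
    refine (norm_inner_le_norm _ _).trans (mul_le_mul_of_nonneg_left ?_ (norm_nonneg _))
    calc ‖A x - A₀ x‖ ≤ θ * ‖A₀ x‖ + b * ‖J x‖ := hA x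
      _ ≤ θ * ‖w‖ + b * (‖w‖ / |t|) := by gcongr
      _ = (θ + b / |t|) * ‖w‖ := by ring
  -- The vectors `w` are dense, so `w = v` is allowed; the factor below one then forces `v = 0`.
  have hv' : ‖⟪v, v⟫‖ ≤ ‖v‖ * ((θ + b / |t|) * ‖v‖) := by
    have hcl : IsClosed {w : E | ‖⟪v, w⟫‖ ≤ ‖v‖ * ((θ + b / |t|) * ‖w‖)} :=
      isClosed_le (by fun_prop) (by fun_prop)
    refine closure_minimal hbound hcl ?_
    rw [← Submodule.topologicalClosure_coe, hdense]
    trivial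
  rw [inner_self_eq_norm_sq_to_K] at hv'
  simp only [norm_pow, Complex.coe_algebraMap, Complex.norm_real, norm_norm] at hv'
  by_contra hne
  have : 0 < ‖v‖ := norm_pos_iff.2 hne
  nlinarith [mul_pos this this]

end Abstract

/-! ### Compact resolvents, discrete spectrum, and the criterion on a core -/

section Abstract

open Filter Topology InnerProductSpace
open scoped ComplexInnerProductSpace

variable {E : Type*} [NormedAddCommGroup E] [InnerProductSpace ℂ E]

/-- Since `(T - c) S = (c - c₀) (ζ - S)` with `ζ = (c - c₀)⁻¹`, the inverse of `T - c` is `ζ S (ζ -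
S)⁻¹`. -/
theorem isResolventPoint_of_mem_resolventSet {T : E →ₗ.[ℂ] E} {c₀ c : ℂ} {S : E →L[ℂ] E}
    (h1 : ∀ g, ∃ h : S g ∈ T.domain, T ⟨S g, h⟩ - c₀ • S g = g)
    (h2 : ∀ f : T.domain, S (T f - c₀ • (f : E)) = f) (hc : c ≠ c₀)
    (hS : (c - c₀)⁻¹ ∈ resolventSet ℂ S) : IsResolventPoint T c := by
  have hc' : c - c₀ ≠ 0 := sub_ne_zero.2 hc
  rw [spectrum.mem_resolventSet_iff] at hS
  set ζ := (c - c₀)⁻¹ with hζ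
  have hζc : (c - c₀) * ζ = 1 := mul_inv_cancel₀ hc'
  obtain ⟨U, hU1, hU2⟩ := isUnit_iff_exists.1 hS
  have k1 : ∀ g, ζ • U g - S (U g) = g := fun g => by
    have := DFunLike.congr_fun hU1 g
    simpa [Algebra.algebraMap_eq_smul_one] using this
  have k2 : ∀ g, U (ζ • g - S g) = g := fun g => by
    have := DFunLike.congr_fun hU2 g
    simpa [Algebra.algebraMap_eq_smul_one] using this
  have hcomm : ∀ g, U (S g) = S (U g) := fun g => by
    have e := k2 (S (U g))
    rw [← map_smul, ← map_sub, k1] at e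
    exact e
  refine ⟨ζ • S.comp U, fun g => ?_, fun f => ?_⟩
  · obtain ⟨h, hT⟩ := h1 (ζ • U g)
    have e : (ζ • S.comp U) g = S (ζ • U g) := by simp
    rw [e]
    refine ⟨h, ?_⟩
    have : T ⟨S (ζ • U g), h⟩ = ζ • U g + c₀ • S (ζ • U g) := by
      rw [← sub_eq_iff_eq_add, hT]
    rw [this]
    have e2 : ζ • U g + c₀ • S (ζ • U g) - c • S (ζ • U g) =
        ζ • U g - ((c - c₀) * ζ) • S (U g) := by
      rw [map_smul]
      module
    rw [e2, hζc, one_smul, k1]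
  · have e : (ζ • S.comp U) (T f - c • (f : E)) = ζ • U (S (T f - c • (f : E))) := by
      simp [hcomm]
    have e2 : T f - c • (f : E) = (T f - c₀ • (f : E)) - (c - c₀) • (f : E) := by module
    rw [e, e2, map_sub, h2, map_smul, ← map_smul]
    have e3 : ζ • ((f : E) - (c - c₀) • S f) = ζ • (f : E) - ((c - c₀) * ζ) • S f := by module
    rw [e3, hζc, one_smul, k2]

/-- A symmetric operator with a compact resolvent has discrete spectrum. -/
theorem hasDiscreteSpectrum_of_isCompactOperator [CompleteSpace E] {T : E →ₗ.[ℂ] E}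
    (hs : T.IsFormalAdjoint T) {c₀ : ℂ} {S : E →L[ℂ] E}
    (h1 : ∀ g, ∃ h : S g ∈ T.domain, T ⟨S g, h⟩ - c₀ • S g = g)
    (h2 : ∀ f : T.domain, S (T f - c₀ • (f : E)) = f) (hS : IsCompactOperator S) :
    HasDiscreteSpectrum T := by
  have hev : ∀ c (f : T.domain), T f = c • (f : E) → (c - c₀) • S f = f := fun c f hf => by
    have := h2 f
    rwa [hf, ← sub_smul, map_smul] at this
  have hres : IsResolventPoint T c₀ := ⟨S, h1, h2⟩
  have hspec : ∀ c ∈ unboundedSpectrum T, c ≠ c₀ ∧ ∃ f : T.domain, T f = c • (f : E) ∧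
      (f : E) ≠ 0 := by
    intro c hc
    have hne : c ≠ c₀ := by rintro rfl; exact hc hres
    have hne' : c - c₀ ≠ 0 := sub_ne_zero.2 hne
    refine ⟨hne, ?_⟩
    -- Fredholm alternative for the compact `S` at the nonzero number `(c - c₀)⁻¹`: an eigenvector
    -- `v` of `S` yields the eigenvector `S v` of `T`, and the other case contradicts `c` being in
    -- the spectrum.
    rcases hS.hasEigenvalue_or_mem_resolventSet (μ := (c - c₀)⁻¹) (inv_ne_zero hne') with h | h
    · obtain ⟨v, hv⟩ := h.exists_hasEigenvector
      have hSv : S v = (c - c₀)⁻¹ • v := hv.apply_eq_smul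
      obtain ⟨hm, hT⟩ := h1 v
      refine ⟨⟨S v, hm⟩, ?_, ?_⟩
      · rw [← sub_eq_zero]
        have : T ⟨S v, hm⟩ - c • S v = (T ⟨S v, hm⟩ - c₀ • S v) - (c - c₀) • S v := by module
        rw [this, hT, hSv, smul_inv_smul₀ hne', sub_self]
      · change S v ≠ 0
        rw [hSv]
        exact smul_ne_zero (inv_ne_zero hne') hv.2
    · exact absurd (isResolventPoint_of_mem_resolventSet h1 h2 hne h) hc
  have hreal : ∀ c ∈ unboundedSpectrum T, starRingEnd ℂ c = c := by
    intro c hc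
    obtain ⟨-, f, hf, hf0⟩ := hspec c hc
    have := hs f f
    rw [hf, inner_smul_left, inner_smul_right] at this
    exact mul_right_cancel₀ (inner_self_ne_zero.2 hf0) this
  have horth : ∀ c ∈ unboundedSpectrum T, ∀ c' ∈ unboundedSpectrum T, c ≠ c' →
      ∀ f g : T.domain, T f = c • (f : E) → T g = c' • (g : E) → ⟪(f : E), (g : E)⟫ = 0 := by
    intro c hc c' hc' hne f g hf hg
    have := hs f g
    rw [hf, hg, inner_smul_left, inner_smul_right, hreal c hc, ← sub_eq_zero, ← sub_mul] at this
    exact (mul_eq_zero.1 this).resolve_left (sub_ne_zero.2 hne)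
  -- Infinitely many spectral points in a disc would give an orthonormal sequence of eigenvectors
  -- whose images under `S` are orthogonal with norms at least `L⁻¹`. No subsequence of these images
  -- is Cauchy, against compactness.
  have hfin : ∀ L : ℝ, (unboundedSpectrum T ∩ {c | ‖c - c₀‖ ≤ L}).Finite := by
    intro L
    by_contra hinf
    have hinf' : (unboundedSpectrum T ∩ {c | ‖c - c₀‖ ≤ L}).Infinite := hinf
    let e := hinf'.natEmbedding
    have hex : ∀ n, ∃ f : T.domain, T f = (e n : ℂ) • (f : E) ∧ ‖(f : E)‖ = 1 := by
      intro n
      obtain ⟨-, f, hf, hf0⟩ := hspec _ (e n).2.1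
      have hf1 : ‖(f : E)‖ ≠ 0 := norm_ne_zero_iff.2 hf0
      refine ⟨((‖(f : E)‖⁻¹ : ℝ) : ℂ) • f, ?_, ?_⟩
      · rw [LinearPMap.map_smul, hf, Submodule.coe_smul, smul_comm]
      · rw [Submodule.coe_smul, norm_smul, Complex.norm_real, norm_inv, norm_norm,
          inv_mul_cancel₀ hf1]
    choose f hf hf1 using hex
    have hpos : ∀ n, 0 < ‖(e n : ℂ) - c₀‖ := fun n =>
      norm_pos_iff.2 (sub_ne_zero.2 (hspec _ (e n).2.1).1)
    have hLpos : 0 < L := (hpos 0).trans_le (e 0).2.2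
    have hSf : ∀ n, S (f n) = ((e n : ℂ) - c₀)⁻¹ • (f n : E) := fun n => by
      rw [eq_inv_smul_iff₀ (norm_pos_iff.1 (hpos n))]
      exact hev _ _ (hf n)
    obtain ⟨K, hK, hK'⟩ := hS.image_closedBall_subset_compact (𝕜₁ := ℂ) (f := (S : E →ₗ[ℂ] E)) 1
    obtain ⟨y, -, ψ, hψ, hlim⟩ := hK.tendsto_subseq (x := fun n => S (f n))
      (fun n => hK' ⟨f n, by simp [hf1], rfl⟩)
    have hc := hlim.cauchySeq
    rw [Metric.cauchySeq_iff] at hc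
    obtain ⟨N, hN⟩ := hc L⁻¹ (inv_pos.2 hLpos)
    have hd := hN N le_rfl (N + 1) (Nat.le_succ N)
    simp only [Function.comp_apply] at hd
    set p := ψ N
    set q := ψ (N + 1)
    have hpq : (e p : ℂ) ≠ e q := fun h => by
      have h' : p = q := e.injective (Subtype.ext h)
      exact absurd (hψ.injective h') (Nat.lt_succ_self N).ne
    have ho := horth _ (e p).2.1 _ (e q).2.1 hpq (f p) (f q) (hf p) (hf q)
    have hn : ‖S (f p) - S (f q)‖ ^ 2 = ‖S (f p)‖ ^ 2 + ‖S (f q)‖ ^ 2 := by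
      rw [@norm_sub_sq ℂ, hSf, hSf, inner_smul_left, inner_smul_right, ho]
      simp
    have hlow : L⁻¹ ≤ ‖S (f p)‖ := by
      rw [hSf, norm_smul, hf1, mul_one, norm_inv]
      exact inv_anti₀ (hpos p) (e p).2.2
    rw [dist_eq_norm] at hd
    have hL' : 0 < L⁻¹ := inv_pos.2 hLpos
    nlinarith [norm_nonneg (S (f p) - S (f q)), sq_nonneg ‖S (f q)‖]
  intro c hc
  obtain ⟨hne, f, hf, hf0⟩ := hspec c hc
  have hne' : c - c₀ ≠ 0 := sub_ne_zero.2 hne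
  refine ⟨?_, ?_, ?_⟩
  · have hF : ((unboundedSpectrum T ∩ {c' | ‖c' - c₀‖ ≤ ‖c - c₀‖ + 1}) \ {c}).Finite :=
      (hfin _).subset sdiff_subset
    have hopen : (((unboundedSpectrum T ∩ {c' | ‖c' - c₀‖ ≤ ‖c - c₀‖ + 1}) \ {c})ᶜ) ∈ 𝓝 c :=
      hF.isClosed.isOpen_compl.mem_nhds (by simp)
    obtain ⟨ε, hε, hball⟩ := Metric.mem_nhds_iff.1 hopen
    -- The minimum with `1` keeps `c'` inside the disc of radius `‖c - c₀‖ + 1`, where finiteness is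
    -- used.
    refine ⟨min ε 1, lt_min hε one_pos, fun c' hc' hcc' => ?_⟩
    by_contra! hlt
    have hlt1 : ‖c' - c‖ < ε := hlt.trans_le (min_le_left _ _)
    have hlt2 : ‖c' - c‖ < 1 := hlt.trans_le (min_le_right _ _)
    refine hball (by rwa [Metric.mem_ball, dist_eq_norm]) ⟨⟨hc', ?_⟩, hcc'⟩
    have := norm_add_le (c' - c) (c - c₀)
    rw [sub_add_sub_cancel] at this
    change ‖c' - c₀‖ ≤ ‖c - c₀‖ + 1
    linarith
  · rw [Submodule.ne_bot_iff]
    refine ⟨f, ?_, fun h => hf0 (by rw [h]; rfl)⟩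
    rw [eigenspace, LinearMap.mem_ker]
    simpa [sub_eq_zero] using hf
  -- On `K` the compact operator `(c - c₀) S` is the identity, so `K` is finite dimensional; the
  -- eigenspace of `T` embeds in `K`.
  · let K : Submodule ℂ E := LinearMap.ker ((S : E →ₗ[ℂ] E) - (c - c₀)⁻¹ • LinearMap.id)
    have hK : ∀ x, x ∈ K ↔ S x = (c - c₀)⁻¹ • x := fun x => by
      simp [K, LinearMap.mem_ker, sub_eq_zero]
    have hKfin : FiniteDimensional ℂ K := by
      refine FiniteDimensional.of_isCompactOperator_id (𝕜 := ℂ) ?_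
      have hclosed : IsClosed (K : Set E) := by
        have : (K : Set E) = {x | S x = (c - c₀)⁻¹ • x} := by
          ext x
          exact hK x
        rw [this]
        exact isClosed_eq (by fun_prop) (by fun_prop)
      have hcK : IsCompactOperator ((c - c₀) • ((S : E →ₗ[ℂ] E))) := hS.smul (c - c₀)
      have hmap : ∀ v ∈ K, ((c - c₀) • (S : E →ₗ[ℂ] E)) v ∈ K := fun v hv => by
        have : ((c - c₀) • (S : E →ₗ[ℂ] E)) v = v := by
          simp [(hK v).1 hv, smul_inv_smul₀ hne']
        rwa [this]
      have := hcK.restrict hmap hclosed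
      have hid : (id : K → K) = ((c - c₀) • (S : E →ₗ[ℂ] E)).restrict hmap := by
        funext v
        refine Subtype.ext ?_
        simp [(hK v).1 v.2, smul_inv_smul₀ hne']
      rw [hid]
      exact this
    have hmem : ∀ g : eigenspace T c, ((g : T.domain) : E) ∈ K := fun g => by
      have hg : T g = c • ((g : T.domain) : E) := by
        have : (T.toFun - c • T.domain.subtype) g = 0 := LinearMap.mem_ker.1 g.2
        simpa [sub_eq_zero] using this
      rw [hK, eq_inv_smul_iff₀ hne']
      exact hev c g hg
    let ι : eigenspace T c →ₗ[ℂ] K :=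
      LinearMap.codRestrict K (T.domain.subtype ∘ₗ (eigenspace T c).subtype) hmem
    refine FiniteDimensional.of_injective ι fun g g' h => ?_
    exact Subtype.ext (Subtype.ext (congrArg (fun k : K => (k : E)) h))

/-- A criterion for essential self-adjointness and discreteness of the spectrum, in terms of the
values of an operator on a core. -/
theorem isSelfAdjoint_and_hasDiscreteSpectrum_of_core [CompleteSpace E] {D : Type*}
    [AddCommGroup D] [Module ℂ D] (J A : D →ₗ[ℂ] E) {T₀ : E →ₗ.[ℂ] E}
    (hg : T₀.graph = LinearMap.range (J.prod A)) (hJ : Dense (range J))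
    (hs : ∀ x y, ⟪A x, J y⟫ = ⟪J x, A y⟫) {t : ℝ} (ht : 0 < t)
    (hr : (LinearMap.range (A - (t * Complex.I : ℂ) • J))ᗮ = ⊥)
    (hr' : (LinearMap.range (A - ((-t : ℝ) * Complex.I : ℂ) • J))ᗮ = ⊥)
    (hc : ∀ ε > 0, ∃ W ≤ LinearMap.range (A - (t * Complex.I : ℂ) • J), FiniteDimensional ℂ W ∧
      ∀ x, (A - (t * Complex.I : ℂ) • J) x ∈ Wᗮ →
        ‖J x‖ ≤ ε * ‖(A - (t * Complex.I : ℂ) • J) x‖) :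
    IsSelfAdjoint T₀.closure ∧ HasDiscreteSpectrum T₀.closure := by
  have hJA : ∀ x, ∃ h : J x ∈ T₀.domain, T₀ ⟨J x, h⟩ = A x := fun x => by
    have : (J x, A x) ∈ T₀.graph := by rw [hg]; exact ⟨x, rfl⟩
    obtain ⟨f, hf1, hf2⟩ := (LinearPMap.mem_graph_iff T₀).1 this
    simp only at hf1 hf2
    exact ⟨hf1 ▸ f.2, by rw [← hf2]; congr 1; exact Subtype.ext hf1.symm⟩
  have hAJ : ∀ f : T₀.domain, ∃ x, J x = f ∧ A x = T₀ f := fun f => by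
    have := T₀.mem_graph f
    rw [hg] at this
    obtain ⟨x, hx⟩ := this
    exact ⟨x, congrArg Prod.fst hx, congrArg Prod.snd hx⟩
  have hd₀ : Dense (T₀.domain : Set E) := hJ.mono (by
    rintro _ ⟨x, rfl⟩
    exact (hJA x).1)
  have hs₀ : T₀.IsFormalAdjoint T₀ := fun f g => by
    obtain ⟨x, hx, hx'⟩ := hAJ f
    obtain ⟨y, hy, hy'⟩ := hAJ g
    rw [← hx, ← hx', ← hy, ← hy', hs]
  -- A symmetric densely defined operator lies below its adjoint, which is closed.
  have hcl₀ : T₀.IsClosable :=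
    (LinearPMap.adjoint_isClosed hd₀).isClosable.leIsClosable (hs₀.le_adjoint hd₀)
  set T := T₀.closure with hT
  have hle : T₀ ≤ T := T₀.le_closure
  have hclosed : T.IsClosed := hcl₀.closure_isClosed
  have hgraph : (T.graph : Set (E × E)) = closure (T₀.graph : Set (E × E)) := by
    rw [← hcl₀.graph_closure_eq_closure_graph]
    rfl
  -- Closed conditions on pairs pass from the core to the graph of the closure. Applied once in each
  -- variable, this makes `T` symmetric.
  have hind : ∀ P : E × E → Prop, IsClosed {p | P p} → (∀ x, P (J x, A x)) →
      ∀ f : T.domain, P (f, T f) := fun P hP h f => by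
    have hf : ((f : E), T f) ∈ closure (T₀.graph : Set (E × E)) := by
      rw [← hgraph]
      exact T.mem_graph f
    refine closure_minimal ?_ hP hf
    rintro p hp
    rw [hg] at hp
    obtain ⟨x, rfl⟩ := hp
    exact h x
  have hdT : Dense (T.domain : Set E) := hd₀.mono hle.1
  have hsT : T.IsFormalAdjoint T := fun f g => by
    refine hind (fun p => ⟪p.2, (g : E)⟫ = ⟪p.1, T g⟫) (isClosed_eq (by fun_prop) (by fun_prop))
      (fun x => ?_) f
    exact hind (fun p => ⟪A x, p.1⟫ = ⟪J x, p.2⟫) (isClosed_eq (by fun_prop) (by fun_prop))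
      (fun y => hs x y) g
  have hbelow : ∀ (s : ℝ), ∀ f : T.domain, |s| * ‖(f : E)‖ ≤ ‖T f - (s * Complex.I : ℂ) • (f : E)‖ :=
    fun s f => by
      have := norm_sq_sub_imaginary_smul (hsT f f) s
      apply le_of_sq_le_sq _ (norm_nonneg _)
      rw [mul_pow, sq_abs, this]
      nlinarith [sq_nonneg ‖T f‖]
  have hres : ∀ s : ℝ, s ≠ 0 → (LinearMap.range (A - (s * Complex.I : ℂ) • J))ᗮ = ⊥ →
      IsResolventPoint T (s * Complex.I) := fun s hs0 hsr => by
    refine isResolventPoint_of_bounded_below hclosed (abs_pos.2 hs0) (hbelow s) ?_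
    rw [← Submodule.topologicalClosure_eq_top_iff, ← Submodule.dense_iff_topologicalClosure_eq_top]
      at hsr
    refine hsr.mono ?_
    rintro _ ⟨x, rfl⟩
    obtain ⟨h, h'⟩ := hJA x
    refine ⟨⟨J x, hle.1 h⟩, ?_⟩
    have : T ⟨J x, hle.1 h⟩ = A x := by
      rw [← h']
      exact (hle.2 rfl).symm
    simp [this]
  have hres1 := hres t ht.ne' hr
  have hres2 := hres (-t) (neg_ne_zero.2 ht.ne') hr'
  refine ⟨isSelfAdjoint_of_resolvent hdT hsT hres1 ?_, ?_⟩
  · simpa using hres2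
  obtain ⟨S, hS1, hS2⟩ := hres1
  refine hasDiscreteSpectrum_of_isCompactOperator hsT hS1 hS2 ?_
  refine isCompactOperator_of_small_on_orthogonal S
    (LinearMap.range (A - (t * Complex.I : ℂ) • J)) ?_ fun ε hε => ?_
  · rw [Submodule.dense_iff_topologicalClosure_eq_top, Submodule.topologicalClosure_eq_top_iff]
    exact hr
  · obtain ⟨W, hW, hWf, hWc⟩ := hc ε hε
    refine ⟨W, hW, hWf, ?_⟩
    rintro _ ⟨x, rfl⟩ hx
    obtain ⟨h, h'⟩ := hJA x
    have hTx : T ⟨J x, hle.1 h⟩ = A x := by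
      rw [← h']
      exact (hle.2 rfl).symm
    -- The resolvent sends `(A - it) x` to `J x`, so `hc` is exactly smallness of `S` off a finite
    -- dimensional space.
    have := hS2 ⟨J x, hle.1 h⟩
    rw [hTx] at this
    have e : S ((A - (t * Complex.I : ℂ) • J) x) = J x := this
    rw [e]
    exact hWc x hx

end Abstract

/-! ### Calculus on the unit cell -/

theorem cellMeasure_eq_prod (a : ℝ) :
    cellMeasure a = (volume : Measure ℂ).prod ((volume : Measure ℝ).restrict (Ico 0 a)) := by
  rw [cellMeasure, Measure.volume_eq_prod, ← Measure.prod_restrict, Measure.restrict_univ]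

/-- The function vanishes for large `r_⊥`. -/
def BoundedSupport {F : Type*} [Zero F] (u : ℂ × ℝ → F) : Prop :=
  ∃ ρ : ℝ, ∀ w z, ρ < ‖w‖ → u (w, z) = 0

theorem cellMeasure_restrict_le (a : ℝ) : cellMeasure a ≤ volume := Measure.restrict_le_self

/-- Quasi-periodic functions need not have compact support in space, but on the cell nothing is lost
by cutting them off to a compact cylinder. -/
theorem BoundedSupport.ae_eq_indicator {F : Type*} [Zero F] {u : ℂ × ℝ → F}
    (hs : BoundedSupport u) (a : ℝ) : ∃ K : Set (ℂ × ℝ), IsCompact K ∧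
      (K.indicator u) =ᵐ[cellMeasure a] u := by
  obtain ⟨ρ, hρ⟩ := hs
  refine ⟨Metric.closedBall 0 ρ ×ˢ Icc 0 a, (isCompact_closedBall _ _).prod isCompact_Icc, ?_⟩
  filter_upwards [ae_restrict_mem (MeasurableSet.univ.prod measurableSet_Ico)] with p hp
  by_cases h : ‖p.1‖ ≤ ρ
  · rw [indicator_of_mem]
    exact ⟨by simpa using h, Ico_subset_Icc_self hp.2⟩
  · have h0 : u p = 0 := hρ p.1 p.2 (not_le.1 h)
    by_cases hK : p ∈ Metric.closedBall (0 : ℂ) ρ ×ˢ Icc (0 : ℝ) a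
    · rw [indicator_of_mem hK]
    · rw [indicator_of_notMem hK, h0]

theorem integrable_cell {F : Type*} [NormedAddCommGroup F] {u : ℂ × ℝ → F} (a : ℝ)
    (hc : Continuous u) (hs : BoundedSupport u) : Integrable u (cellMeasure a) := by
  obtain ⟨K, hK, hKu⟩ := hs.ae_eq_indicator a
  refine Integrable.congr ?_ hKu
  rw [integrable_indicator_iff hK.measurableSet]
  have h : IntegrableOn u K volume := hc.continuousOn.integrableOn_compact hK
  exact h.mono_measure (cellMeasure_restrict_le a)

theorem memLp_cell {F : Type*} [NormedAddCommGroup F] {u : ℂ × ℝ → F} (a : ℝ)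
    (hc : Continuous u) (hs : BoundedSupport u) : MemLp u 2 (cellMeasure a) := by
  rw [memLp_two_iff_integrable_sq_norm (integrable_cell a hc hs).aestronglyMeasurable]
  refine integrable_cell a (by fun_prop) ?_
  obtain ⟨ρ, hρ⟩ := hs
  exact ⟨ρ, fun w z h => by simp [hρ w z h]⟩

/-- Smooth quasi-periodic functions with bounded support in the perpendicular directions. -/
structure IsBlochSmooth (a : ℝ) (c : ℂ) (u : ℂ × ℝ → ℂ) : Prop where
  smooth : ContDiff ℝ ∞ u
  bloch : ∀ w z, u (w, z + a) = c * u (w, z)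
  support : BoundedSupport u

theorem IsBlochCore.isBlochSmooth {a α : ℝ} {m : ℤ} {ψ : ℂ × ℝ → ℂ} (h : IsBlochCore a α m ψ) :
    IsBlochSmooth a (Complex.exp (Complex.I * α)) ψ := ⟨h.smooth, h.bloch, h.support⟩

namespace IsBlochSmooth

variable {a : ℝ} {c d : ℂ} {u v : ℂ × ℝ → ℂ}

theorem continuous (h : IsBlochSmooth a c u) : Continuous u := h.smooth.continuous

theorem differentiable (h : IsBlochSmooth a c u) : Differentiable ℝ u :=
  h.smooth.differentiable (by simp)

theorem integrable (h : IsBlochSmooth a c u) : Integrable u (cellMeasure a) :=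
  integrable_cell a h.continuous h.support

theorem memLp (h : IsBlochSmooth a c u) : MemLp u 2 (cellMeasure a) :=
  memLp_cell a h.continuous h.support

theorem add (h : IsBlochSmooth a c u) (k : IsBlochSmooth a c v) :
    IsBlochSmooth a c (fun p => u p + v p) := by
  refine ⟨h.smooth.add k.smooth, fun w z => by rw [h.bloch, k.bloch]; ring, ?_⟩
  obtain ⟨ρ, hρ⟩ := h.support
  obtain ⟨σ, hσ⟩ := k.support
  exact ⟨max ρ σ, fun w z hw => by
    simp [hρ w z ((le_max_left _ _).trans_lt hw), hσ w z ((le_max_right _ _).trans_lt hw)]⟩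

theorem mul (h : IsBlochSmooth a c u) (k : IsBlochSmooth a d v) :
    IsBlochSmooth a (c * d) (fun p => u p * v p) := by
  refine ⟨h.smooth.mul k.smooth, fun w z => by rw [h.bloch, k.bloch]; ring, ?_⟩
  obtain ⟨ρ, hρ⟩ := h.support
  exact ⟨ρ, fun w z hw => by simp [hρ w z hw]⟩

theorem smul_fst {g : ℂ → ℂ} (h : IsBlochSmooth a c u) (hg : ContDiff ℝ ∞ g) :
    IsBlochSmooth a c (fun p => g p.1 * u p) := by
  refine ⟨(hg.comp contDiff_fst).mul h.smooth, fun w z => by rw [h.bloch]; ring, ?_⟩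
  obtain ⟨ρ, hρ⟩ := h.support
  exact ⟨ρ, fun w z hw => by simp [hρ w z hw]⟩

theorem conj (h : IsBlochSmooth a c u) :
    IsBlochSmooth a (starRingEnd ℂ c) (fun p => starRingEnd ℂ (u p)) := by
  refine ⟨Complex.conjCLE.contDiff.comp h.smooth, fun w z => by rw [h.bloch, map_mul], ?_⟩
  obtain ⟨ρ, hρ⟩ := h.support
  exact ⟨ρ, fun w z hw => by simp [hρ w z hw]⟩

theorem dir (h : IsBlochSmooth a c u) (e : ℂ × ℝ) :
    IsBlochSmooth a c (fun p => fderiv ℝ u p e) := by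
  refine ⟨contDiff_dir h.smooth e, fun w z => ?_, ?_⟩
  · have h1 : (fun p : ℂ × ℝ => u (p + (0, a))) = fun p => c * u p := by
      funext p
      have h3 : p + (0, a) = (p.1, p.2 + a) := by ext <;> simp
      rw [h3, h.bloch]
    have h2 := DFunLike.congr_fun (congrArg (fun f => fderiv ℝ f (w, z)) h1) e
    rw [fderiv_comp_add_right, fderiv_const_mul (h.differentiable _)] at h2
    simpa using h2
  · obtain ⟨ρ, hρ⟩ := h.support
    refine ⟨ρ, fun w z hw => ?_⟩
    have : u =ᶠ[nhds (w, z)] fun _ => 0 := by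
      have hopen : IsOpen {p : ℂ × ℝ | ρ < ‖p.1‖} := isOpen_lt (by fun_prop) (by fun_prop)
      filter_upwards [hopen.mem_nhds hw] with p hp
      exact hρ p.1 p.2 hp
    change fderiv ℝ u (w, z) e = 0
    rw [this.fderiv_eq]
    simp

theorem fderiv_conj (h : IsBlochSmooth a c u) (e p : ℂ × ℝ) :
    fderiv ℝ (fun p => starRingEnd ℂ (u p)) p e = starRingEnd ℂ (fderiv ℝ u p e) := by
  have := (Complex.conjCLE.toContinuousLinearMap.hasFDerivAt.comp p (h.differentiable p).hasFDerivAt)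
  have h2 : HasFDerivAt (fun p => starRingEnd ℂ (u p)) _ p := this
  rw [h2.fderiv]
  rfl

/-- The integral over the cell of a derivative of a periodic function vanishes. -/
theorem integral_dir_eq_zero (h : IsBlochSmooth a 1 u) (ha : 0 < a) (e : ℂ × ℝ) :
    ∫ p, fderiv ℝ u p e ∂(cellMeasure a) = 0 := by
  -- For fixed `z` the function has compact support in the plane, so one integrates by parts against
  -- the constant `1`.
  have hperp : ∀ e₁ : ℂ, ∫ p, fderiv ℝ u p (e₁, 0) ∂(cellMeasure a) = 0 := by
    intro e₁
    have hi := (h.dir (e₁, 0)).integrable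
    rw [cellMeasure_eq_prod] at hi ⊢
    rw [integral_prod_symm _ hi]
    refine integral_eq_zero_of_ae (ae_of_all _ fun z => ?_)
    have hu : ContDiff ℝ ∞ (fun w => u (w, z)) := h.smooth.comp (by fun_prop)
    have hcs : HasCompactSupport (fun w => u (w, z)) := by
      obtain ⟨ρ, hρ⟩ := h.support
      refine HasCompactSupport.of_support_subset_isCompact (isCompact_closedBall (0 : ℂ) ρ) ?_
      intro w hw
      by_contra hw'
      exact hw (hρ w z (by simpa using hw'))
    have hd : ∀ w, fderiv ℝ (fun w => u (w, z)) w e₁ = fderiv ℝ u (w, z) (e₁, 0) := fun w => by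
      have h1 := (h.differentiable (w, z)).hasFDerivAt.comp w (hasFDerivAt_prodMk_left (𝕜 := ℝ) w z)
      have h2 : HasFDerivAt (fun w => u (w, z)) _ w := h1
      rw [h2.fderiv]
      simp
    have hcs' : HasCompactSupport (fun w => fderiv ℝ (fun w => u (w, z)) w e₁) :=
      hcs.fderiv_apply ℝ e₁
    have key := integral_mul_fderiv_eq_neg_fderiv_mul_of_integrable (μ := (volume : Measure ℂ))
      (f := fun _ : ℂ => (1 : ℂ)) (g := fun w => u (w, z)) (v := e₁) (by simp)
      (by
        simp only [one_mul]
        exact ((hu.continuous_fderiv (by simp)).clm_apply continuous_const).integrable_of_hasCompactSupport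
          hcs')
      (by
        simp only [one_mul]
        exact hu.continuous.integrable_of_hasCompactSupport hcs)
      (fun _ _ => by fun_prop) (fun w _ => hu.differentiable (by simp) w)
    simpa [hd] using key
  -- Along the axis the fundamental theorem leaves `u (w, a) - u (w, 0)`, which vanishes because the
  -- phase is `1`.
  have hpar : ∫ p, fderiv ℝ u p (0, 1) ∂(cellMeasure a) = 0 := by
    have hi := (h.dir (0, 1)).integrable
    have hcont : Continuous fun p => fderiv ℝ u p (0, 1) := (h.dir (0, 1)).continuous
    rw [cellMeasure_eq_prod] at hi ⊢
    rw [integral_prod _ hi]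
    refine integral_eq_zero_of_ae (ae_of_all _ fun w => ?_)
    have hd : ∀ z, HasDerivAt (fun z => u (w, z)) (fderiv ℝ u (w, z) (0, 1)) z := fun z => by
      have h1 := (h.differentiable (w, z)).hasFDerivAt.comp_hasDerivAt z
        ((hasDerivAt_const z w).prodMk (hasDerivAt_id z))
      exact h1
    simp only [Pi.zero_apply]
    rw [integral_Ico_eq_integral_Ioc, ← intervalIntegral.integral_of_le ha.le,
      intervalIntegral.integral_eq_sub_of_hasDerivAt (fun z _ => hd z)
        (Continuous.intervalIntegrable (by fun_prop) _ _)]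
    have := h.bloch w 0
    rw [zero_add, one_mul] at this
    rw [this, sub_self]
  have hsplit : ∀ p, fderiv ℝ u p e = fderiv ℝ u p (e.1, 0) + e.2 • fderiv ℝ u p (0, 1) := by
    intro p
    rw [← map_smul, ← map_add]
    simp
  simp only [hsplit]
  have i1 : Integrable (fun p => fderiv ℝ u p (e.1, 0)) (cellMeasure a) := (h.dir _).integrable
  have i2 : Integrable (fun p => e.2 • fderiv ℝ u p (0, 1)) (cellMeasure a) :=
    (h.dir (0, 1)).integrable.smul e.2
  rw [integral_add i1 i2, integral_smul, hperp, hpar]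
  simp

theorem congr_phase (h : IsBlochSmooth a c u) (hcd : c = d) : IsBlochSmooth a d u := hcd ▸ h

/-- Integration by parts on the cell. -/
theorem integral_mul_dir (h : IsBlochSmooth a c u) (k : IsBlochSmooth a d v) (hcd : c * d = 1)
    (ha : 0 < a) (e : ℂ × ℝ) :
    ∫ p, u p * fderiv ℝ v p e ∂(cellMeasure a) = -∫ p, fderiv ℝ u p e * v p ∂(cellMeasure a) := by
  -- The product has phase `c * d = 1`, so it is truly periodic.
  have h0 := ((h.mul k).congr_phase hcd).integral_dir_eq_zero ha e
  have hd : ∀ p, fderiv ℝ (fun p => u p * v p) p e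
      = u p * fderiv ℝ v p e + fderiv ℝ u p e * v p := fun p => by
    rw [fderiv_fun_mul (h.differentiable p) (k.differentiable p)]
    simp [mul_comm]
  simp only [hd] at h0
  rw [integral_add ((h.mul (k.dir e)).integrable) (((h.dir e).mul k).integrable)] at h0
  exact eq_neg_of_add_eq_zero_left h0

theorem integral_mul_dir_dir (h : IsBlochSmooth a c u) (k : IsBlochSmooth a d v)
    (hcd : c * d = 1) (ha : 0 < a) (e : ℂ × ℝ) :
    ∫ p, u p * fderiv ℝ (fun p => fderiv ℝ v p e) p e ∂(cellMeasure a)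
      = ∫ p, fderiv ℝ (fun p => fderiv ℝ u p e) p e * v p ∂(cellMeasure a) := by
  rw [h.integral_mul_dir (k.dir e) hcd ha, (h.dir e).integral_mul_dir k hcd ha, neg_neg]

theorem laplacian (h : IsBlochSmooth a c u) : IsBlochSmooth a c (lap u) :=
  (((h.dir (1, 0)).dir (1, 0)).add ((h.dir (Complex.I, 0)).dir (Complex.I, 0))).add
    ((h.dir (0, 1)).dir (0, 1))

theorem integral_mul_lap (h : IsBlochSmooth a c u) (k : IsBlochSmooth a d v)
    (hcd : c * d = 1) (ha : 0 < a) :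
    ∫ p, u p * lap v p ∂(cellMeasure a)
      = ∫ p, lap u p * v p ∂(cellMeasure a) := by
  have e1 : ∀ p, u p * lap v p = u p * dX (dX v) p + u p * dY (dY v) p
    + u p * dZ (dZ v) p := fun p => by rw [lap]; ring
  have e2 : ∀ p, lap u p * v p = dX (dX u) p * v p + dY (dY u) p * v p
    + dZ (dZ u) p * v p := fun p => by rw [lap]; ring
  have i1 : ∀ e, Integrable (fun p => u p * fderiv ℝ (fun p => fderiv ℝ v p e) p e)
    (cellMeasure a) := fun e => (h.mul ((k.dir e).dir e)).integrable
  have i2 : ∀ e, Integrable (fun p => fderiv ℝ (fun p => fderiv ℝ u p e) p e * v p)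
    (cellMeasure a) := fun e => (((h.dir e).dir e).mul k).integrable
  simp only [e1, e2]
  rw [integral_add, integral_add, integral_add, integral_add]
  · exact congrArg₂ (· + ·) (congrArg₂ (· + ·) (h.integral_mul_dir_dir k hcd ha _)
      (h.integral_mul_dir_dir k hcd ha _)) (h.integral_mul_dir_dir k hcd ha _)
  · exact i2 (1, 0)
  · exact i2 (Complex.I, 0)
  · exact (i2 (1, 0)).add (i2 (Complex.I, 0))
  · exact i2 (0, 1)
  · exact i1 (1, 0)
  · exact i1 (Complex.I, 0)
  · exact (i1 (1, 0)).add (i1 (Complex.I, 0))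
  · exact i1 (0, 1)

theorem lap_conj (h : IsBlochSmooth a c u) (p : ℂ × ℝ) :
    lap (fun p => starRingEnd ℂ (u p)) p = starRingEnd ℂ (lap u p) := by
  have h1 : ∀ e, (fun p => fderiv ℝ (fun p => starRingEnd ℂ (u p)) p e)
      = fun p => starRingEnd ℂ (fderiv ℝ u p e) := fun e => funext fun p => h.fderiv_conj e p
  have h2 : ∀ e, fderiv ℝ (fun p => fderiv ℝ (fun p => starRingEnd ℂ (u p)) p e) p e
      = starRingEnd ℂ (fderiv ℝ (fun p => fderiv ℝ u p e) p e) := fun e => by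
    rw [h1, (h.dir e).fderiv_conj]
  simp only [lap, map_add]
  exact congrArg₂ (· + ·) (congrArg₂ (· + ·) (h2 _) (h2 _)) (h2 _)

end IsBlochSmooth

theorem conj_exp_I_mul_self (α : ℝ) :
    starRingEnd ℂ (Complex.exp (Complex.I * α)) * Complex.exp (Complex.I * α) = 1 := by
  rw [← Complex.exp_conj, ← Complex.exp_add]
  simp

/-! ### Rotations -/

theorem rot_eq (θ : ℝ) (p : ℂ × ℝ) : rot θ p = (Complex.exp (θ * Complex.I) * p.1, p.2) := by
  simp [rot, rotation_apply, Circle.coe_exp]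

/-- Rotation around the `z`-axis as a continuous linear map. -/
def rotCLM (θ : ℝ) : (ℂ × ℝ) →L[ℝ] (ℂ × ℝ) :=
  ((ContinuousLinearMap.mul ℝ ℂ (Complex.exp (θ * Complex.I))).comp
    (ContinuousLinearMap.fst ℝ ℂ ℝ)).prod (ContinuousLinearMap.snd ℝ ℂ ℝ)

theorem coe_rotCLM (θ : ℝ) : ⇑(rotCLM θ) = rot θ := by
  funext p
  rw [rot_eq]
  rfl

theorem fderiv_rot {u : ℂ × ℝ → ℂ} {c : ℂ} {θ : ℝ} (hu : Differentiable ℝ u)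
    (h : ∀ p, u (rot θ p) = c * u p) (p e : ℂ × ℝ) :
    fderiv ℝ u (rot θ p) (rot θ e) = c * fderiv ℝ u p e := by
  have h1 : (fun p => u (rotCLM θ p)) = fun p => c * u p := by
    funext p
    rw [coe_rotCLM, h]
  have h2 : HasFDerivAt (fun p => u (rotCLM θ p)) _ p :=
    (hu (rotCLM θ p)).hasFDerivAt.comp p (rotCLM θ).hasFDerivAt
  have h3 := h2.fderiv
  rw [h1, fderiv_const_mul (hu p)] at h3
  have h4 := DFunLike.congr_fun h3 e
  simp only [ContinuousLinearMap.comp_apply, coe_rotCLM] at h4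
  rw [← h4]
  rfl

theorem rot_dirs (θ : ℝ) : rot θ (1, 0) = Real.cos θ • ((1, 0) : ℂ × ℝ) + Real.sin θ • (Complex.I, 0)
    ∧ rot θ (Complex.I, 0) = (-Real.sin θ) • ((1, 0) : ℂ × ℝ) + Real.cos θ • (Complex.I, 0)
    ∧ rot θ (0, 1) = (0, 1) := by
  refine ⟨?_, ?_, ?_⟩ <;> rw [rot_eq] <;>
    refine Prod.ext ?_ ?_ <;> simp [Complex.exp_mul_I, Complex.ext_iff, ← Complex.ofReal_cos,
      ← Complex.ofReal_sin]

/-- Differentiating twice in the rotated directions at the rotated point reproduces the phase. On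
adding the two perpendicular directions the mixed derivatives cancel and `cos² + sin² = 1` restores
the Laplacian. -/
theorem lap_rot {u : ℂ × ℝ → ℂ} {c : ℂ} {θ : ℝ} (hu : ContDiff ℝ ∞ u)
    (h : ∀ p, u (rot θ p) = c * u p) (p : ℂ × ℝ) : lap u (rot θ p) = c * lap u p := by
  have h1 : ∀ e p, fderiv ℝ u (rot θ p) (rot θ e) = c * fderiv ℝ u p e := fun e p =>
    fderiv_rot (hu.differentiable (by simp)) h p e
  have h2 : ∀ e, fderiv ℝ (fun p => fderiv ℝ u p (rot θ e)) (rot θ p) (rot θ e)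
      = c * fderiv ℝ (fun p => fderiv ℝ u p e) p e := fun e => by
    have hdiff : ∀ e, Differentiable ℝ fun p => fderiv ℝ u p e := fun e =>
      (contDiff_dir hu e).differentiable (by simp)
    have k1 : (fun p => fderiv ℝ u (rotCLM θ p) (rot θ e)) = fun p => c * fderiv ℝ u p e := by
      funext q
      rw [coe_rotCLM, h1]
    have k2 : HasFDerivAt (fun p => fderiv ℝ u (rotCLM θ p) (rot θ e)) _ p :=
      (hdiff (rot θ e) (rotCLM θ p)).hasFDerivAt.comp p (rotCLM θ).hasFDerivAt
    have k3 := k2.fderiv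
    rw [k1, fderiv_const_mul (hdiff e p)] at k3
    have k4 := DFunLike.congr_fun k3 e
    simp only [ContinuousLinearMap.comp_apply, coe_rotCLM] at k4
    rw [← k4]
    rfl
  have hX := h2 (1, 0)
  have hY := h2 (Complex.I, 0)
  have hZ := h2 (0, 1)
  obtain ⟨r1, r2, r3⟩ := rot_dirs θ
  have hsm : ∀ (s t : ℝ) (q : ℂ × ℝ),
      fderiv ℝ (fun p => fderiv ℝ u p (s • ((1, 0) : ℂ × ℝ) + t • (Complex.I, 0))) q
        (s • ((1, 0) : ℂ × ℝ) + t • (Complex.I, 0))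
      = s ^ 2 * dX (dX u) q + s * t * (dX (dY u) q + dY (dX u) q) + t ^ 2 * dY (dY u) q := by
    intro s t q
    have hdiff : ∀ e, DifferentiableAt ℝ (fun p => fderiv ℝ u p e) q := fun e =>
      (contDiff_dir hu e).differentiable (by simp) q
    simp only [map_add, map_smul]
    have hk : HasFDerivAt (fun p => s • fderiv ℝ u p (1, 0) + t • fderiv ℝ u p (Complex.I, 0))
        (s • fderiv ℝ (fun p => fderiv ℝ u p (1, 0)) q
          + t • fderiv ℝ (fun p => fderiv ℝ u p (Complex.I, 0)) q) q :=
      ((hdiff _).hasFDerivAt.const_smul s).add ((hdiff _).hasFDerivAt.const_smul t)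
    rw [hk.fderiv]
    simp only [add_apply, smul_apply]
    simp only [dX, dY, Complex.real_smul]
    unfold dX dY
    ring
  rw [r1, hsm] at hX
  rw [r2, hsm] at hY
  rw [r3] at hZ
  have hcs : (Real.cos θ : ℂ) ^ 2 + (Real.sin θ : ℂ) ^ 2 = 1 := by
    rw [← Complex.ofReal_pow, ← Complex.ofReal_pow, ← Complex.ofReal_add, Real.cos_sq_add_sin_sq,
      Complex.ofReal_one]
  have hXe : fderiv ℝ (fun p => fderiv ℝ u p (1, 0)) p (1, 0) = dX (dX u) p := rfl
  have hYe : fderiv ℝ (fun p => fderiv ℝ u p (Complex.I, 0)) p (Complex.I, 0) = dY (dY u) p := rfl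
  have hZe : ∀ q, fderiv ℝ (fun p => fderiv ℝ u p (0, 1)) q (0, 1) = dZ (dZ u) q := fun _ => rfl
  rw [hXe] at hX
  rw [hYe] at hY
  rw [hZe, hZe] at hZ
  simp only [lap]
  push_cast at hX hY
  rw [← Complex.ofReal_cos, ← Complex.ofReal_sin] at hX hY
  linear_combination hX + hY + hZ - (dX (dX u) (rot θ p) + dY (dY u) (rot θ p)) * hcs

/-- Differentiate `ψ (rot θ p) = exp(imθ) ψ p` at `θ = 0`: the orbit has velocity `(i w, 0)`, that
is `-y` along `x` and `x` along `y`. -/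
theorem IsBlochCore.angMom_eq {a α : ℝ} {m : ℤ} {ψ : ℂ × ℝ → ℂ} (h : IsBlochCore a α m ψ)
    (p : ℂ × ℝ) : angMom ψ p = m * ψ p := by
  have h1 : HasDerivAt (fun θ : ℝ => (Complex.exp (θ * Complex.I) * p.1, p.2))
      (Complex.I * p.1, (0 : ℝ)) 0 := by
    refine HasDerivAt.prodMk ?_ (hasDerivAt_const _ _)
    have : HasDerivAt (fun θ : ℝ => Complex.exp (θ * Complex.I)) (Complex.I) 0 := by
      have h2 : HasDerivAt (fun θ : ℝ => (θ : ℂ) * Complex.I) (1 * Complex.I) 0 :=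
        (Complex.ofRealCLM.hasDerivAt (x := (0 : ℝ))).mul_const Complex.I
      simpa using h2.cexp
    exact this.mul_const p.1
  have h2 : HasDerivAt (fun θ : ℝ => ψ (rot θ p)) (fderiv ℝ ψ p (Complex.I * p.1, 0)) 0 := by
    have hp : (Complex.exp (((0 : ℝ) : ℂ) * Complex.I) * p.1, p.2) = p := by simp
    have h3 : HasFDerivAt ψ (fderiv ℝ ψ p) (Complex.exp (((0 : ℝ) : ℂ) * Complex.I) * p.1, p.2) := by
      rw [hp]
      exact (h.smooth.differentiable (by simp) p).hasFDerivAt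
    have := h3.comp_hasDerivAt (0 : ℝ) h1
    simp only [rot_eq]
    exact this
  have h3 : HasDerivAt (fun θ : ℝ => ψ (rot θ p)) (Complex.I * m * ψ p) 0 := by
    simp only [h.angular]
    have h4 : HasDerivAt (fun θ : ℝ => Complex.I * m * (θ : ℂ)) (Complex.I * m * 1) 0 :=
      (Complex.ofRealCLM.hasDerivAt (x := (0 : ℝ))).const_mul _
    simpa using (h4.cexp.mul_const (ψ p))
  have h4 := h2.unique h3
  have h5 : ((Complex.I * p.1, 0) : ℂ × ℝ) = (-p.1.im) • ((1, 0) : ℂ × ℝ) + p.1.re • (Complex.I, 0) := by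
    refine Prod.ext ?_ ?_ <;> simp [Complex.ext_iff]
  rw [h5, map_add, map_smul, map_smul] at h4
  simp only [angMom, dX, dY]
  simp only [Complex.real_smul, Complex.ofReal_neg] at h4
  linear_combination (-Complex.I) * h4 - (m * ψ p) * Complex.I_sq

/-! ### The core and the operators on it -/

theorem mem_sector_iff {a : ℝ} {m : ℤ} {v : BlochSpace a} : v ∈ sector a m ↔
    ∀ θ : ℝ, (fun p => v (rot θ p)) =ᵐ[cellMeasure a]
      fun p => Complex.exp (Complex.I * m * θ) * v p := by
  simp only [sector, Submodule.mem_iInf, LinearMap.mem_ker]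
  refine forall_congr' fun θ => ?_
  change Lp.compMeasurePreserving (rot θ) (measurePreserving_rot a θ) v
    - Complex.exp (Complex.I * m * θ) • v = 0 ↔ _
  rw [sub_eq_zero]
  have h1 := Lp.coeFn_compMeasurePreserving v (measurePreserving_rot a θ)
  have h2 := Lp.coeFn_smul (Complex.exp (Complex.I * m * θ)) v
  constructor
  · intro h
    rw [h] at h1
    exact h1.symm.trans h2
  · intro h
    refine Lp.ext ?_
    exact h1.trans (Filter.EventuallyEq.trans h h2.symm)

theorem toLp_mem_sector {a : ℝ} {m : ℤ} {u : ℂ × ℝ → ℂ} (hu : MemLp u 2 (cellMeasure a))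
    (h : ∀ θ p, u (rot θ p) = Complex.exp (Complex.I * m * θ) * u p) :
    hu.toLp u ∈ sector a m := by
  rw [mem_sector_iff]
  intro θ
  have h1 := (measurePreserving_rot a θ).quasiMeasurePreserving.ae_eq_comp hu.coeFn_toLp
  filter_upwards [h1, hu.coeFn_toLp] with p hp hp'
  simp only [Function.comp_apply] at hp
  rw [hp, hp', h]

/-- Local square integrability of an axially symmetric potential. -/
def LocallySquareIntegrable (V : ℝ → ℝ → ℝ) : Prop :=
  ∀ s : Set (ℂ × ℝ), IsCompact s → MemLp (fun p : ℂ × ℝ => V ‖p.1‖ p.2) 2 (volume.restrict s)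

/-- On the cell only a compact set matters; there `V` is square integrable and `u` is bounded. This
is why `H` maps the core into the Hilbert space. -/
theorem LocallySquareIntegrable.memLp_mul {V : ℝ → ℝ → ℝ} (hV : LocallySquareIntegrable V)
    {u : ℂ × ℝ → ℂ} (a : ℝ) (hc : Continuous u) (hs : BoundedSupport u) :
    MemLp (fun p => ((V ‖p.1‖ p.2 : ℝ) : ℂ) * u p) 2 (cellMeasure a) := by
  have hs' : BoundedSupport fun p => ((V ‖p.1‖ p.2 : ℝ) : ℂ) * u p := by
    obtain ⟨ρ, hρ⟩ := hs
    exact ⟨ρ, fun w z h => by simp [hρ w z h]⟩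
  obtain ⟨K, hK, hKu⟩ := hs'.ae_eq_indicator a
  refine MemLp.ae_eq hKu ?_
  rw [memLp_indicator_iff_restrict hK.measurableSet]
  have hVK : MemLp (fun p : ℂ × ℝ => V ‖p.1‖ p.2) 2 ((cellMeasure a).restrict K) :=
    (hV K hK).mono_measure (Measure.restrict_mono_measure (cellMeasure_restrict_le a) K)
  obtain ⟨M, hM⟩ := hK.exists_bound_of_continuousOn hc.continuousOn
  refine MemLp.of_le_mul (c := M) hVK ?_ ?_
  · exact (Complex.continuous_ofReal.comp_aestronglyMeasurable hVK.aestronglyMeasurable).mul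
      hc.aestronglyMeasurable
  · filter_upwards [ae_restrict_mem hK.measurableSet] with p hp
    rw [norm_mul, Complex.norm_real, mul_comm]
    exact mul_le_mul_of_nonneg_right (hM p hp) (norm_nonneg _)

theorem locallySquareIntegrable_const (c : ℝ) : LocallySquareIntegrable fun _ _ => c :=
  fun s hs => by
    have : IsFiniteMeasure ((volume : Measure (ℂ × ℝ)).restrict s) :=
      ⟨by simpa using hs.measure_lt_top⟩
    exact memLp_const c

/-- The space of smooth Bloch functions. -/
def core (a α : ℝ) (m : ℤ) : Submodule ℂ (ℂ × ℝ → ℂ) where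
  carrier := {ψ | IsBlochCore a α m ψ}
  zero_mem' := isBlochCore_zero a α m
  add_mem' := IsBlochCore.add
  smul_mem' := fun c _ h => h.smul c

section

variable {B a α : ℝ} {m : ℤ} {V : ℝ → ℝ → ℝ} {ψ φ : ℂ × ℝ → ℂ}

theorem IsBlochCore.memLp (h : IsBlochCore a α m ψ) : MemLp ψ 2 (cellMeasure a) :=
  h.isBlochSmooth.memLp

theorem IsBlochCore.hamExpr_eq (h : IsBlochCore a α m ψ) (p : ℂ × ℝ) :
    hamExpr B V ψ p = -lap ψ p + ((B ^ 2 / 4 * ‖p.1‖ ^ 2 - B * m : ℝ) : ℂ) * ψ p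
      + ((V ‖p.1‖ p.2 : ℝ) : ℂ) * ψ p := by
  rw [hamExpr, h.angMom_eq]
  push_cast
  ring

theorem IsBlochCore.memLp_hamExpr (h : IsBlochCore a α m ψ) (hV : LocallySquareIntegrable V) :
    MemLp (hamExpr B V ψ) 2 (cellMeasure a) := by
  have h1 : hamExpr B V ψ = (fun p => -lap ψ p + ((B ^ 2 / 4 * ‖p.1‖ ^ 2 - B * m : ℝ) : ℂ) * ψ p)
      + fun p => ((V ‖p.1‖ p.2 : ℝ) : ℂ) * ψ p := funext fun p => h.hamExpr_eq p
  rw [h1]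
  refine MemLp.add (memLp_cell a ?_ ?_) (hV.memLp_mul a h.smooth.continuous h.support)
  · have := h.isBlochSmooth.laplacian.continuous
    have := h.smooth.continuous
    fun_prop
  · obtain ⟨ρ, hρ⟩ := h.support
    obtain ⟨σ, hσ⟩ := h.isBlochSmooth.laplacian.support
    exact ⟨max ρ σ, fun w z hw => by
      simp [hρ w z ((le_max_left _ _).trans_lt hw), hσ w z ((le_max_right _ _).trans_lt hw)]⟩

theorem IsBlochCore.hamExpr_rot (h : IsBlochCore a α m ψ) (θ : ℝ) (p : ℂ × ℝ) :
    hamExpr B V ψ (rot θ p) = Complex.exp (Complex.I * m * θ) * hamExpr B V ψ p := by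
  have h1 : ‖(rot θ p).1‖ = ‖p.1‖ := by simp [rot]
  have h2 : (rot θ p).2 = p.2 := rfl
  rw [h.hamExpr_eq, h.hamExpr_eq, lap_rot h.smooth (h.angular θ), h.angular, h1, h2]
  ring

/-- Smooth Bloch functions as elements of the Hilbert space. -/
def coreVec (a α : ℝ) (m : ℤ) : core a α m →ₗ[ℂ] sector a m where
  toFun ψ := ⟨ψ.2.memLp.toLp _, toLp_mem_sector _ ψ.2.angular⟩
  map_add' _ _ := rfl
  map_smul' _ _ := rfl

/-- The Hamiltonian on smooth Bloch functions, with values in the Hilbert space. -/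
def hamVec (B a α : ℝ) (m : ℤ) (hV : LocallySquareIntegrable V) :
    core a α m →ₗ[ℂ] sector a m where
  toFun ψ := ⟨(ψ.2.memLp_hamExpr (B := B) hV).toLp _, toLp_mem_sector _ ψ.2.hamExpr_rot⟩
  map_add' ψ φ := Subtype.ext <| by
    change MemLp.toLp _ (IsBlochCore.memLp_hamExpr (ψ + φ).2 hV)
      = MemLp.toLp _ (IsBlochCore.memLp_hamExpr ψ.2 hV)
        + MemLp.toLp _ (IsBlochCore.memLp_hamExpr φ.2 hV)
    rw [← MemLp.toLp_add]
    exact MemLp.toLp_congr _ _ (ae_of_all _ fun p =>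
      congrFun (hamExpr_add B V ψ.2.smooth φ.2.smooth) p)
  map_smul' c ψ := Subtype.ext <| by
    change MemLp.toLp _ (IsBlochCore.memLp_hamExpr (c • ψ).2 hV)
      = c • MemLp.toLp _ (IsBlochCore.memLp_hamExpr ψ.2 hV)
    rw [← MemLp.toLp_const_smul]
    exact MemLp.toLp_congr _ _ (ae_of_all _ fun p => congrFun (hamExpr_smul B V c ψ.2.smooth) p)

theorem coeFn_coreVec (ψ : core a α m) :
    ((coreVec a α m ψ : sector a m) : BlochSpace a) =ᵐ[cellMeasure a] (ψ : ℂ × ℝ → ℂ) :=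
  MemLp.coeFn_toLp ψ.2.memLp

theorem coeFn_hamVec (hV : LocallySquareIntegrable V) (ψ : core a α m) :
    ((hamVec B a α m hV ψ : sector a m) : BlochSpace a)
      =ᵐ[cellMeasure a] hamExpr B V (ψ : ℂ × ℝ → ℂ) :=
  MemLp.coeFn_toLp (ψ.2.memLp_hamExpr hV)

/-- This replaces the partially defined operator by two linear maps on the core, the form in which
the abstract criterion is applied. -/
theorem minimalHam_graph (ha : 0 < a) (hV : LocallySquareIntegrable V) :
    (minimalHam B a V α m).graph
      = LinearMap.range ((coreVec a α m).prod (hamVec B a α m hV)) := by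
  rw [minimalHam, Submodule.toLinearPMap_graph_eq _ fun q hq h0 =>
    minimalGraph_single_valued ha q hq h0]
  ext q
  constructor
  · rintro ⟨ψ, h, h1, h2⟩
    refine ⟨⟨ψ, h⟩, Prod.ext (Subtype.ext (Lp.ext ?_)) (Subtype.ext (Lp.ext ?_))⟩
    · exact (coeFn_coreVec ⟨ψ, h⟩).trans h1.symm
    · exact (coeFn_hamVec hV ⟨ψ, h⟩).trans h2.symm
  · rintro ⟨ψ, rfl⟩
    exact ⟨ψ, ψ.2, coeFn_coreVec ψ, coeFn_hamVec hV ψ⟩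

theorem sector_inner_eq {f g : sector a m} {u v : ℂ × ℝ → ℂ}
    (hf : (f : BlochSpace a) =ᵐ[cellMeasure a] u) (hg : (g : BlochSpace a) =ᵐ[cellMeasure a] v) :
    inner ℂ f g = ∫ p, starRingEnd ℂ (u p) * v p ∂(cellMeasure a) := by
  rw [Submodule.coe_inner, L2.inner_def]
  refine integral_congr_ae ?_
  filter_upwards [hf, hg] with p hp hp'
  rw [hp, hp', RCLike.inner_apply, mul_comm]

/-- The real multiplication terms, including the constant `-B m`, cancel pointwise. The Laplacian
moves across by parts because `conj ψ` and `φ` have inverse phases. -/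
theorem hamVec_symmetric (ha : 0 < a) (hV : LocallySquareIntegrable V) (ψ φ : core a α m) :
    inner ℂ (hamVec B a α m hV ψ) (coreVec a α m φ)
      = inner ℂ (coreVec a α m ψ) (hamVec B a α m hV φ) := by
  rw [sector_inner_eq (coeFn_hamVec hV ψ) (coeFn_coreVec φ),
    sector_inner_eq (coeFn_coreVec ψ) (coeFn_hamVec hV φ)]
  have hψ := ψ.2.isBlochSmooth
  have hφ := φ.2.isBlochSmooth
  have i1 : Integrable (fun p => starRingEnd ℂ (hamExpr B V (ψ : ℂ × ℝ → ℂ) p)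
      * (φ : ℂ × ℝ → ℂ) p) (cellMeasure a) :=
    (ψ.2.memLp_hamExpr (B := B) hV).star.integrable_mul φ.2.memLp
  have i2 : Integrable (fun p => starRingEnd ℂ ((ψ : ℂ × ℝ → ℂ) p)
      * hamExpr B V (φ : ℂ × ℝ → ℂ) p) (cellMeasure a) :=
    ψ.2.memLp.star.integrable_mul (φ.2.memLp_hamExpr (B := B) hV)
  rw [← sub_eq_zero, ← integral_sub i1 i2]
  have e : ∀ p, starRingEnd ℂ (hamExpr B V (ψ : ℂ × ℝ → ℂ) p) * (φ : ℂ × ℝ → ℂ) p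
      - starRingEnd ℂ ((ψ : ℂ × ℝ → ℂ) p) * hamExpr B V (φ : ℂ × ℝ → ℂ) p
      = starRingEnd ℂ ((ψ : ℂ × ℝ → ℂ) p) * lap (φ : ℂ × ℝ → ℂ) p
        - lap (fun p => starRingEnd ℂ ((ψ : ℂ × ℝ → ℂ) p)) p * (φ : ℂ × ℝ → ℂ) p := fun p => by
    rw [ψ.2.hamExpr_eq, φ.2.hamExpr_eq, hψ.lap_conj]
    simp only [map_add, map_neg, map_mul, Complex.conj_ofReal]
    ring
  simp only [e]
  rw [integral_sub, hψ.conj.integral_mul_lap hφ (conj_exp_I_mul_self α) ha, sub_self]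
  · exact (hψ.conj.mul hφ.laplacian).integrable
  · exact (hψ.conj.laplacian.mul hφ).integrable

/-! ### The norm of the cell -/

/-- The `L²` norm over the unit cell. -/
def cellNorm (a : ℝ) (u : ℂ × ℝ → ℂ) : ℝ := (eLpNorm u 2 (cellMeasure a)).toReal

theorem cellNorm_nonneg (u : ℂ × ℝ → ℂ) : 0 ≤ cellNorm a u := ENNReal.toReal_nonneg

theorem norm_eq_cellNorm {f : sector a m} {u : ℂ × ℝ → ℂ}
    (hf : (f : BlochSpace a) =ᵐ[cellMeasure a] u) : ‖f‖ = cellNorm a u := by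
  rw [Submodule.coe_norm, Lp.norm_def, cellNorm, eLpNorm_congr_ae hf]

theorem cellNorm_sq {u : ℂ × ℝ → ℂ} (hu : MemLp u 2 (cellMeasure a)) :
    cellNorm a u ^ 2 = ∫ p, ‖u p‖ ^ 2 ∂(cellMeasure a) := by
  have h0 : 0 ≤ ∫ p, ‖u p‖ ^ 2 ∂(cellMeasure a) := integral_nonneg fun p => sq_nonneg _
  rw [cellNorm, hu.eLpNorm_eq_integral_rpow_norm two_ne_zero ENNReal.ofNat_ne_top]
  simp only [ENNReal.toReal_ofNat, Real.rpow_ofNat]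
  rw [ENNReal.toReal_ofReal (Real.rpow_nonneg h0 _), ← Real.rpow_natCast, ← Real.rpow_mul h0]
  norm_num

theorem cellNorm_add_le {u v : ℂ × ℝ → ℂ} (hu : MemLp u 2 (cellMeasure a))
    (hv : MemLp v 2 (cellMeasure a)) :
    cellNorm a (fun p => u p + v p) ≤ cellNorm a u + cellNorm a v := by
  rw [cellNorm, cellNorm, cellNorm, ← ENNReal.toReal_add hu.eLpNorm_ne_top hv.eLpNorm_ne_top]
  exact ENNReal.toReal_mono (ENNReal.add_ne_top.2 ⟨hu.eLpNorm_ne_top, hv.eLpNorm_ne_top⟩)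
    (eLpNorm_add_le hu.1 hv.1 (by norm_num))

theorem cellNorm_const_mul (c : ℂ) (u : ℂ × ℝ → ℂ) :
    cellNorm a (fun p => c * u p) = ‖c‖ * cellNorm a u := by
  have : (fun p => c * u p) = c • u := rfl
  rw [cellNorm, this, eLpNorm_const_smul, ENNReal.toReal_mul]
  simp [cellNorm]

theorem cellNorm_mono {u v : ℂ × ℝ → ℂ} (hv : MemLp v 2 (cellMeasure a))
    (h : ∀ p, ‖u p‖ ≤ ‖v p‖) : cellNorm a u ≤ cellNorm a v :=
  ENNReal.toReal_mono hv.eLpNorm_ne_top (eLpNorm_mono h)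

end

/-! ### The harmonic oscillator bounds its two parts -/

/-- One integration by parts leaves `∫ g' conj ψ ∂ψ` besides `∫ g |∂ψ|²`. Twice its real part is `∫
g' ∂|ψ|²`, and a second integration by parts turns this into `-∫ g'' |ψ|²`. -/
theorem IsBlochSmooth.re_integral_weight {a : ℝ} {c : ℂ} {ψ : ℂ × ℝ → ℂ}
    (h : IsBlochSmooth a c ψ) (hc : starRingEnd ℂ c * c = 1) (ha : 0 < a) {e : ℂ × ℝ}
    {g g' g'' : ℂ → ℝ} (hg : ContDiff ℝ ∞ g) (hg' : ContDiff ℝ ∞ g') (hg'' : ContDiff ℝ ∞ g'')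
    (hd : ∀ p : ℂ × ℝ, fderiv ℝ (fun p : ℂ × ℝ => g p.1) p e = g' p.1)
    (hd' : ∀ p : ℂ × ℝ, fderiv ℝ (fun p : ℂ × ℝ => g' p.1) p e = g'' p.1) :
    -2 * (∫ p, ((g p.1 : ℝ) : ℂ) * starRingEnd ℂ (ψ p)
        * fderiv ℝ (fun p => fderiv ℝ ψ p e) p e ∂(cellMeasure a)).re
      = 2 * ∫ p, g p.1 * ‖fderiv ℝ ψ p e‖ ^ 2 ∂(cellMeasure a)
        - ∫ p, g'' p.1 * ‖ψ p‖ ^ 2 ∂(cellMeasure a) := by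
  have hof : ∀ {k : ℂ → ℝ}, ContDiff ℝ ∞ k → ContDiff ℝ ∞ fun w => ((k w : ℝ) : ℂ) := fun hk =>
    Complex.ofRealCLM.contDiff.comp hk
  have hmul : ∀ {k k' : ℂ → ℝ}, ContDiff ℝ ∞ k →
      (∀ p : ℂ × ℝ, fderiv ℝ (fun p : ℂ × ℝ => k p.1) p e = k' p.1) → ∀ p : ℂ × ℝ,
      fderiv ℝ (fun p : ℂ × ℝ => ((k p.1 : ℝ) : ℂ) * starRingEnd ℂ (ψ p)) p e
      = ((k p.1 : ℝ) : ℂ) * starRingEnd ℂ (fderiv ℝ ψ p e)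
        + ((k' p.1 : ℝ) : ℂ) * starRingEnd ℂ (ψ p) := by
    intro k k' hk hkd p
    have h1 : HasFDerivAt (fun p : ℂ × ℝ => k p.1) (fderiv ℝ (fun p : ℂ × ℝ => k p.1) p) p :=
      ((hk.comp contDiff_fst).differentiable (by simp) p).hasFDerivAt
    have h2 : HasFDerivAt (fun p : ℂ × ℝ => ((k p.1 : ℝ) : ℂ)) _ p :=
      Complex.ofRealCLM.hasFDerivAt.comp p h1
    rw [fderiv_fun_mul h2.differentiableAt (h.conj.differentiable p), h2.fderiv]
    simp only [add_apply, smul_apply, h.fderiv_conj, ContinuousLinearMap.comp_apply, hkd,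
      Complex.ofRealCLM_apply, smul_eq_mul]
    ring
  have i1 : Integrable (fun p => ((g p.1 : ℝ) : ℂ) * starRingEnd ℂ (fderiv ℝ ψ p e)
      * fderiv ℝ ψ p e) (cellMeasure a) := (((h.dir e).conj.smul_fst (hof hg)).mul (h.dir e)).integrable
  have i2 : Integrable (fun p => ((g' p.1 : ℝ) : ℂ) * starRingEnd ℂ (ψ p)
      * fderiv ℝ ψ p e) (cellMeasure a) := ((h.conj.smul_fst (hof hg')).mul (h.dir e)).integrable
  have i3 : Integrable (fun p => ((g' p.1 : ℝ) : ℂ) * starRingEnd ℂ (fderiv ℝ ψ p e)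
      * ψ p) (cellMeasure a) := (((h.dir e).conj.smul_fst (hof hg')).mul h).integrable
  have i4 : Integrable (fun p => ((g'' p.1 : ℝ) : ℂ) * starRingEnd ℂ (ψ p)
      * ψ p) (cellMeasure a) := ((h.conj.smul_fst (hof hg'')).mul h).integrable
  have s1 := (h.conj.smul_fst (hof hg)).integral_mul_dir (h.dir e) hc ha e
  have s2 := (h.conj.smul_fst (hof hg')).integral_mul_dir h hc ha e
  simp only [hmul hg hd, hmul hg' hd', add_mul] at s1 s2
  rw [integral_add i1 i2] at s1
  rw [integral_add i3 i4] at s2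
  have hcs : ∫ p, ((g' p.1 : ℝ) : ℂ) * starRingEnd ℂ (fderiv ℝ ψ p e) * ψ p ∂(cellMeasure a)
      = starRingEnd ℂ (∫ p, ((g' p.1 : ℝ) : ℂ) * starRingEnd ℂ (ψ p) * fderiv ℝ ψ p e
        ∂(cellMeasure a)) := by
    rw [← integral_conj]
    congr 1
    funext p
    simp only [map_mul, Complex.conj_ofReal, Complex.conj_conj]
    ring
  have hre : ∀ (k : ℂ → ℝ) (u : ℂ × ℝ → ℂ),
      ∫ p, ((k p.1 : ℝ) : ℂ) * starRingEnd ℂ (u p) * u p ∂(cellMeasure a)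
      = ((∫ p, k p.1 * ‖u p‖ ^ 2 ∂(cellMeasure a) : ℝ) : ℂ) := by
    intro k u
    rw [← integral_complex_ofReal]
    congr 1
    funext p
    rw [mul_assoc, Complex.conj_mul']
    push_cast
    ring
  rw [hcs, hre] at s2
  rw [hre] at s1
  have r1 := congrArg Complex.re s1
  have r2 := congrArg Complex.re s2
  simp only [Complex.neg_re, Complex.add_re, Complex.ofReal_re, Complex.conj_re] at r1 r2
  linarith

/-- Put `q = (B²/4) r_⊥²` and expand the square of `-Δψ + qψ`. The cross term `-2 Re ∫ q conj ψ Δψ`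
equals `2 ∫ q |∇ψ|² - ∫ (Δq) |ψ|²`, which is at least `-B² ‖ψ‖²` since `q ≥ 0` and `Δq = B²`. -/
theorem IsBlochSmooth.oscillator_bound {a : ℝ} {c : ℂ} {ψ : ℂ × ℝ → ℂ}
    (h : IsBlochSmooth a c ψ) (hc : starRingEnd ℂ c * c = 1) (ha : 0 < a) (B : ℝ) :
    cellNorm a (lap ψ) ^ 2 + cellNorm a (fun p => ((B ^ 2 / 4 * ‖p.1‖ ^ 2 : ℝ) : ℂ) * ψ p) ^ 2
      ≤ cellNorm a (fun p => -lap ψ p + ((B ^ 2 / 4 * ‖p.1‖ ^ 2 : ℝ) : ℂ) * ψ p) ^ 2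
        + B ^ 2 * cellNorm a ψ ^ 2 := by
  have hof : ∀ {k : ℂ → ℝ}, ContDiff ℝ ∞ k → ContDiff ℝ ∞ fun w => ((k w : ℝ) : ℂ) := fun hk =>
    Complex.ofRealCLM.contDiff.comp hk
  have hre : ContDiff ℝ ∞ Complex.re := Complex.reCLM.contDiff
  have him : ContDiff ℝ ∞ Complex.im := Complex.imCLM.contDiff
  have hqe : ∀ w : ℂ, B ^ 2 / 4 * ‖w‖ ^ 2 = B ^ 2 / 4 * (w.re * w.re + w.im * w.im) := fun w => by
    rw [← Complex.normSq_eq_norm_sq, Complex.normSq_apply]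
  have hq : ContDiff ℝ ∞ fun w : ℂ => B ^ 2 / 4 * ‖w‖ ^ 2 := by
    simp only [hqe]
    fun_prop
  have hfd : ∀ p : ℂ × ℝ, HasFDerivAt (fun p : ℂ × ℝ => B ^ 2 / 4 * ‖p.1‖ ^ 2)
      ((B ^ 2 / 4) • ((2 * p.1.re) • Complex.reCLM.comp (ContinuousLinearMap.fst ℝ ℂ ℝ)
        + (2 * p.1.im) • Complex.imCLM.comp (ContinuousLinearMap.fst ℝ ℂ ℝ))) p := by
    intro p
    have hx : HasFDerivAt (fun p : ℂ × ℝ => p.1.re)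
      (Complex.reCLM.comp (ContinuousLinearMap.fst ℝ ℂ ℝ)) p :=
      (Complex.reCLM.comp (ContinuousLinearMap.fst ℝ ℂ ℝ)).hasFDerivAt
    have hy : HasFDerivAt (fun p : ℂ × ℝ => p.1.im)
      (Complex.imCLM.comp (ContinuousLinearMap.fst ℝ ℂ ℝ)) p :=
      (Complex.imCLM.comp (ContinuousLinearMap.fst ℝ ℂ ℝ)).hasFDerivAt
    simp only [hqe]
    refine (((hx.mul hx).add (hy.mul hy)).const_mul (B ^ 2 / 4)).congr_fderiv ?_
    ext <;> simp <;> ring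
  have hlin : ∀ (ℓ : ℂ →L[ℝ] ℝ) (k : ℝ) (p e : ℂ × ℝ),
      fderiv ℝ (fun p : ℂ × ℝ => k * ℓ p.1) p e = k * ℓ e.1 := by
    intro ℓ k p e
    have : HasFDerivAt (fun p : ℂ × ℝ => k * ℓ p.1)
        (k • ℓ.comp (ContinuousLinearMap.fst ℝ ℂ ℝ)) p :=
      (ℓ.comp (ContinuousLinearMap.fst ℝ ℂ ℝ)).hasFDerivAt.const_mul k
    rw [this.fderiv]
    simp
  have wX := h.re_integral_weight hc ha (e := (1, 0)) (g' := fun w => B ^ 2 / 2 * w.re)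
    (g'' := fun _ => B ^ 2 / 2) hq (by fun_prop) contDiff_const
    (fun p => by rw [(hfd p).fderiv]; simp; ring)
    (fun p => by simpa using hlin Complex.reCLM (B ^ 2 / 2) p (1, 0))
  have wY := h.re_integral_weight hc ha (e := (Complex.I, 0)) (g' := fun w => B ^ 2 / 2 * w.im)
    (g'' := fun _ => B ^ 2 / 2) hq (by fun_prop) contDiff_const
    (fun p => by rw [(hfd p).fderiv]; simp; ring)
    (fun p => by simpa using hlin Complex.imCLM (B ^ 2 / 2) p (Complex.I, 0))
  have wZ := h.re_integral_weight hc ha (e := (0, 1)) (g' := fun w => 0)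
    (g'' := fun _ => 0) hq contDiff_const contDiff_const
    (fun p => by rw [(hfd p).fderiv]; simp)
    (fun p => by simp)
  have hpos : ∀ e, 0 ≤ ∫ p : ℂ × ℝ, B ^ 2 / 4 * ‖p.1‖ ^ 2 * ‖fderiv ℝ ψ p e‖ ^ 2 ∂(cellMeasure a) :=
    fun e => integral_nonneg fun p => by positivity
  have hpX := hpos (1, 0)
  have hpY := hpos (Complex.I, 0)
  have hpZ := hpos (0, 1)
  have hqψ := h.smul_fst (hof hq)
  have hsum : lap ψ = fun p => dX (dX ψ) p + dY (dY ψ) p + dZ (dZ ψ) p := rfl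
  have hcross : ∫ p, ((B ^ 2 / 4 * ‖p.1‖ ^ 2 : ℝ) : ℂ) * starRingEnd ℂ (ψ p) * lap ψ p
      ∂(cellMeasure a) = (∫ p, ((B ^ 2 / 4 * ‖p.1‖ ^ 2 : ℝ) : ℂ) * starRingEnd ℂ (ψ p)
        * fderiv ℝ (fun p => fderiv ℝ ψ p (1, 0)) p (1, 0) ∂(cellMeasure a))
      + (∫ p, ((B ^ 2 / 4 * ‖p.1‖ ^ 2 : ℝ) : ℂ) * starRingEnd ℂ (ψ p)
        * fderiv ℝ (fun p => fderiv ℝ ψ p (Complex.I, 0)) p (Complex.I, 0) ∂(cellMeasure a))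
      + (∫ p, ((B ^ 2 / 4 * ‖p.1‖ ^ 2 : ℝ) : ℂ) * starRingEnd ℂ (ψ p)
        * fderiv ℝ (fun p => fderiv ℝ ψ p (0, 1)) p (0, 1) ∂(cellMeasure a)) := by
    have i : ∀ e, Integrable (fun p => ((B ^ 2 / 4 * ‖p.1‖ ^ 2 : ℝ) : ℂ) * starRingEnd ℂ (ψ p)
        * fderiv ℝ (fun p => fderiv ℝ ψ p e) p e) (cellMeasure a) := fun e =>
      ((h.conj.smul_fst (hof hq)).mul ((h.dir e).dir e)).integrable
    rw [← integral_add (i _) (i _), ← integral_add ((i (1, 0)).fun_add (i (Complex.I, 0))) (i _)]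
    congr 1
    funext p
    simp only [hsum, dX, dY, dZ]
    unfold dX dY dZ
    ring
  have hrecross := congrArg Complex.re hcross
  simp only [Complex.add_re] at hrecross
  have hsq : ∀ p, ‖-lap ψ p + ((B ^ 2 / 4 * ‖p.1‖ ^ 2 : ℝ) : ℂ) * ψ p‖ ^ 2
      = ‖lap ψ p‖ ^ 2 + ‖((B ^ 2 / 4 * ‖p.1‖ ^ 2 : ℝ) : ℂ) * ψ p‖ ^ 2
        - 2 * (((B ^ 2 / 4 * ‖p.1‖ ^ 2 : ℝ) : ℂ) * starRingEnd ℂ (ψ p) * lap ψ p).re := by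
    intro p
    simp only [← Complex.normSq_eq_norm_sq, Complex.normSq_apply, Complex.add_re, Complex.add_im,
      Complex.mul_re, Complex.mul_im, Complex.neg_re, Complex.neg_im, Complex.conj_re,
      Complex.conj_im, Complex.ofReal_re, Complex.ofReal_im]
    ring
  have j1 : Integrable (fun p => ‖lap ψ p‖ ^ 2) (cellMeasure a) :=
    (memLp_two_iff_integrable_sq_norm h.laplacian.memLp.1).1 h.laplacian.memLp
  have j2 : Integrable (fun p => ‖((B ^ 2 / 4 * ‖p.1‖ ^ 2 : ℝ) : ℂ) * ψ p‖ ^ 2) (cellMeasure a) :=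
    (memLp_two_iff_integrable_sq_norm hqψ.memLp.1).1 hqψ.memLp
  have j3 : Integrable (fun p => ((B ^ 2 / 4 * ‖p.1‖ ^ 2 : ℝ) : ℂ) * starRingEnd ℂ (ψ p) * lap ψ p)
      (cellMeasure a) := ((h.conj.smul_fst (hof hq)).mul h.laplacian).integrable
  have hm : MemLp (fun p => -lap ψ p + ((B ^ 2 / 4 * ‖p.1‖ ^ 2 : ℝ) : ℂ) * ψ p) 2 (cellMeasure a) :=
    h.laplacian.memLp.neg.add hqψ.memLp
  have j3' : Integrable (fun p => 2 * (((B ^ 2 / 4 * ‖p.1‖ ^ 2 : ℝ) : ℂ) * starRingEnd ℂ (ψ p)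
      * lap ψ p).re) (cellMeasure a) := j3.re.const_mul 2
  have hint : ∫ p, (((B ^ 2 / 4 * ‖p.1‖ ^ 2 : ℝ) : ℂ) * starRingEnd ℂ (ψ p) * lap ψ p).re
      ∂(cellMeasure a) = (∫ p, ((B ^ 2 / 4 * ‖p.1‖ ^ 2 : ℝ) : ℂ) * starRingEnd ℂ (ψ p) * lap ψ p
      ∂(cellMeasure a)).re := integral_re j3
  rw [cellNorm_sq h.laplacian.memLp, cellNorm_sq hqψ.memLp, cellNorm_sq hm, cellNorm_sq h.memLp]
  simp only [hsq]
  rw [integral_sub (j1.fun_add j2) j3', integral_add j1 j2, integral_const_mul, hint]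
  rw [integral_const_mul] at wX wY
  simp only [zero_mul, integral_zero, sub_zero] at wZ
  linarith

/-! ### A Sobolev inequality in the plane -/

/-- Smooth functions with compact support on the plane. -/
structure IsTest (f : ℂ → ℂ) : Prop where
  smooth : ContDiff ℝ ∞ f
  supp : HasCompactSupport f

namespace IsTest

variable {f g : ℂ → ℂ}

theorem dir (h : IsTest f) (e : ℂ) : IsTest fun w => fderiv ℝ f w e :=
  ⟨(h.smooth.fderiv_right (m := ∞) (by simp)).clm_apply contDiff_const, h.supp.fderiv_apply ℝ e⟩

theorem conj (h : IsTest f) : IsTest fun w => starRingEnd ℂ (f w) :=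
  ⟨Complex.conjCLE.contDiff.comp h.smooth, h.supp.comp_left (g := starRingEnd ℂ) (map_zero _)⟩

theorem mul (h : IsTest f) (k : IsTest g) : IsTest fun w => f w * g w :=
  ⟨h.smooth.mul k.smooth, h.supp.mul_right⟩

theorem differentiable (h : IsTest f) : Differentiable ℝ f := h.smooth.differentiable (by simp)

theorem integrable (h : IsTest f) : Integrable f :=
  h.smooth.continuous.integrable_of_hasCompactSupport h.supp

theorem integrable_norm_mul (h : IsTest f) (k : IsTest g) :
    Integrable fun w => ‖f w‖ * ‖g w‖ := by
  have := (h.mul k).integrable.norm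
  simpa using this

theorem integrable_norm_sq (h : IsTest f) : Integrable fun w => ‖f w‖ ^ 2 := by
  simpa [sq] using h.integrable_norm_mul h

theorem fderiv_conj (h : IsTest f) (e w : ℂ) :
    fderiv ℝ (fun w => starRingEnd ℂ (f w)) w e = starRingEnd ℂ (fderiv ℝ f w e) := by
  have : HasFDerivAt (fun w => starRingEnd ℂ (f w)) _ w :=
    (Complex.conjCLE.toContinuousLinearMap.hasFDerivAt.comp w (h.differentiable w).hasFDerivAt)
  rw [this.fderiv]
  rfl

theorem fderiv_mul (h : IsTest f) (k : IsTest g) (e w : ℂ) :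
    fderiv ℝ (fun w => f w * g w) w e = fderiv ℝ f w e * g w + f w * fderiv ℝ g w e := by
  rw [fderiv_fun_mul (h.differentiable w) (k.differentiable w)]
  simp only [add_apply, smul_apply, smul_eq_mul]
  ring

theorem dir_comm (h : IsTest f) (e e' w : ℂ) :
    fderiv ℝ (fun w => fderiv ℝ f w e) w e' = fderiv ℝ (fun w => fderiv ℝ f w e') w e := by
  have hd : DifferentiableAt ℝ (fderiv ℝ f) w :=
    (h.smooth.fderiv_right (m := ∞) (by simp)).differentiable (by simp) w
  have h1 : ∀ v v', fderiv ℝ (fun w => fderiv ℝ f w v) w v' = fderiv ℝ (fderiv ℝ f) w v' v := by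
    intro v v'
    have : HasFDerivAt (fun w => fderiv ℝ f w v) _ w := hd.hasFDerivAt.clm_apply (hasFDerivAt_const v w)
    rw [this.fderiv]
    simp
  rw [h1, h1]
  exact (h.smooth.contDiffAt.isSymmSndFDerivAt
    (by simpa using ENat.LEInfty.out)).eq _ _

theorem integral_mul_dir (h : IsTest f) (k : IsTest g) (e : ℂ) :
    ∫ w, f w * fderiv ℝ g w e = -∫ w, fderiv ℝ f w e * g w :=
  integral_mul_fderiv_eq_neg_fderiv_mul_of_integrable ((h.dir e).mul k).integrable
    (h.mul (k.dir e)).integrable (h.mul k).integrable (fun w _ => h.differentiable w)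
    (fun w _ => k.differentiable w)

/-- The fundamental theorem of calculus is used first on the horizontal line through `w₀`, then on
each vertical line; Fubini's theorem combines the two. -/
theorem norm_le_integral (h : IsTest f) (w₀ : ℂ) :
    ‖f w₀‖ ≤ ∫ w, ‖fderiv ℝ (fun w => fderiv ℝ f w 1) w Complex.I‖ := by
  have one : ∀ k : ℝ → ℂ, ContDiff ℝ ∞ k → HasCompactSupport k → ∀ t, ‖k t‖ ≤ ∫ s, ‖deriv k s‖ := by
    intro k hk hks t
    rw [← hks.integral_Iic_deriv_eq (hk.of_le (by simp)) t]
    refine (norm_integral_le_integral_norm _).trans ?_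
    refine setIntegral_le_integral ?_ (ae_of_all _ fun s => norm_nonneg _)
    exact ((hk.continuous_deriv (by simp)).integrable_of_hasCompactSupport hks.deriv).norm
  have line : ∀ {u : ℂ → ℂ}, IsTest u → ∀ b e : ℂ, e ≠ 0 → ∀ t : ℝ,
      ‖u (b + t * e)‖ ≤ ∫ s : ℝ, ‖fderiv ℝ u (b + s * e) e‖ := by
    intro u hu b e he t
    have hk : ContDiff ℝ ∞ fun t : ℝ => u (b + t * e) := by
      refine hu.smooth.comp ?_
      have : ContDiff ℝ ∞ fun t : ℝ => (t : ℂ) := Complex.ofRealCLM.contDiff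
      fun_prop
    have hks : HasCompactSupport fun t : ℝ => u (b + t * e) := by
      refine hu.supp.comp_isClosedEmbedding (g := fun t : ℝ => b + t * e) ?_
      have h1 : Topology.IsClosedEmbedding fun t : ℝ => (t : ℂ) := Complex.isometry_ofReal.isClosedEmbedding
      have h2 := (Homeomorph.mulRight₀ e he).trans (Homeomorph.addLeft b)
      exact ((Homeomorph.mulRight₀ e he).trans (Homeomorph.addLeft b)).isClosedEmbedding.comp h1
    have hd : ∀ s : ℝ, deriv (fun t : ℝ => u (b + t * e)) s = fderiv ℝ u (b + s * e) e := by
      intro s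
      have h1 : HasDerivAt (fun t : ℝ => b + (t : ℂ) * e) (1 * e) s :=
        ((Complex.ofRealCLM.hasDerivAt (x := s)).mul_const e).const_add b
      rw [one_mul] at h1
      exact ((hu.differentiable _).hasFDerivAt.comp_hasDerivAt s h1).deriv
    have := one _ hk hks t
    simpa only [hd] using this
  set D := fun w => fderiv ℝ (fun w => fderiv ℝ f w 1) w Complex.I with hD
  have hDt : IsTest D := (h.dir 1).dir Complex.I
  have hmp := Complex.volume_preserving_equiv_real_prod.symm
  have hpint : Integrable (fun q : ℝ × ℝ => ‖D (Complex.measurableEquivRealProd.symm q)‖)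
      (volume.prod volume) := by
    have := (hmp.integrable_comp_emb Complex.measurableEquivRealProd.symm.measurableEmbedding).2
      hDt.integrable.norm
    exact this
  have hval : ∫ w, ‖D w‖ = ∫ x : ℝ, ∫ y : ℝ, ‖D (x + y * Complex.I)‖ := by
    rw [← hmp.integral_comp Complex.measurableEquivRealProd.symm.measurableEmbedding
      (fun w => ‖D w‖), Measure.volume_eq_prod, integral_prod _ hpint]
    simp [Complex.measurableEquivRealProd_symm_apply, Complex.mk_eq_add_mul_I]
  rw [hval]
  have hint : Integrable fun x : ℝ => ∫ y : ℝ, ‖D (x + y * Complex.I)‖ := by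
    have := hpint.integral_prod_left
    simpa [Complex.measurableEquivRealProd_symm_apply, Complex.mk_eq_add_mul_I] using this
  have e1 : ‖f w₀‖ ≤ ∫ x : ℝ, ‖fderiv ℝ f (x + w₀.im * Complex.I) 1‖ := by
    have := line h (w₀.im * Complex.I) 1 one_ne_zero w₀.re
    simpa [add_comm, Complex.re_add_im] using this
  refine e1.trans ?_
  refine integral_mono_of_nonneg (ae_of_all _ fun x => norm_nonneg _) hint (ae_of_all _ fun x => ?_)
  exact line (h.dir 1) x Complex.I Complex.I_ne_zero w₀.im

/-- The Laplacian in the plane. -/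
def lap₂ (f : ℂ → ℂ) (w : ℂ) : ℂ := fderiv ℝ (fun w => fderiv ℝ f w 1) w 1
  + fderiv ℝ (fun w => fderiv ℝ f w Complex.I) w Complex.I

/-- Applying `norm_le_integral` to `|f|²` bounds the left side by `s⁻¹‖f_xy‖² + s‖f‖² + ‖f_x‖² +
‖f_y‖²`. By parts, `‖(s - Δ)f‖²` is `s²‖f‖² + ‖f_xx‖² + ‖f_yy‖² + 2‖f_xy‖² + 2s‖∇f‖²`, and `s⁻¹`
times this dominates. The factor `s⁻¹` is what makes the sum over wave numbers converge later. -/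
theorem norm_sq_le (h : IsTest f) {s : ℝ} (hs : 0 < s) (w₀ : ℂ) :
    ‖f w₀‖ ^ 2 ≤ s⁻¹ * ∫ w, ‖(s : ℂ) * f w - lap₂ f w‖ ^ 2 := by
  set fx := fun w => fderiv ℝ f w 1 with hfx
  set fy := fun w => fderiv ℝ f w Complex.I with hfy
  set fxx := fun w => fderiv ℝ fx w 1 with hfxx
  set fyy := fun w => fderiv ℝ fy w Complex.I with hfyy
  set fxy := fun w => fderiv ℝ fx w Complex.I with hfxy
  have tx : IsTest fx := h.dir 1
  have ty : IsTest fy := h.dir Complex.I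
  have txx : IsTest fxx := tx.dir 1
  have tyy : IsTest fyy := ty.dir Complex.I
  have txy : IsTest fxy := tx.dir Complex.I
  have hyx : ∀ w, fderiv ℝ fy w 1 = fxy w := fun w => h.dir_comm Complex.I 1 w
  have hre : ∀ {u : ℂ → ℂ}, ∫ w, u w * starRingEnd ℂ (u w) = ((∫ w, ‖u w‖ ^ 2 : ℝ) : ℂ) := by
    intro u
    rw [← integral_complex_ofReal]
    congr 1
    funext w
    rw [Complex.mul_conj']
    push_cast
    rfl
  have k1 : ∫ w, starRingEnd ℂ (f w) * fxx w = -((∫ w, ‖fx w‖ ^ 2 : ℝ) : ℂ) := by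
    rw [h.conj.integral_mul_dir tx, ← hre]
    simp only [h.fderiv_conj, mul_comm]
    rfl
  have k2 : ∫ w, starRingEnd ℂ (f w) * fyy w = -((∫ w, ‖fy w‖ ^ 2 : ℝ) : ℂ) := by
    rw [h.conj.integral_mul_dir ty, ← hre]
    simp only [h.fderiv_conj, mul_comm]
    rfl
  -- One `x` derivative and one `y` derivative change sides, and the two signs cancel.
  have k3 : ∫ w, starRingEnd ℂ (fyy w) * fxx w = ((∫ w, ‖fxy w‖ ^ 2 : ℝ) : ℂ) := by
    rw [tyy.conj.integral_mul_dir tx, ← hre]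
    have e1 : ∀ w, fderiv ℝ (fun w => starRingEnd ℂ (fyy w)) w 1 * fx w
        = fx w * fderiv ℝ (fun w => starRingEnd ℂ (fxy w)) w Complex.I := fun w => by
      rw [tyy.fderiv_conj, txy.fderiv_conj, mul_comm, ty.dir_comm]
      simp only [hyx]
    simp only [e1]
    rw [tx.integral_mul_dir txy.conj, neg_neg]
  have hsq : ∀ w, ‖(s : ℂ) * f w - lap₂ f w‖ ^ 2 = s ^ 2 * ‖f w‖ ^ 2 + ‖fxx w‖ ^ 2 + ‖fyy w‖ ^ 2
      + 2 * ((starRingEnd ℂ (fyy w) * fxx w).re) + -2 * s * ((starRingEnd ℂ (f w) * fxx w).re)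
      + -2 * s * ((starRingEnd ℂ (f w) * fyy w).re) := by
    intro w
    have : lap₂ f w = fxx w + fyy w := rfl
    rw [this]
    simp only [← Complex.normSq_eq_norm_sq, Complex.normSq_apply, Complex.add_re, Complex.add_im,
      Complex.mul_re, Complex.mul_im, Complex.sub_re, Complex.sub_im, Complex.conj_re,
      Complex.conj_im, Complex.ofReal_re, Complex.ofReal_im]
    ring
  have i1 : Integrable fun w => (starRingEnd ℂ (f w) * fxx w).re := (h.conj.mul txx).integrable.re
  have i2 : Integrable fun w => (starRingEnd ℂ (f w) * fyy w).re := (h.conj.mul tyy).integrable.re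
  have i3 : Integrable fun w => (starRingEnd ℂ (fyy w) * fxx w).re :=
    (tyy.conj.mul txx).integrable.re
  have v1 : ∫ w, (starRingEnd ℂ (f w) * fxx w).re = -∫ w, ‖fx w‖ ^ 2 := by
    have := congrArg Complex.re k1
    rw [Complex.neg_re, Complex.ofReal_re] at this
    rw [← this]
    exact integral_re (h.conj.mul txx).integrable
  have v2 : ∫ w, (starRingEnd ℂ (f w) * fyy w).re = -∫ w, ‖fy w‖ ^ 2 := by
    have := congrArg Complex.re k2
    rw [Complex.neg_re, Complex.ofReal_re] at this
    rw [← this]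
    exact integral_re (h.conj.mul tyy).integrable
  have v3 : ∫ w, (starRingEnd ℂ (fyy w) * fxx w).re = ∫ w, ‖fxy w‖ ^ 2 := by
    have := congrArg Complex.re k3
    rw [Complex.ofReal_re] at this
    rw [← this]
    exact integral_re (tyy.conj.mul txx).integrable
  have hident : ∫ w, ‖(s : ℂ) * f w - lap₂ f w‖ ^ 2 = s ^ 2 * (∫ w, ‖f w‖ ^ 2) + (∫ w, ‖fxx w‖ ^ 2)
      + (∫ w, ‖fyy w‖ ^ 2) + 2 * (∫ w, ‖fxy w‖ ^ 2) + 2 * s * (∫ w, ‖fx w‖ ^ 2)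
      + 2 * s * (∫ w, ‖fy w‖ ^ 2) := by
    simp only [hsq]
    have n0 := h.integrable_norm_sq.const_mul (s ^ 2)
    have n1 := txx.integrable_norm_sq
    have n2 := tyy.integrable_norm_sq
    rw [integral_add ((((n0.fun_add n1).fun_add n2).fun_add (i3.const_mul 2)).fun_add
        (i1.const_mul (-2 * s))) (i2.const_mul (-2 * s)),
      integral_add (((n0.fun_add n1).fun_add n2).fun_add (i3.const_mul 2)) (i1.const_mul (-2 * s)),
      integral_add ((n0.fun_add n1).fun_add n2) (i3.const_mul 2), integral_add (n0.fun_add n1) n2,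
      integral_add n0 n1]
    simp only [integral_const_mul]
    rw [v1, v2, v3]
    ring
  have hmain : ‖f w₀‖ ^ 2 ≤ s⁻¹ * (∫ w, ‖fxy w‖ ^ 2) + s * (∫ w, ‖f w‖ ^ 2)
      + (∫ w, ‖fx w‖ ^ 2) + (∫ w, ‖fy w‖ ^ 2) := by
    have e0 := (h.mul h.conj).norm_le_integral w₀
    rw [norm_mul, RCLike.norm_conj, ← sq] at e0
    refine e0.trans ?_
    rw [← integral_const_mul, ← integral_const_mul, ← integral_add
      (txy.integrable_norm_sq.const_mul _) (h.integrable_norm_sq.const_mul _), ← integral_add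
      ((txy.integrable_norm_sq.const_mul _).fun_add (h.integrable_norm_sq.const_mul _))
        tx.integrable_norm_sq, ← integral_add
      (((txy.integrable_norm_sq.const_mul _).fun_add (h.integrable_norm_sq.const_mul _)).fun_add
        tx.integrable_norm_sq) ty.integrable_norm_sq]
    refine integral_mono_of_nonneg (ae_of_all _ fun w => norm_nonneg _)
      ((((txy.integrable_norm_sq.const_mul _).fun_add (h.integrable_norm_sq.const_mul _)).fun_add
        tx.integrable_norm_sq).fun_add ty.integrable_norm_sq) (ae_of_all _ fun w => ?_)
    have e1 : (fun w => fderiv ℝ (fun w => f w * starRingEnd ℂ (f w)) w 1)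
        = fun w => fx w * starRingEnd ℂ (f w) + f w * starRingEnd ℂ (fx w) := by
      funext w
      rw [h.fderiv_mul h.conj, h.fderiv_conj]
    have e2 : fderiv ℝ (fun w => fx w * starRingEnd ℂ (f w) + f w * starRingEnd ℂ (fx w)) w
        Complex.I = (fxy w * starRingEnd ℂ (f w) + fx w * starRingEnd ℂ (fy w))
          + (fy w * starRingEnd ℂ (fx w) + f w * starRingEnd ℂ (fxy w)) := by
      rw [fderiv_fun_add ((tx.mul h.conj).differentiable w) ((h.mul tx.conj).differentiable w),
        add_apply, tx.fderiv_mul h.conj, h.fderiv_mul tx.conj, h.fderiv_conj, tx.fderiv_conj]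
    simp only [e1, e2]
    have e3 : ‖(fxy w * starRingEnd ℂ (f w) + fx w * starRingEnd ℂ (fy w))
          + (fy w * starRingEnd ℂ (fx w) + f w * starRingEnd ℂ (fxy w))‖
        ≤ (‖fxy w‖ * ‖f w‖ + ‖fx w‖ * ‖fy w‖) + (‖fy w‖ * ‖fx w‖ + ‖f w‖ * ‖fxy w‖) := by
      refine (norm_add_le _ _).trans (add_le_add ?_ ?_) <;>
      · refine (norm_add_le _ _).trans_eq ?_
        simp only [norm_mul, RCLike.norm_conj]
    refine e3.trans ?_
    have a1 : 2 * (‖fx w‖ * ‖fy w‖) ≤ ‖fx w‖ ^ 2 + ‖fy w‖ ^ 2 := by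
      nlinarith [sq_nonneg (‖fx w‖ - ‖fy w‖)]
    have a2 : 2 * (‖fxy w‖ * ‖f w‖) ≤ s⁻¹ * ‖fxy w‖ ^ 2 + s * ‖f w‖ ^ 2 := by
      have : 0 ≤ s⁻¹ * (‖fxy w‖ - s * ‖f w‖) ^ 2 := by positivity
      have e : s⁻¹ * (‖fxy w‖ - s * ‖f w‖) ^ 2
          = s⁻¹ * ‖fxy w‖ ^ 2 + s * ‖f w‖ ^ 2 - 2 * (‖fxy w‖ * ‖f w‖) := by
        field_simp
        ring
      linarith
    linarith
  refine hmain.trans ?_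
  rw [hident]
  have p1 : 0 ≤ ∫ w, ‖fxx w‖ ^ 2 := integral_nonneg fun w => sq_nonneg _
  have p2 : 0 ≤ ∫ w, ‖fyy w‖ ^ 2 := integral_nonneg fun w => sq_nonneg _
  have p3 : 0 ≤ ∫ w, ‖fxy w‖ ^ 2 := integral_nonneg fun w => sq_nonneg _
  have p4 : 0 ≤ ∫ w, ‖fx w‖ ^ 2 := integral_nonneg fun w => sq_nonneg _
  have p5 : 0 ≤ ∫ w, ‖fy w‖ ^ 2 := integral_nonneg fun w => sq_nonneg _
  have hs' : 0 ≤ s⁻¹ := by positivity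
  have e : s⁻¹ * (s ^ 2 * (∫ w, ‖f w‖ ^ 2) + (∫ w, ‖fxx w‖ ^ 2)
      + (∫ w, ‖fyy w‖ ^ 2) + 2 * (∫ w, ‖fxy w‖ ^ 2) + 2 * s * (∫ w, ‖fx w‖ ^ 2)
      + 2 * s * (∫ w, ‖fy w‖ ^ 2)) = s * (∫ w, ‖f w‖ ^ 2) + s⁻¹ * (∫ w, ‖fxx w‖ ^ 2)
      + s⁻¹ * (∫ w, ‖fyy w‖ ^ 2) + 2 * (s⁻¹ * (∫ w, ‖fxy w‖ ^ 2)) + 2 * (∫ w, ‖fx w‖ ^ 2)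
      + 2 * (∫ w, ‖fy w‖ ^ 2) := by
    field_simp
  rw [e]
  have q1 := mul_nonneg hs' p1
  have q2 := mul_nonneg hs' p2
  have q3 := mul_nonneg hs' p3
  linarith

end IsTest

/-! ### Fourier series in the direction of the `z`-axis -/

/-- The wave numbers compatible with the quasi-momentum `α`. -/
def waveNumber (a α : ℝ) (k : ℤ) : ℝ := (α + 2 * Real.pi * k) / a

/-- The plane waves in the direction of the `z`-axis. -/
def planeWave (κ z : ℝ) : ℂ := Complex.exp (Complex.I * (κ * z : ℝ))

theorem norm_planeWave (κ z : ℝ) : ‖planeWave κ z‖ = 1 := by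
  rw [planeWave, mul_comm]
  exact Complex.norm_exp_ofReal_mul_I _

theorem planeWave_neg_mul (κ z : ℝ) : planeWave (-κ) z * planeWave κ z = 1 := by
  rw [planeWave, planeWave, ← Complex.exp_add]
  simp

theorem contDiff_planeWave (κ : ℝ) : ContDiff ℝ ∞ (planeWave κ) := by
  unfold planeWave
  have h : ContDiff ℝ ∞ fun z : ℝ => ((κ * z : ℝ) : ℂ) :=
    Complex.ofRealCLM.contDiff.comp (contDiff_const.mul contDiff_id)
  exact (contDiff_const.mul h).cexp

theorem continuous_planeWave (κ : ℝ) : Continuous (planeWave κ) := (contDiff_planeWave κ).continuous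

theorem hasDerivAt_planeWave (κ z : ℝ) :
    HasDerivAt (planeWave κ) (Complex.I * κ * planeWave κ z) z := by
  have h : HasDerivAt (fun z : ℝ => ((κ * z : ℝ) : ℂ)) (κ : ℂ) z := by
    have := ((hasDerivAt_id z).const_mul κ).ofReal_comp
    simpa using this
  have := (h.const_mul Complex.I).cexp
  rw [mul_comm] at this
  exact this

theorem planeWave_add_period {a : ℝ} (ha : a ≠ 0) (α : ℝ) (k : ℤ) (z : ℝ) :
    planeWave (waveNumber a α k) (z + a)
      = Complex.exp (Complex.I * α) * planeWave (waveNumber a α k) z := by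
  rw [planeWave, planeWave, ← Complex.exp_add, Complex.exp_eq_exp_iff_exists_int]
  refine ⟨k, ?_⟩
  rw [waveNumber]
  have ha' : (a : ℂ) ≠ 0 := Complex.ofReal_ne_zero.2 ha
  push_cast
  field_simp
  ring

/-- The coefficients of a quasi-periodic function with respect to the plane waves. -/
def blochCoeff (a α : ℝ) (k : ℤ) (f : ℝ → ℂ) : ℂ :=
  (1 / a : ℝ) • ∫ z in (0 : ℝ)..a, planeWave (-waveNumber a α k) z * f z

theorem planeWave_eq_fourier {a : ℝ} (α : ℝ) (k : ℤ) (z : ℝ) :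
    planeWave (-waveNumber a α k) z = fourier (-k) (z : AddCircle a) * planeWave (-(α / a)) z := by
  rw [fourier_coe_apply, planeWave, planeWave, ← Complex.exp_add, waveNumber]
  congr 1
  push_cast
  ring

/-- The factor `exp(-iαz/a)` removes the quasi-momentum, so the theory of ordinary Fourier series
applies. -/
theorem blochCoeff_eq_fourierCoeffOn {a : ℝ} (ha : 0 < a) (α : ℝ) (k : ℤ) (f : ℝ → ℂ) :
    blochCoeff a α k f = fourierCoeffOn ha (fun z => planeWave (-(α / a)) z * f z) k := by
  rw [fourierCoeffOn_eq_integral, blochCoeff]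
  have h0 : a - 0 = a := sub_zero a
  congr 1
  · rw [h0]
  · refine intervalIntegral.integral_congr fun z _ => ?_
    simp only [smul_eq_mul]
    rw [planeWave_eq_fourier, mul_assoc]
    congr 1
    simp only [fourier_coe_apply, h0]

theorem hasSum_sq_blochCoeff {a : ℝ} (ha : 0 < a) (α : ℝ) {f : ℝ → ℂ}
    (hf : MemLp f 2 (volume.restrict (Ioc 0 a))) :
    HasSum (fun k => ‖blochCoeff a α k f‖ ^ 2) (a⁻¹ * ∫ z in (0 : ℝ)..a, ‖f z‖ ^ 2) := by
  have hg : MemLp (fun z => planeWave (-(α / a)) z * f z) 2 (volume.restrict (Ioc 0 a)) := by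
    refine hf.of_le ((continuous_planeWave _).aestronglyMeasurable.mul hf.1) (ae_of_all _ fun z => ?_)
    rw [norm_mul, norm_planeWave, one_mul]
  have := hasSum_sq_fourierCoeffOn ha hg
  simp only [← blochCoeff_eq_fourierCoeffOn, norm_mul, norm_planeWave, one_mul, sub_zero,
    smul_eq_mul] at this
  exact this

theorem norm_le_tsum_blochCoeff {a : ℝ} (ha : 0 < a) (α : ℝ) {f : ℝ → ℂ} (hf : Continuous f)
    (hp : ∀ z, f (z + a) = Complex.exp (Complex.I * α) * f z)
    (hs : Summable fun k => ‖blochCoeff a α k f‖) (z : ℝ) :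
    ‖f z‖ ≤ ∑' k, ‖blochCoeff a α k f‖ := by
  have : Fact (0 < a) := ⟨ha⟩
  set g : ℝ → ℂ := fun z => planeWave (-(α / a)) z * f z with hg
  have hgc : Continuous g := (continuous_planeWave _).mul hf
  have hper : Function.Periodic g a := fun z => by
    simp only [hg, hp]
    rw [← mul_assoc, planeWave, planeWave, ← Complex.exp_add]
    congr 2
    have ha' : (a : ℂ) ≠ 0 := Complex.ofReal_ne_zero.2 ha.ne'
    push_cast
    field_simp
    ring
  let G : C(AddCircle a, ℂ) := ⟨hper.lift, continuous_coinduced_dom.2 hgc⟩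
  have hG : ∀ z : ℝ, G (z : AddCircle a) = g z := fun z => hper.lift_coe z
  have hcoef : ∀ k, fourierCoeff G k = blochCoeff a α k f := fun k => by
    rw [fourierCoeff_eq_intervalIntegral _ _ 0, zero_add, blochCoeff]
    congr 1
    refine intervalIntegral.integral_congr fun z _ => ?_
    simp only [hG, hg, smul_eq_mul]
    rw [planeWave_eq_fourier, mul_assoc]
  have hsum : Summable (fourierCoeff G) := by
    refine Summable.of_norm ?_
    simpa only [hcoef] using hs
  have key := has_pointwise_sum_fourier_series_of_summable hsum (z : AddCircle a)
  rw [hG] at key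
  have h1 : ‖g z‖ = ‖f z‖ := by rw [hg, norm_mul, norm_planeWave, one_mul]
  rw [← h1, ← key.tsum_eq]
  have hn : ∀ k, ‖fourierCoeff G k • fourier k (z : AddCircle a)‖ = ‖blochCoeff a α k f‖ := fun k => by
    rw [norm_smul, hcoef, fourier_apply, Circle.norm_coe, mul_one]
  refine (norm_tsum_le_tsum_norm ?_).trans_eq ?_
  · simpa only [hn] using hs
  · simp only [hn]

/-! ### Integrals depending on a parameter -/

theorem hasFDerivAt_integral_snd {F : Type*} [NormedAddCommGroup F] [NormedSpace ℝ F]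
    {u : ℂ × ℝ → F} (hu : ContDiff ℝ ∞ u) (a : ℝ) (w : ℂ) :
    HasFDerivAt (fun w => ∫ z in (0 : ℝ)..a, u (w, z))
      (∫ z in (0 : ℝ)..a, (fderiv ℝ u (w, z)).comp (ContinuousLinearMap.inl ℝ ℂ ℝ)) w := by
  have hc : Continuous fun p => (fderiv ℝ u p).comp (ContinuousLinearMap.inl ℝ ℂ ℝ) :=
    (hu.continuous_fderiv (by simp)).clm_comp continuous_const
  have hcu : Continuous u := hu.continuous
  obtain ⟨M, hM⟩ := ((isCompact_closedBall w 1).prod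
    (isCompact_uIcc (a := (0 : ℝ)) (b := a))).exists_bound_of_continuousOn hc.continuousOn
  refine intervalIntegral.hasFDerivAt_integral_of_dominated_of_fderiv_le (bound := fun _ => M)
    (F' := fun w z => (fderiv ℝ u (w, z)).comp (ContinuousLinearMap.inl ℝ ℂ ℝ))
    (Metric.closedBall_mem_nhds w one_pos) ?_ ?_ ?_ ?_ ?_ ?_
  · exact Filter.Eventually.of_forall fun x =>
      (hcu.comp (Continuous.prodMk_right x)).aestronglyMeasurable
  · exact (hcu.comp (Continuous.prodMk_right w)).intervalIntegrable _ _
  · exact (hc.comp (Continuous.prodMk_right w)).aestronglyMeasurable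
  · exact ae_of_all _ fun z hz x hx => hM (x, z) ⟨hx, uIoc_subset_uIcc hz⟩
  · exact intervalIntegrable_const
  · refine ae_of_all _ fun z _ x _ => ?_
    exact ((hu.differentiable (by simp)) (x, z)).hasFDerivAt.comp x (hasFDerivAt_prodMk_left x z)

theorem fderiv_integral_snd {F : Type*} [NormedAddCommGroup F] [NormedSpace ℝ F]
    [CompleteSpace F] {u : ℂ × ℝ → F} (hu : ContDiff ℝ ∞ u) (a : ℝ) (w e : ℂ) :
    fderiv ℝ (fun w => ∫ z in (0 : ℝ)..a, u (w, z)) w e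
      = ∫ z in (0 : ℝ)..a, fderiv ℝ u (w, z) (e, 0) := by
  have hc : Continuous fun z => (fderiv ℝ u (w, z)).comp (ContinuousLinearMap.inl ℝ ℂ ℝ) :=
    ((hu.continuous_fderiv (by simp)).comp (Continuous.prodMk_right w)).clm_comp continuous_const
  rw [(hasFDerivAt_integral_snd hu a w).fderiv,
    ContinuousLinearMap.intervalIntegral_apply (hc.intervalIntegrable _ _)]
  simp

/-- The derivative is an integral of the same kind with values in continuous linear maps, so the
induction must range over all target spaces. -/
theorem contDiff_integral_snd (n : ℕ) : ∀ {F : Type} [NormedAddCommGroup F] [NormedSpace ℝ F]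
    [CompleteSpace F] {u : ℂ × ℝ → F}, ContDiff ℝ ∞ u → ∀ a : ℝ,
    ContDiff ℝ n (fun w => ∫ z in (0 : ℝ)..a, u (w, z)) := by
  induction n with
  | zero =>
    intro F _ _ _ u hu a
    rw [Nat.cast_zero, contDiff_zero]
    exact continuous_iff_continuousAt.2 fun w => (hasFDerivAt_integral_snd hu a w).continuousAt
  | succ n ih =>
    intro F _ _ _ u hu a
    rw [Nat.cast_succ, contDiff_succ_iff_hasFDerivAt]
    refine ⟨_, ?_, hasFDerivAt_integral_snd hu a⟩
    exact ih ((hu.fderiv_right (m := ∞) (by simp)).clm_comp contDiff_const) a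

/-! ### The Sobolev inequality on the cell -/

theorem summable_waveNumber {a : ℝ} (ha : 0 < a) (α : ℝ) {s : ℝ} (hs : 0 < s) :
    Summable fun k => (s + waveNumber a α k ^ 2)⁻¹ := by
  have h0 : Summable fun k : ℤ => (2 * Real.pi / a) ^ (-2 : ℝ) *
      (1 / |(k : ℝ) + α / (2 * Real.pi)| ^ (2 : ℝ)) :=
    ((Real.summable_one_div_int_add_rpow (α / (2 * Real.pi)) 2).2 (by norm_num)).mul_left _
  refine Summable.of_norm_bounded_eventually h0 ?_
  -- At the only `k` that may make the wave number vanish, the comparison term is `1 / 0 = 0` and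
  -- bounds nothing; it is set aside.
  have hfin : {k : ℤ | (k : ℝ) + α / (2 * Real.pi) = 0}.Finite := by
    refine Set.Subsingleton.finite fun k hk l hl => ?_
    have : (k : ℝ) = l := by
      have h1 : (k : ℝ) + α / (2 * Real.pi) = 0 := hk
      have h2 : (l : ℝ) + α / (2 * Real.pi) = 0 := hl
      linarith
    exact_mod_cast this
  filter_upwards [hfin.compl_mem_cofinite] with k hk
  have hk' : (k : ℝ) + α / (2 * Real.pi) ≠ 0 := hk
  have hpi := Real.pi_pos
  have hκ : waveNumber a α k = (2 * Real.pi / a) * ((k : ℝ) + α / (2 * Real.pi)) := by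
    rw [waveNumber]
    field_simp
    ring
  have hpos : 0 < (2 * Real.pi / a) ^ 2 * ((k : ℝ) + α / (2 * Real.pi)) ^ 2 := by positivity
  rw [Real.norm_of_nonneg (by positivity), hκ, mul_pow,
    Real.rpow_neg (by positivity), Real.rpow_two, Real.rpow_two, sq_abs, one_div, ← mul_inv]
  exact inv_anti₀ hpos (by linarith)

/-- The constant in the Sobolev inequality on the cell. -/
def sobolevConst (a α s : ℝ) : ℝ := √(a⁻¹ * ∑' k, (s + waveNumber a α k ^ 2)⁻¹)

/-- Dominated convergence, with the series at `s = 1` as majorant. This decay is what makes the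
inner part of `V` an arbitrarily small perturbation. -/
theorem tendsto_sobolevConst {a : ℝ} (ha : 0 < a) (α : ℝ) :
    Filter.Tendsto (sobolevConst a α) Filter.atTop (nhds 0) := by
  have h1 : Filter.Tendsto (fun s => ∑' k, (s + waveNumber a α k ^ 2)⁻¹) Filter.atTop
      (nhds (∑' _ : ℤ, (0 : ℝ))) := by
    refine tendsto_tsum_of_dominated_convergence (summable_waveNumber ha α one_pos) (fun k => ?_) ?_
    · exact tendsto_inv_atTop_zero.comp (Filter.tendsto_atTop_add_const_right _ _ Filter.tendsto_id)
    · filter_upwards [Filter.eventually_ge_atTop 1] with s hs k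
      have : 0 < s := by linarith
      rw [Real.norm_of_nonneg (by positivity)]
      exact inv_anti₀ (by positivity) (by linarith)
  have h2 := (Real.continuous_sqrt.tendsto _).comp (h1.const_mul a⁻¹)
  have h3 : sobolevConst a α = fun s => √(a⁻¹ * ∑' k, (s + waveNumber a α k ^ 2)⁻¹) := rfl
  rw [h3]
  simpa [Function.comp_def] using h2

theorem blochCoeff_add {a α : ℝ} {k : ℤ} {f g : ℝ → ℂ} (hf : Continuous f) (hg : Continuous g) :
    blochCoeff a α k (fun z => f z + g z) = blochCoeff a α k f + blochCoeff a α k g := by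
  have hc := continuous_planeWave (-waveNumber a α k)
  rw [blochCoeff, blochCoeff, blochCoeff, ← smul_add, ← intervalIntegral.integral_add
    (Continuous.intervalIntegrable (by fun_prop) _ _)
    (Continuous.intervalIntegrable (by fun_prop) _ _)]
  simp only [mul_add]

theorem blochCoeff_const_mul {a α : ℝ} {k : ℤ} (c : ℂ) (f : ℝ → ℂ) :
    blochCoeff a α k (fun z => c * f z) = c * blochCoeff a α k f := by
  simp only [blochCoeff, mul_left_comm _ c]
  rw [intervalIntegral.integral_const_mul, mul_smul_comm]

namespace IsBlochSmooth

variable {a α : ℝ} {c : ℂ} {u : ℂ × ℝ → ℂ}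

theorem contDiff_planeWave_mul (h : IsBlochSmooth a c u) (κ : ℝ) :
    ContDiff ℝ ∞ fun p : ℂ × ℝ => planeWave κ p.2 * u p :=
  ((contDiff_planeWave κ).comp contDiff_snd).mul h.smooth

theorem fderiv_blochCoeff (h : IsBlochSmooth a c u) (k : ℤ) (w e : ℂ) :
    fderiv ℝ (fun w => blochCoeff a α k fun z => u (w, z)) w e
      = blochCoeff a α k fun z => fderiv ℝ u (w, z) (e, 0) := by
  have hs := h.contDiff_planeWave_mul (-waveNumber a α k)
  simp only [blochCoeff]
  have hd := (hasFDerivAt_integral_snd hs a w).differentiableAt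
  rw [fderiv_fun_const_smul hd, smul_apply, fderiv_integral_snd hs]
  congr 1
  refine intervalIntegral.integral_congr fun z _ => ?_
  have h1 : HasFDerivAt (fun p : ℂ × ℝ => planeWave (-waveNumber a α k) p.2)
      (fderiv ℝ (fun p : ℂ × ℝ => planeWave (-waveNumber a α k) p.2) (w, z)) (w, z) :=
    (((contDiff_planeWave _).comp contDiff_snd).differentiable (by simp) (w, z)).hasFDerivAt
  have h2 : fderiv ℝ (fun p : ℂ × ℝ => planeWave (-waveNumber a α k) p.2) (w, z) (e, 0) = 0 := by
    have h4 : HasFDerivAt (planeWave (-waveNumber a α k))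
        (fderiv ℝ (planeWave (-waveNumber a α k)) z) ((w, z) : ℂ × ℝ).2 :=
      (((contDiff_planeWave (-waveNumber a α k)).differentiable (by simp)) z).hasFDerivAt
    have h3 : HasFDerivAt (fun p : ℂ × ℝ => planeWave (-waveNumber a α k) p.2) _ (w, z) :=
      h4.comp (w, z) (hasFDerivAt_snd (𝕜 := ℝ) (E := ℂ) (F := ℝ))
    rw [h3.fderiv]
    simp
  rw [fderiv_fun_mul h1.differentiableAt (h.differentiable _)]
  simp only [add_apply, smul_apply, h2, smul_eq_mul, mul_zero, add_zero]

theorem isTest_blochCoeff (h : IsBlochSmooth a c u) (k : ℤ) :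
    IsTest fun w => blochCoeff a α k fun z => u (w, z) := by
  have hs := h.contDiff_planeWave_mul (-waveNumber a α k)
  constructor
  · refine ContDiff.const_smul _ ?_
    rw [contDiff_infty]
    exact fun n => contDiff_integral_snd n hs a
  · obtain ⟨ρ, hρ⟩ := h.support
    refine HasCompactSupport.of_support_subset_isCompact (isCompact_closedBall (0 : ℂ) ρ) ?_
    intro w hw
    by_contra hw'
    refine hw ?_
    have : ∀ z, u (w, z) = 0 := fun z => hρ w z (by simpa using hw')
    simp [blochCoeff, this]

theorem blochCoeff_dZ (h : IsBlochSmooth a (Complex.exp (Complex.I * α)) u) (ha : 0 < a) (k : ℤ)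
    (w : ℂ) : blochCoeff a α k (fun z => fderiv ℝ u (w, z) (0, 1))
      = Complex.I * waveNumber a α k * blochCoeff a α k fun z => u (w, z) := by
  set κ := waveNumber a α k with hκ
  have hd : ∀ z, HasDerivAt (fun z => u (w, z)) (fderiv ℝ u (w, z) (0, 1)) z := fun z =>
    (h.differentiable (w, z)).hasFDerivAt.comp_hasDerivAt z
      ((hasDerivAt_const z w).prodMk (hasDerivAt_id z))
  have hc : Continuous fun z => fderiv ℝ u (w, z) (0, 1) :=
    (h.dir (0, 1)).continuous.comp (Continuous.prodMk_right w)
  have hcu : Continuous fun z => u (w, z) := h.continuous.comp (Continuous.prodMk_right w)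
  have hpc := continuous_planeWave (-κ)
  have key := intervalIntegral.integral_mul_deriv_eq_deriv_mul (a := 0) (b := a)
    (fun z _ => hasDerivAt_planeWave (-κ) z) (fun z _ => hd z)
    ((continuous_const.mul hpc).intervalIntegrable _ _) (hc.intervalIntegrable _ _)
  -- The wave number `κ` is compatible with `α`, so `exp(-iκz) u` is periodic and the boundary terms
  -- cancel.
  have hb : planeWave (-κ) a * u (w, a) = planeWave (-κ) 0 * u (w, 0) := by
    have h1 := planeWave_neg_mul κ a
    have h2 := planeWave_add_period ha.ne' α k 0
    have h3 := h.bloch w 0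
    rw [zero_add] at h2 h3
    have h4 : ∀ κ, planeWave κ 0 = 1 := fun κ => by simp [planeWave]
    rw [← hκ, h4, mul_one] at h2
    rw [h2] at h1
    rw [h3, ← mul_assoc, h1, h4]
  rw [hb, sub_self, zero_sub] at key
  rw [blochCoeff, ← hκ, key, blochCoeff, ← hκ, mul_smul_comm, ← intervalIntegral.integral_const_mul,
    ← intervalIntegral.integral_neg]
  congr 1
  refine intervalIntegral.integral_congr fun z _ => ?_
  push_cast
  ring

/-- On the `k`-th coefficient `∂²/∂z²` acts as `-κ²`, so the operator `s - Δ` in space becomes the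
planar one with `s` raised by `κ²`. -/
theorem blochCoeff_helmholtz (h : IsBlochSmooth a (Complex.exp (Complex.I * α)) u) (ha : 0 < a)
    (k : ℤ) (s : ℝ) (w : ℂ) : blochCoeff a α k (fun z => s * u (w, z) - lap u (w, z))
      = ((s + waveNumber a α k ^ 2 : ℝ) : ℂ) * (blochCoeff a α k fun z => u (w, z))
        - IsTest.lap₂ (fun w => blochCoeff a α k fun z => u (w, z)) w := by
  have hw : Continuous fun z : ℝ => (w, z) := Continuous.prodMk_right w
  have hu : Continuous fun z => u (w, z) := h.continuous.comp hw
  have hxx : Continuous fun z => fderiv ℝ (fun p => fderiv ℝ u p (1, 0)) (w, z) (1, 0) :=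
    ((h.dir (1, 0)).dir (1, 0)).continuous.comp hw
  have hyy : Continuous fun z =>
      fderiv ℝ (fun p => fderiv ℝ u p (Complex.I, 0)) (w, z) (Complex.I, 0) :=
    ((h.dir (Complex.I, 0)).dir (Complex.I, 0)).continuous.comp hw
  have hzz : Continuous fun z => fderiv ℝ (fun p => fderiv ℝ u p (0, 1)) (w, z) (0, 1) :=
    ((h.dir (0, 1)).dir (0, 1)).continuous.comp hw
  have e : (fun z => s * u (w, z) - lap u (w, z)) = fun z => (s * u (w, z))
      + (-1) * ((fderiv ℝ (fun p => fderiv ℝ u p (1, 0)) (w, z) (1, 0)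
        + fderiv ℝ (fun p => fderiv ℝ u p (Complex.I, 0)) (w, z) (Complex.I, 0))
        + fderiv ℝ (fun p => fderiv ℝ u p (0, 1)) (w, z) (0, 1)) := by
    funext z
    rw [neg_one_mul, sub_eq_add_neg]
    rfl
  have hlap : IsTest.lap₂ (fun w => blochCoeff a α k fun z => u (w, z)) w
      = (blochCoeff a α k fun z => fderiv ℝ (fun p => fderiv ℝ u p (1, 0)) (w, z) (1, 0))
      + (blochCoeff a α k fun z =>
        fderiv ℝ (fun p => fderiv ℝ u p (Complex.I, 0)) (w, z) (Complex.I, 0)) := by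
    simp only [IsTest.lap₂, h.fderiv_blochCoeff, (h.dir _).fderiv_blochCoeff]
  rw [e, blochCoeff_add ?_ ?_, blochCoeff_const_mul, blochCoeff_const_mul,
    blochCoeff_add ?_ hzz, blochCoeff_add hxx hyy, (h.dir (0, 1)).blochCoeff_dZ ha,
    h.blochCoeff_dZ ha, hlap]
  · push_cast
    linear_combination (-waveNumber a α k ^ 2 * blochCoeff a α k fun z => u (w, z)) * Complex.I_sq
  · exact hxx.add hyy
  · exact continuous_const.mul hu
  · exact continuous_const.mul ((hxx.add hyy).add hzz)

/-- The Sobolev inequality on the cell. -/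
theorem norm_le_sobolevConst (h : IsBlochSmooth a (Complex.exp (Complex.I * α)) u) (ha : 0 < a)
    {s : ℝ} (hs : 0 < s) (p : ℂ × ℝ) :
    ‖u p‖ ≤ sobolevConst a α s * cellNorm a fun p => s * u p - lap u p := by
  set G : ℂ × ℝ → ℂ := fun p => s * u p - lap u p with hG
  have hGs : IsBlochSmooth a (Complex.exp (Complex.I * α)) G := by
    have h1 := (h.smul_fst (g := fun _ => (s : ℂ)) contDiff_const).add
      (h.laplacian.smul_fst (g := fun _ => (-1 : ℂ)) contDiff_const)
    have h2 : G = fun p => s * u p + (-1) * lap u p := by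
      funext p
      rw [hG]
      ring
    rw [h2]
    exact h1
  set t : ℤ → ℝ := fun k => s + waveNumber a α k ^ 2 with ht
  have htpos : ∀ k, 0 < t k := fun k => by positivity
  set A : ℤ → ℝ := fun k => ∫ w, ‖blochCoeff a α k fun z => G (w, z)‖ ^ 2 with hA
  have hA0 : ∀ k, 0 ≤ A k := fun k => integral_nonneg fun w => sq_nonneg _
  -- The planar inequality, with parameter `s + κ_k²`, for the `k`-th coefficient.
  have hptw : ∀ k w, ‖blochCoeff a α k fun z => u (w, z)‖ ≤ √((t k)⁻¹) * √(A k) := by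
    intro k w
    rw [← Real.sqrt_mul (inv_nonneg.2 (htpos k).le)]
    refine Real.le_sqrt_of_sq_le ?_
    refine ((h.isTest_blochCoeff k).norm_sq_le (htpos k) w).trans_eq ?_
    simp only [hA, hG, h.blochCoeff_helmholtz ha]
    rfl
  have hsq : Integrable (fun p => ‖G p‖ ^ 2) (cellMeasure a) :=
    (memLp_two_iff_integrable_sq_norm hGs.memLp.1).1 hGs.memLp
  have hN : cellNorm a G ^ 2 = ∫ w, ∫ z in (0 : ℝ)..a, ‖G (w, z)‖ ^ 2 := by
    rw [cellNorm_sq hGs.memLp]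
    rw [cellMeasure_eq_prod] at hsq ⊢
    rw [integral_prod _ hsq]
    simp only [intervalIntegral.integral_of_le ha.le, integral_Ico_eq_integral_Ioc]
  have hint : Integrable fun w => ∫ z in (0 : ℝ)..a, ‖G (w, z)‖ ^ 2 := by
    rw [cellMeasure_eq_prod] at hsq
    have := hsq.integral_prod_left
    simpa only [intervalIntegral.integral_of_le ha.le, integral_Ico_eq_integral_Ioc] using this
  -- Bessel's inequality in `z`, integrated over the plane.
  have hAsum : ∀ S : Finset ℤ, ∑ k ∈ S, A k ≤ a⁻¹ * cellNorm a G ^ 2 := by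
    intro S
    simp only [hA]
    rw [← integral_finsetSum _ fun k _ => (hGs.isTest_blochCoeff k).integrable_norm_sq, hN,
      ← integral_const_mul]
    refine integral_mono_of_nonneg (ae_of_all _ fun w => Finset.sum_nonneg fun k _ => sq_nonneg _)
      (hint.const_mul _) (ae_of_all _ fun w => ?_)
    have hc : Continuous fun z => G (w, z) := hGs.continuous.comp (Continuous.prodMk_right w)
    have hmem : MemLp (fun z => G (w, z)) 2 (volume.restrict (Ioc 0 a)) := by
      rw [memLp_two_iff_integrable_sq_norm hc.aestronglyMeasurable]
      exact ((hc.norm.pow 2).integrableOn_Icc).mono_set Ioc_subset_Icc_self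
    exact sum_le_hasSum S (fun k _ => sq_nonneg _) (hasSum_sq_blochCoeff ha α hmem)
  have hfin : ∀ (w : ℂ) (S : Finset ℤ), ∑ k ∈ S, ‖blochCoeff a α k fun z => u (w, z)‖
      ≤ sobolevConst a α s * cellNorm a G := by
    intro w S
    have e1 : ∑ k ∈ S, ‖blochCoeff a α k fun z => u (w, z)‖ ≤ ∑ k ∈ S, √((t k)⁻¹) * √(A k) :=
      Finset.sum_le_sum fun k _ => hptw k w
    -- Cauchy–Schwarz separates the summable inverses `(s + κ_k²)⁻¹`, which form `sobolevConst`,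
    -- from the norm of `(s - Δ)u`.
    have e2 := Real.sum_sqrt_mul_sqrt_le S (f := fun k => (t k)⁻¹) (g := A)
      (fun k => inv_nonneg.2 (htpos k).le) hA0
    refine e1.trans (e2.trans ?_)
    have e3 : ∑ k ∈ S, (t k)⁻¹ ≤ ∑' k, (t k)⁻¹ :=
      (summable_waveNumber ha α hs).sum_le_tsum S fun k _ => inv_nonneg.2 (htpos k).le
    have e4 : sobolevConst a α s * cellNorm a G
        = √(∑' k, (t k)⁻¹) * √(a⁻¹ * cellNorm a G ^ 2) := by
      rw [sobolevConst, Real.sqrt_mul (inv_nonneg.2 ha.le), Real.sqrt_mul (inv_nonneg.2 ha.le),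
        Real.sqrt_sq (cellNorm_nonneg _)]
      ring
    rw [e4]
    exact mul_le_mul (Real.sqrt_le_sqrt e3) (Real.sqrt_le_sqrt (hAsum S)) (Real.sqrt_nonneg _)
      (Real.sqrt_nonneg _)
  obtain ⟨w, z⟩ := p
  have hsum : Summable fun k => ‖blochCoeff a α k fun z => u (w, z)‖ :=
    summable_of_sum_le (fun k => norm_nonneg _) (hfin w)
  have hc : Continuous fun z => u (w, z) := h.continuous.comp (Continuous.prodMk_right w)
  exact (norm_le_tsum_blochCoeff ha α hc (h.bloch w) hsum z).trans
    (hsum.tsum_le_of_sum_le (hfin w))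

end IsBlochSmooth

/-! ### Relative boundedness of the potential -/

section

variable {B a α : ℝ} {m : ℤ} {V : ℝ → ℝ → ℝ} {ψ : ℂ × ℝ → ℂ}

/-- The operator `-Δ + (B² / 4) r_⊥²` on smooth Bloch functions. -/
def oscVec (B a α : ℝ) (m : ℤ) : core a α m →ₗ[ℂ] sector a m :=
  hamVec B a α m (locallySquareIntegrable_const (B * m))

/-- The differential expression `-Δ + (B² / 4) r_⊥²`. -/
def oscExpr (B : ℝ) (ψ : ℂ × ℝ → ℂ) (p : ℂ × ℝ) : ℂ :=
  -lap ψ p + ((B ^ 2 / 4 * ‖p.1‖ ^ 2 : ℝ) : ℂ) * ψ p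

/-- The constant potential `B m` cancels `-B L_z` on the sector. Facts proved for every `V`, such as
symmetry, thus hold for the oscillator. -/
theorem IsBlochCore.hamExpr_const_eq (h : IsBlochCore a α m ψ) :
    hamExpr B (fun _ _ => B * m) ψ = oscExpr B ψ := by
  funext p
  rw [h.hamExpr_eq, oscExpr]
  push_cast
  ring

theorem coeFn_oscVec (ψ : core a α m) :
    ((oscVec B a α m ψ : sector a m) : BlochSpace a)
      =ᵐ[cellMeasure a] oscExpr B (ψ : ℂ × ℝ → ℂ) := by
  have := coeFn_hamVec (B := B) (locallySquareIntegrable_const (B * m)) ψ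
  rwa [ψ.2.hamExpr_const_eq] at this

/-- Drop one summand of `oscillator_bound` and use `P² + B² Q² ≤ (P + B Q)²`. -/
theorem cellNorm_lap_le (ha : 0 < a) (hB : 0 ≤ B) (ψ : core a α m) :
    cellNorm a (lap (ψ : ℂ × ℝ → ℂ)) ≤ ‖oscVec B a α m ψ‖ + B * ‖coreVec a α m ψ‖ := by
  have h := ψ.2.isBlochSmooth.oscillator_bound (conj_exp_I_mul_self α) ha B
  rw [norm_eq_cellNorm (coeFn_oscVec ψ), norm_eq_cellNorm (coeFn_coreVec ψ)]
  have h0 := cellNorm_nonneg (a := a) (oscExpr B (ψ : ℂ × ℝ → ℂ))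
  have h1 := cellNorm_nonneg (a := a) (ψ : ℂ × ℝ → ℂ)
  refine abs_le_of_sq_le_sq' ?_ (by positivity) |>.2
  have h2 := mul_nonneg h0 (mul_nonneg hB h1)
  change _ ≤ cellNorm a (oscExpr B (ψ : ℂ × ℝ → ℂ)) ^ 2 + _ at h
  nlinarith [sq_nonneg (cellNorm a (fun p => ((B^2/4*‖p.1‖^2:ℝ):ℂ)*(ψ : ℂ × ℝ → ℂ) p))]

theorem cellNorm_quadratic_le (ha : 0 < a) (hB : 0 ≤ B) (ψ : core a α m) :
    cellNorm a (fun p => ((B ^ 2 / 4 * ‖p.1‖ ^ 2 : ℝ) : ℂ) * (ψ : ℂ × ℝ → ℂ) p)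
      ≤ ‖oscVec B a α m ψ‖ + B * ‖coreVec a α m ψ‖ := by
  have h := ψ.2.isBlochSmooth.oscillator_bound (conj_exp_I_mul_self α) ha B
  rw [norm_eq_cellNorm (coeFn_oscVec ψ), norm_eq_cellNorm (coeFn_coreVec ψ)]
  have h0 := cellNorm_nonneg (a := a) (oscExpr B (ψ : ℂ × ℝ → ℂ))
  have h1 := cellNorm_nonneg (a := a) (ψ : ℂ × ℝ → ℂ)
  refine abs_le_of_sq_le_sq' ?_ (by positivity) |>.2
  have h2 := mul_nonneg h0 (mul_nonneg hB h1)
  change _ ≤ cellNorm a (oscExpr B (ψ : ℂ × ℝ → ℂ)) ^ 2 + _ at h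
  nlinarith [sq_nonneg (cellNorm a (lap (ψ : ℂ × ℝ → ℂ)))]

theorem sobolevConst_nonneg (a α s : ℝ) : 0 ≤ sobolevConst a α s := Real.sqrt_nonneg _

/-- The parameter `s` stays free: enlarging it shrinks the coefficient of the oscillator term, at
the cost of the factor `B + s` on the lower order term. -/
theorem norm_apply_le (ha : 0 < a) (hB : 0 ≤ B) {s : ℝ} (hs : 0 < s) (ψ : core a α m)
    (p : ℂ × ℝ) : ‖(ψ : ℂ × ℝ → ℂ) p‖
      ≤ sobolevConst a α s * (‖oscVec B a α m ψ‖ + (B + s) * ‖coreVec a α m ψ‖) := by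
  have h := ψ.2.isBlochSmooth
  refine (h.norm_le_sobolevConst ha hs p).trans
    (mul_le_mul_of_nonneg_left ?_ (sobolevConst_nonneg _ _ _))
  have h1 : (fun p => (s : ℂ) * (ψ : ℂ × ℝ → ℂ) p - lap (ψ : ℂ × ℝ → ℂ) p)
      = fun p => (s : ℂ) * (ψ : ℂ × ℝ → ℂ) p + (-1) * lap (ψ : ℂ × ℝ → ℂ) p := by
    funext p; ring
  rw [h1]
  refine (cellNorm_add_le (h.memLp.const_mul _) (h.laplacian.memLp.const_mul _)).trans ?_
  rw [cellNorm_const_mul, cellNorm_const_mul, Complex.norm_real, Real.norm_of_nonneg hs.le,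
    norm_neg, norm_one, one_mul]
  have := cellNorm_lap_le ha hB ψ
  rw [norm_eq_cellNorm (coeFn_coreVec ψ)] at *
  linarith

theorem LocallySquareIntegrable.memLp_indicator (hV : LocallySquareIntegrable V) (a R : ℝ) :
    MemLp ({p : ℂ × ℝ | ‖p.1‖ ≤ R}.indicator fun p => ((V ‖p.1‖ p.2 : ℝ) : ℂ)) 2
      (cellMeasure a) := by
  have hS : MeasurableSet {p : ℂ × ℝ | ‖p.1‖ ≤ R} :=
    measurableSet_le (by fun_prop) measurable_const
  rw [memLp_indicator_iff_restrict hS, cellMeasure, Measure.restrict_restrict hS]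
  have hK : IsCompact (Metric.closedBall (0 : ℂ) R ×ˢ Icc (0 : ℝ) a) :=
    (isCompact_closedBall _ _).prod isCompact_Icc
  refine MemLp.mono_measure (Measure.restrict_mono ?_ le_rfl) (hV _ hK).ofReal
  rintro ⟨w, z⟩ ⟨h1, h2⟩
  exact ⟨by simpa using h1, Ico_subset_Icc_self h2.2⟩

/-- A locally square integrable potential which grows at most like `c r_⊥²` with `c < B² / 4` is a
small perturbation of the oscillator. -/
theorem exists_relative_bound {R C C_V : ℝ} (ha : 0 < a) (hB : 0 < B)
    (hV : LocallySquareIntegrable V) (hCV : C_V < B ^ 2 / 4)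
    (hgrow : ∀ r z : ℝ, R < r → |V r z| ≤ C + C_V * r ^ 2) :
    ∃ θ b : ℝ, 0 ≤ θ ∧ θ < 1 ∧ 0 ≤ b ∧ ∀ ψ : core a α m,
      ‖hamVec B a α m hV ψ - oscVec B a α m ψ‖
        ≤ θ * ‖oscVec B a α m ψ‖ + b * ‖coreVec a α m ψ‖ := by
  set S : Set (ℂ × ℝ) := {p | ‖p.1‖ ≤ R} with hSdef
  have hS : MeasurableSet S := measurableSet_le (by fun_prop) measurable_const
  set W : ℂ × ℝ → ℂ := S.indicator fun p => ((V ‖p.1‖ p.2 : ℝ) : ℂ) with hWdef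
  have hW : MemLp W 2 (cellMeasure a) := hV.memLp_indicator a R
  set N := cellNorm a W with hN
  have hN0 : 0 ≤ N := cellNorm_nonneg _
  -- The relative bound of the outer part, fixed by `κ * (B² / 4) = max C_V 0`; the maximum allows
  -- for negative `C_V`.
  set κ := 4 * max C_V 0 / B ^ 2 with hκ
  have hκ0 : 0 ≤ κ := by positivity
  have hκ1 : κ < 1 := by
    rw [hκ, div_lt_one (by positivity)]
    rcases max_cases C_V 0 with ⟨h, -⟩ | ⟨h, -⟩ <;> rw [h]
    · linarith
    · nlinarith [sq_pos_of_pos hB]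
  -- Take `s` so large that the inner part, with relative bound `N * sobolevConst a α s`, fits into
  -- the gap `1 - κ`.
  obtain ⟨s, hs, hsθ⟩ : ∃ s : ℝ, 0 < s ∧ κ + N * sobolevConst a α s < 1 := by
    have h1 : Filter.Tendsto (fun s => κ + N * sobolevConst a α s) Filter.atTop
        (nhds (κ + N * 0)) := ((tendsto_sobolevConst ha α).const_mul N).const_add κ
    rw [mul_zero, add_zero] at h1
    exact ((Filter.eventually_gt_atTop 0).and (h1.eventually_lt_const hκ1)).exists
  have hc0 := sobolevConst_nonneg a α s
  refine ⟨κ + N * sobolevConst a α s,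
    N * sobolevConst a α s * (B + s) + |C| + |B * m| + κ * B, by positivity, hsθ,
    by positivity, fun ψ => ?_⟩
  set u : ℂ × ℝ → ℂ := (ψ : ℂ × ℝ → ℂ)
  have hu := ψ.2.isBlochSmooth
  have hsup := norm_apply_le ha hB.le hs ψ
  set P := ‖oscVec B a α m ψ‖
  set Q := ‖coreVec a α m ψ‖ with hQ
  have hQu : Q = cellNorm a u := norm_eq_cellNorm (coeFn_coreVec ψ)
  have hVu : MemLp (fun p => ((V ‖p.1‖ p.2 : ℝ) : ℂ) * u p) 2 (cellMeasure a) :=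
    hV.memLp_mul a hu.continuous hu.support
  have hq : MemLp (fun p => ((B ^ 2 / 4 * ‖p.1‖ ^ 2 : ℝ) : ℂ) * u p) 2 (cellMeasure a) := by
    refine memLp_cell a ?_ ?_
    · have := hu.continuous
      fun_prop
    · obtain ⟨ρ, hρ⟩ := hu.support
      exact ⟨ρ, fun w z hw => by simp [u, hρ w z hw]⟩
  set f₁ := fun p => S.indicator (fun p => ((V ‖p.1‖ p.2 : ℝ) : ℂ) * u p) p
  set f₂ := fun p => Sᶜ.indicator (fun p => ((V ‖p.1‖ p.2 : ℝ) : ℂ) * u p) p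
  have hf₁ : MemLp f₁ 2 (cellMeasure a) := hVu.indicator hS
  have hf₂ : MemLp f₂ 2 (cellMeasure a) := hVu.indicator hS.compl
  have hdiff : ((hamVec B a α m hV ψ - oscVec B a α m ψ : sector a m) : BlochSpace a)
      =ᵐ[cellMeasure a] fun p => (f₁ p + f₂ p) + ((-(B * m) : ℝ) : ℂ) * u p := by
    rw [Submodule.coe_sub]
    filter_upwards [Lp.coeFn_sub (hamVec B a α m hV ψ : BlochSpace a) (oscVec B a α m ψ),
      coeFn_hamVec (B := B) hV ψ, coeFn_oscVec (B := B) ψ] with p h1 h2 h3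
    have h4 : f₁ p + f₂ p = ((V ‖p.1‖ p.2 : ℝ) : ℂ) * u p := by
      by_cases hp : p ∈ S <;> simp [f₁, f₂, hp]
    rw [h1, Pi.sub_apply, h2, h3, h4, ψ.2.hamExpr_eq, oscExpr]
    push_cast
    ring
  have hb₁ : cellNorm a f₁ ≤ N * sobolevConst a α s * (P + (B + s) * Q) := by
    set M := sobolevConst a α s * (P + (B + s) * Q) with hM
    have hM0 : 0 ≤ M := (norm_nonneg _).trans (hsup (0, 0))
    have : cellNorm a f₁ ≤ cellNorm a fun p => (M : ℂ) * W p := by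
      refine cellNorm_mono (hW.const_mul _) fun p => ?_
      by_cases hp : p ∈ S
      · simp only [f₁, W, indicator_of_mem hp, norm_mul, Complex.norm_real,
          Real.norm_of_nonneg hM0]
        rw [mul_comm]
        exact mul_le_mul_of_nonneg_right (hsup p) (norm_nonneg _)
      · simp [f₁, W, hp]
    rw [cellNorm_const_mul, Complex.norm_real, Real.norm_of_nonneg hM0] at this
    calc _ ≤ M * N := this
      _ = _ := by rw [hM]; ring
  have hb₂ : cellNorm a f₂ ≤ |C| * Q + κ * (P + B * Q) := by
    have h1 : cellNorm a f₂ ≤ cellNorm a fun p => ((|C| : ℝ) : ℂ) * u p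
        + (κ : ℂ) * (((B ^ 2 / 4 * ‖p.1‖ ^ 2 : ℝ) : ℂ) * u p) := by
      refine cellNorm_mono ((hu.memLp.const_mul _).add (hq.const_mul _)) fun p => ?_
      by_cases hp : p ∈ S
      · simp [f₂, hp]
      · have hp' : R < ‖p.1‖ := not_le.1 hp
        have e : ((|C| : ℝ) : ℂ) * u p + (κ : ℂ) * (((B ^ 2 / 4 * ‖p.1‖ ^ 2 : ℝ) : ℂ) * u p)
            = ((|C| + max C_V 0 * ‖p.1‖ ^ 2 : ℝ) : ℂ) * u p := by
          have : κ * (B ^ 2 / 4) = max C_V 0 := by rw [hκ]; field_simp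
          rw [← this]
          push_cast
          ring
        simp only [f₂, indicator_of_mem (show p ∈ Sᶜ from hp), e, norm_mul, Complex.norm_real]
        refine mul_le_mul_of_nonneg_right ?_ (norm_nonneg _)
        rw [Real.norm_eq_abs, Real.norm_of_nonneg (by positivity)]
        refine (hgrow _ _ hp').trans (add_le_add (le_abs_self C) ?_)
        exact mul_le_mul_of_nonneg_right (le_max_left _ _) (sq_nonneg _)
    refine h1.trans ((cellNorm_add_le (hu.memLp.const_mul _) (hq.const_mul _)).trans ?_)
    rw [cellNorm_const_mul, cellNorm_const_mul, Complex.norm_real, Complex.norm_real,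
      Real.norm_of_nonneg hκ0, Real.norm_of_nonneg (abs_nonneg C), hQu]
    have := cellNorm_quadratic_le ha hB.le ψ
    rw [norm_eq_cellNorm (coeFn_coreVec ψ)] at this
    gcongr
  rw [norm_eq_cellNorm hdiff]
  refine (cellNorm_add_le (hf₁.add hf₂) (hu.memLp.const_mul _)).trans ?_
  rw [cellNorm_const_mul, Complex.norm_real, ← hQu, Real.norm_eq_abs, abs_neg]
  have h3 : cellNorm a (f₁ + f₂) ≤ _ := cellNorm_add_le hf₁ hf₂
  nlinarith

end

/-! ### Monomials times radial functions times plane waves -/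

/-- The function `w ^ j * conj w ^ l * φ (|w|²) * exp (i κ z)`. -/
def monWave (j l : ℕ) (φ : ℝ → ℝ) (κ : ℝ) (p : ℂ × ℝ) : ℂ :=
  p.1 ^ j * starRingEnd ℂ p.1 ^ l * ((φ (‖p.1‖ ^ 2) : ℝ) : ℂ) * planeWave κ p.2

section

variable {j l : ℕ} {φ : ℝ → ℝ} {κ : ℝ}

theorem contDiff_monWave (hφ : ContDiff ℝ ∞ φ) : ContDiff ℝ ∞ (monWave j l φ κ) := by
  have h1 : ContDiff ℝ ∞ fun p : ℂ × ℝ => p.1 := contDiff_fst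
  have h2 : ContDiff ℝ ∞ fun p : ℂ × ℝ => starRingEnd ℂ p.1 :=
    Complex.conjCLE.contDiff.comp contDiff_fst
  have h3 : ContDiff ℝ ∞ fun p : ℂ × ℝ => ((φ (‖p.1‖ ^ 2) : ℝ) : ℂ) :=
    Complex.ofRealCLM.contDiff.comp (hφ.comp (h1.norm_sq ℝ))
  exact (((h1.pow j).mul (h2.pow l)).mul h3).mul ((contDiff_planeWave κ).comp contDiff_snd)

/-- The derivative of `|w|²` along `d` is `d conj w + conj d w`, so differentiating `φ` raises one
of the two exponents. Truncated subtraction in `j - 1` and `l - 1` is harmless, since the factor `j`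
or `l` vanishes there. -/
theorem fderiv_monWave (hφ : ContDiff ℝ ∞ φ) (p : ℂ × ℝ) (d : ℂ) (τ : ℝ) :
    fderiv ℝ (monWave j l φ κ) p (d, τ)
      = d * (j * monWave (j - 1) l φ κ p + monWave j (l + 1) (deriv φ) κ p)
        + starRingEnd ℂ d * (l * monWave j (l - 1) φ κ p + monWave (j + 1) l (deriv φ) κ p)
        + Complex.I * κ * τ * monWave j l φ κ p := by
  obtain ⟨w, z⟩ := p
  have hl := ((contDiff_monWave (j := j) (l := l) (κ := κ) hφ).differentiable
    (by simp) (w, z)).hasFDerivAt.hasLineDerivAt (d, τ)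
  have e0 : HasDerivAt (fun t : ℝ => (t : ℂ)) 1 0 := Complex.ofRealCLM.hasDerivAt
  have e1 : HasDerivAt (fun t : ℝ => w + (t : ℂ) * d) d 0 := by
    simpa using (e0.mul_const d).const_add w
  have e2 : HasDerivAt (fun t : ℝ => starRingEnd ℂ w + (t : ℂ) * starRingEnd ℂ d)
      (starRingEnd ℂ d) 0 := by
    simpa using (e0.mul_const (starRingEnd ℂ d)).const_add (starRingEnd ℂ w)
  have e3 : HasDerivAt (fun t : ℝ => ‖w + (t : ℂ) * d‖ ^ 2) (2 * inner ℝ w d) 0 := by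
    simpa using e1.norm_sq
  have e4 : HasDerivAt (fun t : ℝ => φ (‖w + (t : ℂ) * d‖ ^ 2))
      (deriv φ (‖w‖ ^ 2) * (2 * inner ℝ w d)) 0 := by
    have h : HasDerivAt φ (deriv φ (‖w‖ ^ 2)) (‖w + ((0 : ℝ) : ℂ) * d‖ ^ 2) := by
      simpa using (hφ.differentiable (by simp) (‖w‖ ^ 2)).hasDerivAt
    exact h.comp (0 : ℝ) e3
  have e5 : HasDerivAt (fun t : ℝ => z + t * τ) τ 0 := by
    simpa using ((hasDerivAt_id (0 : ℝ)).mul_const τ).const_add z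
  have e6 : HasDerivAt (fun t : ℝ => planeWave κ (z + t * τ))
      ((τ : ℂ) * (Complex.I * κ * planeWave κ z)) 0 := by
    have h : HasDerivAt (planeWave κ) (Complex.I * κ * planeWave κ z) (z + 0 * τ) := by
      simpa using hasDerivAt_planeWave κ z
    simpa [Function.comp_def] using h.scomp (0 : ℝ) e5
  have e7 := (((e1.pow j).mul (e2.pow l)).mul e4.ofReal_comp).mul e6
  have e8 := HasDerivAt.unique (hl : HasDerivAt _ _ (0 : ℝ)) (e7.congr_of_eventuallyEq
    (Filter.Eventually.of_forall fun t => by simp [monWave]))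
  rw [e8]
  have e9 : ((2 * inner ℝ w d : ℝ) : ℂ) = d * starRingEnd ℂ w + starRingEnd ℂ d * w := by
    apply Complex.ext <;> simp [Complex.inner] <;> ring
  have e10 : ((deriv φ (‖w‖ ^ 2) * (2 * inner ℝ w d) : ℝ) : ℂ)
      = (deriv φ (‖w‖ ^ 2) : ℝ) * (d * starRingEnd ℂ w + starRingEnd ℂ d * w) := by
    rw [Complex.ofReal_mul, e9]
  simp only [monWave, e10, Pi.pow_apply, Pi.mul_apply, Complex.ofReal_zero, zero_mul, add_zero]
  ring

/-- The formula is that of `4 ∂_w ∂_{conj w} + ∂²/∂z²`. It is closed under the family `monWave`,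
which makes `A₀` computable on it. -/
theorem lap_monWave (hφ : ContDiff ℝ ∞ φ) (p : ℂ × ℝ) :
    lap (monWave j l φ κ) p
      = 4 * (j * l * monWave (j - 1) (l - 1) φ κ p + (j + l + 1) * monWave j l (deriv φ) κ p
        + monWave (j + 1) (l + 1) (deriv (deriv φ)) κ p) - κ ^ 2 * monWave j l φ κ p := by
  have hφ' : ContDiff ℝ ∞ (deriv φ) := hφ.iterate_deriv 1
  have hcomb : ∀ {u₁ u₂ u₃ u₄ u₅ : ℂ × ℝ → ℂ}, ContDiff ℝ ∞ u₁ → ContDiff ℝ ∞ u₂ →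
      ContDiff ℝ ∞ u₃ → ContDiff ℝ ∞ u₄ → ContDiff ℝ ∞ u₅ → ∀ (c₁ c₂ c₃ c₄ c₅ : ℂ) (e : ℂ × ℝ),
      fderiv ℝ (fun p => c₁ * (c₂ * u₁ p + u₂ p) + c₃ * (c₄ * u₃ p + u₄ p) + c₅ * u₅ p) p e
        = c₁ * (c₂ * fderiv ℝ u₁ p e + fderiv ℝ u₂ p e)
          + c₃ * (c₄ * fderiv ℝ u₃ p e + fderiv ℝ u₄ p e) + c₅ * fderiv ℝ u₅ p e := by
    intro u₁ u₂ u₃ u₄ u₅ h₁ h₂ h₃ h₄ h₅ c₁ c₂ c₃ c₄ c₅ e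
    have k := fun {u : ℂ × ℝ → ℂ} (h : ContDiff ℝ ∞ u) =>
      (h.differentiable (by simp) p).hasFDerivAt
    have := (((((k h₁).const_mul c₂).add (k h₂)).const_mul c₁).add
      ((((k h₃).const_mul c₄).add (k h₄)).const_mul c₃)).add ((k h₅).const_mul c₅)
    have h := this.fderiv
    refine (congrArg (fun L : (ℂ × ℝ) →L[ℝ] ℂ => L e) h).trans ?_
    simp
    ring
  have hD : ∀ d τ, fderiv ℝ (fun p => fderiv ℝ (monWave j l φ κ) p (d, τ)) p (d, τ) = _ :=
    fun d τ => by
      simp only [fderiv_monWave hφ]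
      exact hcomb (contDiff_monWave hφ) (contDiff_monWave hφ') (contDiff_monWave hφ)
        (contDiff_monWave hφ') (contDiff_monWave hφ) _ _ _ _ _ _
  have hj : ∀ (f : ℝ → ℝ), (j : ℂ) * monWave (j - 1 + 1) l f κ p = j * monWave j l f κ p :=
    fun f => by cases j <;> simp
  have hl : ∀ (f : ℝ → ℝ), (l : ℂ) * monWave j (l - 1 + 1) f κ p = l * monWave j l f κ p :=
    fun f => by cases l <;> simp
  unfold lap dX dY dZ
  rw [hD 1 0, hD Complex.I 0, hD 0 1]
  simp only [fderiv_monWave hφ, fderiv_monWave hφ', Complex.conj_I, map_one, map_zero,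
    Complex.ofReal_zero, Complex.ofReal_one, add_tsub_cancel_right]
  push_cast
  linear_combination (exp := 1) 2 * hj (deriv φ) + 2 * hl (deriv φ) + 
    (j * ((j - 1 : ℕ) : ℂ) * monWave (j - 1 - 1) l φ κ p
      + 2 * j * monWave (j - 1) (l + 1) (deriv φ) κ p
      - 2 * j * l * monWave (j - 1) (l - 1) φ κ p - j * monWave (j - 1 + 1) l (deriv φ) κ p
      - j * monWave j l (deriv φ) κ p - l * monWave j l (deriv φ) κ p
      - l * monWave j (l - 1 + 1) (deriv φ) κ p
      + l * ((l - 1 : ℕ) : ℂ) * monWave j (l - 1 - 1) φ κ p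
      + 2 * l * monWave (j + 1) (l - 1) (deriv φ) κ p + κ ^ 2 * monWave j l φ κ p
      + monWave j (l + 1 + 1) (deriv (deriv φ)) κ p - 2 * monWave j l (deriv φ) κ p
      - 2 * monWave (j + 1) (l + 1) (deriv (deriv φ)) κ p
      + monWave (j + 1 + 1) l (deriv (deriv φ)) κ p) * Complex.I_sq

end

/-! ### Cutoffs -/

theorem exists_smooth_step : ∃ χ : ℝ → ℝ, ContDiff ℝ ∞ χ ∧ (∀ s < 0, χ s = 1) ∧
    (∀ s, 1 ≤ s → χ s = 0) ∧ (∀ s < 0, deriv χ s = 0) ∧ (∀ s < 0, deriv (deriv χ) s = 0) ∧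
    ∃ C, ∀ s, |χ s| ≤ C ∧ |deriv χ s| ≤ C ∧ |deriv (deriv χ) s| ≤ C := by
  set χ : ℝ → ℝ := fun s => Real.smoothTransition (1 - s) with hχ
  have h0 : ∀ s < 0, χ s = 1 := fun s hs => Real.smoothTransition.one_of_one_le (by linarith)
  have h1 : ∀ s, 1 ≤ s → χ s = 0 :=
    fun s hs => Real.smoothTransition.zero_of_nonpos (by linarith)
  have hs : ContDiff ℝ ∞ χ := Real.smoothTransition.contDiff.comp (contDiff_const.sub contDiff_id)
  have hs' : ContDiff ℝ ∞ (deriv χ) := hs.iterate_deriv 1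
  have hs'' : ContDiff ℝ ∞ (deriv (deriv χ)) := hs.iterate_deriv 2
  have loc : ∀ (f : ℝ → ℝ) (c : ℝ) (U : Set ℝ), IsOpen U → (∀ s ∈ U, f s = c) →
      ∀ s ∈ U, deriv f s = 0 := by
    intro f c U hU hf s hs
    have : f =ᶠ[nhds s] fun _ => c := by
      filter_upwards [hU.mem_nhds hs] with t ht using hf t ht
    rw [this.deriv_eq, deriv_const]
  have d0 : ∀ s ∈ Iio (0 : ℝ), deriv χ s = 0 := loc χ 1 _ isOpen_Iio h0
  have d1 : ∀ s ∈ Ioi (1 : ℝ), deriv χ s = 0 := loc χ 0 _ isOpen_Ioi fun s hs => h1 s hs.le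
  have dd0 : ∀ s ∈ Iio (0 : ℝ), deriv (deriv χ) s = 0 := loc _ 0 _ isOpen_Iio d0
  have dd1 : ∀ s ∈ Ioi (1 : ℝ), deriv (deriv χ) s = 0 := loc _ 0 _ isOpen_Ioi d1
  have bd : ∀ f : ℝ → ℝ, Continuous f → (∀ s ∈ Iio (0 : ℝ), f s = 0) →
      (∀ s ∈ Ioi (1 : ℝ), f s = 0) → ∃ C, ∀ s, |f s| ≤ C := by
    intro f hf f0 f1
    obtain ⟨C, hC⟩ := (isCompact_Icc (a := (0 : ℝ)) (b := 1)).exists_bound_of_continuousOn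
      hf.continuousOn
    have hC0 : 0 ≤ C := (norm_nonneg _).trans (hC 0 (by simp))
    refine ⟨C, fun s => ?_⟩
    rcases lt_or_ge s 0 with h | h
    · rw [f0 s h, abs_zero]; exact hC0
    rcases lt_or_ge 1 s with h' | h'
    · rw [f1 s h', abs_zero]; exact hC0
    exact hC s ⟨h, h'⟩
  obtain ⟨C₁, hC₁⟩ := bd _ hs'.continuous d0 d1
  obtain ⟨C₂, hC₂⟩ := bd _ hs''.continuous dd0 dd1
  refine ⟨χ, hs, h0, h1, d0, dd0, max 1 (max C₁ C₂), fun s => ⟨?_, ?_, ?_⟩⟩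
  · rw [abs_of_nonneg (Real.smoothTransition.nonneg _)]
    exact (Real.smoothTransition.le_one _).trans (le_max_left _ _)
  · exact (hC₁ s).trans ((le_max_left _ _).trans (le_max_right _ _))
  · exact (hC₂ s).trans ((le_max_right _ _).trans (le_max_right _ _))

/-- Gaussians are not in the core and are approximated by `exp(-bs) χ(s - N)`, with `s` standing for
`r_⊥²`. Translating one fixed step keeps all derivative bounds uniform in `N`, and at each `s` the
approximation is eventually exact, so dominated convergence applies. -/
theorem exists_cutoff_exp {b : ℝ} (hb : 0 < b) : ∃ φ : ℕ → ℝ → ℝ, (∀ N, ContDiff ℝ ∞ (φ N)) ∧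
    (∀ (N : ℕ) (s : ℝ), N + 1 ≤ s → φ N s = 0) ∧
    (∃ C, ∀ N s, |φ N s| ≤ C * Real.exp (-b * s) ∧ |deriv (φ N) s| ≤ C * Real.exp (-b * s) ∧
      |deriv (deriv (φ N)) s| ≤ C * Real.exp (-b * s)) ∧
    ∀ s, ∀ᶠ N in Filter.atTop, φ N s = Real.exp (-b * s) ∧
      deriv (φ N) s = -b * Real.exp (-b * s) ∧
      deriv (deriv (φ N)) s = b ^ 2 * Real.exp (-b * s) := by
  obtain ⟨χ, hs, h0, h1, d0, dd0, C, hC⟩ := exists_smooth_step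
  have hs' : ContDiff ℝ ∞ (deriv χ) := hs.iterate_deriv 1
  have hE : ∀ s, HasDerivAt (fun s => Real.exp (-b * s)) (-b * Real.exp (-b * s)) s := fun s => by
    simpa [mul_comm] using ((hasDerivAt_id s).const_mul (-b)).exp
  have hsh : ∀ (f : ℝ → ℝ), ContDiff ℝ ∞ f → ∀ c s : ℝ,
      HasDerivAt (fun s => f (s - c)) (deriv f (s - c)) s := fun f hf c s =>
    HasDerivAt.comp_sub_const s c (hf.differentiable (by simp) (s - c)).hasDerivAt
  have e1 : ∀ N : ℕ, deriv (fun s => Real.exp (-b * s) * χ (s - N))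
      = fun s => -b * Real.exp (-b * s) * χ (s - N) + Real.exp (-b * s) * deriv χ (s - N) :=
    fun N => funext fun s => ((hE s).mul (hsh χ hs N s)).deriv
  have e2 : ∀ N : ℕ, deriv (deriv (fun s => Real.exp (-b * s) * χ (s - N)))
      = fun s => (-b * (-b * Real.exp (-b * s)) * χ (s - N)
          + -b * Real.exp (-b * s) * deriv χ (s - N))
        + (-b * Real.exp (-b * s) * deriv χ (s - N)
          + Real.exp (-b * s) * deriv (deriv χ) (s - N)) := fun N => by
    rw [e1]
    exact funext fun s => ((((hE s).const_mul (-b)).mul (hsh χ hs N s)).add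
      ((hE s).mul (hsh _ hs' N s))).deriv
  have hC0 : 0 ≤ C := (abs_nonneg _).trans (hC 0).1
  refine ⟨fun N s => Real.exp (-b * s) * χ (s - N), fun N => ?_, fun N s hNs => ?_,
    ⟨(1 + 2 * b + b ^ 2) * C, fun N s => ?_⟩, fun s => ?_⟩
  · exact (Real.contDiff_exp.comp (contDiff_const.mul contDiff_id)).mul
      (hs.comp (contDiff_id.sub contDiff_const))
  · simp only
    rw [h1 _ (by linarith), mul_zero]
  · rw [e2, e1]
    simp only
    obtain ⟨k0, k1, k2⟩ := hC (s - N)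
    have hp := Real.exp_pos (-b * s)
    set E := Real.exp (-b * s)
    set x := χ (s - N)
    set y := deriv χ (s - N)
    set y' := deriv (deriv χ) (s - N)
    have hb2 : 0 ≤ b ^ 2 := sq_nonneg b
    refine ⟨?_, ?_, ?_⟩
    · rw [abs_mul, abs_of_pos hp, mul_comm]
      refine mul_le_mul_of_nonneg_right ?_ hp.le
      nlinarith [mul_nonneg hb.le hC0, mul_nonneg hb2 hC0]
    · have : -b * E * x + E * y = (-b * x + y) * E := by ring
      rw [this, abs_mul, abs_of_pos hp]
      refine mul_le_mul_of_nonneg_right ?_ hp.le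
      have h3 : |-b * x| ≤ b * C := by
        rw [abs_mul, abs_neg, abs_of_pos hb]
        exact mul_le_mul_of_nonneg_left k0 hb.le
      have := abs_add_le (-b * x) y
      nlinarith [mul_nonneg hb.le hC0, mul_nonneg hb2 hC0]
    · have : -b * (-b * E) * x + -b * E * y + (-b * E * y + E * y')
          = (b ^ 2 * x + (2 * b) * (-y) + y') * E := by ring
      rw [this, abs_mul, abs_of_pos hp]
      refine mul_le_mul_of_nonneg_right ?_ hp.le
      have h3 : |b ^ 2 * x| ≤ b ^ 2 * C := by
        rw [abs_mul, abs_of_nonneg hb2]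
        exact mul_le_mul_of_nonneg_left k0 hb2
      have h4 : |(2 * b) * (-y)| ≤ (2 * b) * C := by
        rw [abs_mul, abs_neg, abs_of_pos (by positivity)]
        exact mul_le_mul_of_nonneg_left k1 (by positivity)
      have := abs_add_le (b ^ 2 * x + (2 * b) * (-y)) y'
      have := abs_add_le (b ^ 2 * x) ((2 * b) * (-y))
      linarith
  · have : ∀ᶠ N : ℕ in Filter.atTop, s < N :=
      tendsto_natCast_atTop_atTop.eventually_gt_atTop s
    filter_upwards [this] with N hN
    have hN' : s - N < 0 := by linarith
    rw [e2, e1]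
    simp only [h0 _ hN', d0 _ hN', dd0 _ hN']
    refine ⟨by ring, by ring, by ring⟩

/-! ### Matrix elements with Gaussians -/

/-- Completing the square gives `2cr - 2br² ≤ c²/b - br²`. The factor `exp(cr)` serves to absorb
polynomials and the exponentials of the Fourier transform. -/
theorem memLp_exp_gauss (a c : ℝ) {b : ℝ} (hb : 0 < b) :
    MemLp (fun p : ℂ × ℝ => Real.exp (c * ‖p.1‖ - b * ‖p.1‖ ^ 2)) 2 (cellMeasure a) := by
  have hc : Continuous fun p : ℂ × ℝ => Real.exp (c * ‖p.1‖ - b * ‖p.1‖ ^ 2) := by fun_prop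
  rw [memLp_two_iff_integrable_sq hc.aestronglyMeasurable]
  have h1 : Integrable fun w : ℂ => Real.exp (-b * ‖w‖ ^ 2) := by
    have := (GaussianFourier.integrable_cexp_neg_mul_sq_norm_add (V := ℂ) (b := (b : ℂ))
      (by simpa using hb) 0 0).norm
    refine this.congr (ae_of_all _ fun w => ?_)
    simp only
    rw [Complex.norm_exp]
    norm_cast
    simp
  have h2 : Integrable (fun p : ℂ × ℝ => Real.exp (c ^ 2 / b) * Real.exp (-b * ‖p.1‖ ^ 2))
      (cellMeasure a) := by
    rw [cellMeasure_eq_prod]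
    exact (h1.const_mul _).comp_fst _
  refine h2.mono' (hc.pow 2).aestronglyMeasurable (ae_of_all _ fun p => ?_)
  rw [Real.norm_of_nonneg (by positivity), ← Real.exp_nat_mul, ← Real.exp_add, Real.exp_le_exp]
  have : 0 ≤ (b * ‖p.1‖ - c) ^ 2 / b := by positivity
  have e : (b * ‖p.1‖ - c) ^ 2 / b = b * ‖p.1‖ ^ 2 - 2 * c * ‖p.1‖ + c ^ 2 / b := by
    field_simp
    ring
  rw [e] at this
  push_cast
  linarith

theorem norm_monWave_le (j l : ℕ) {φ : ℝ → ℝ} {C b : ℝ} (κ : ℝ)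
    (hφ : ∀ s, |φ s| ≤ C * Real.exp (-b * s)) (p : ℂ × ℝ) :
    ‖monWave j l φ κ p‖
      ≤ C * (j + l).factorial * Real.exp (1 * ‖p.1‖ - b * ‖p.1‖ ^ 2) := by
  have hC : 0 ≤ C := by simpa using (abs_nonneg _).trans (hφ 0)
  have h1 : ‖p.1‖ ^ (j + l) ≤ (j + l).factorial * Real.exp ‖p.1‖ := by
    have := Real.pow_div_factorial_le_exp ‖p.1‖ (norm_nonneg _) (j + l)
    rwa [div_le_iff₀' (by positivity)] at this
  rw [monWave, norm_mul, norm_mul, norm_mul, norm_pow, norm_pow, Complex.norm_conj,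
    Complex.norm_real, Real.norm_eq_abs, norm_planeWave, mul_one, ← pow_add]
  refine (mul_le_mul h1 (hφ _) (abs_nonneg _) (by positivity)).trans_eq ?_
  rw [sub_eq_add_neg, Real.exp_add, one_mul, neg_mul]
  ring

theorem memLp_monWave (a : ℝ) (j l : ℕ) {φ : ℝ → ℝ} {C b : ℝ} (κ : ℝ) (hb : 0 < b)
    (hc : Continuous φ) (hφ : ∀ s, |φ s| ≤ C * Real.exp (-b * s)) :
    MemLp (monWave j l φ κ) 2 (cellMeasure a) := by
  refine ((memLp_exp_gauss a 1 hb).const_mul (C * (j + l).factorial)).mono ?_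
    (ae_of_all _ fun p => (norm_monWave_le j l κ hφ p).trans (Real.le_norm_self _))
  have := continuous_planeWave κ
  have : Continuous (monWave j l φ κ) := by
    unfold monWave
    fun_prop
  exact this.aestronglyMeasurable

theorem tendsto_integral_monWave {a b C : ℝ} (hb : 0 < b) {v : ℂ × ℝ → ℂ}
    (hv : MemLp v 2 (cellMeasure a)) (j l : ℕ) (κ : ℝ) {f : ℕ → ℝ → ℝ} {g : ℝ → ℝ}
    (hc : ∀ N, Continuous (f N)) (hf : ∀ N s, |f N s| ≤ C * Real.exp (-b * s))
    (hg : ∀ s, ∀ᶠ N in Filter.atTop, f N s = g s) :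
    Filter.Tendsto
      (fun N => ∫ p, starRingEnd ℂ (monWave j l (f N) κ p) * v p ∂(cellMeasure a)) Filter.atTop
      (nhds (∫ p, starRingEnd ℂ (monWave j l g κ p) * v p ∂(cellMeasure a))) := by
  refine tendsto_integral_of_dominated_convergence
    (fun p => (C * (j + l).factorial * Real.exp (1 * ‖p.1‖ - b * ‖p.1‖ ^ 2)) * ‖v p‖)
    (fun N => ?_) ?_ (fun N => ?_) ?_
  · exact ((memLp_monWave a j l κ hb (hc N) (hf N)).star.integrable_mul hv).aestronglyMeasurable
  · exact ((memLp_exp_gauss a 1 hb).const_mul _).integrable_mul hv.norm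
  · refine ae_of_all _ fun p => ?_
    rw [norm_mul, Complex.norm_conj]
    exact mul_le_mul_of_nonneg_right (norm_monWave_le j l κ (hf N) p) (norm_nonneg _)
  · refine ae_of_all _ fun p => ?_
    refine tendsto_const_nhds.congr' ?_
    filter_upwards [hg (‖p.1‖ ^ 2)] with N hN
    simp only [monWave, hN]

section

variable {B a α : ℝ} {m : ℤ} {j l : ℕ} {φ : ℝ → ℝ}

theorem monWave_rot (κ θ : ℝ) (p : ℂ × ℝ) : monWave j l φ κ (rot θ p)
    = Complex.exp (Complex.I * ((j - l : ℤ) : ℂ) * θ) * monWave j l φ κ p := by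
  have h1 : (rot θ p).1 = Complex.exp (θ * Complex.I) * p.1 := by rw [rot_eq]
  have h2 : ‖(rot θ p).1‖ = ‖p.1‖ := by simp [rot]
  have h3 : Complex.exp (Complex.I * ((j - l : ℤ) : ℂ) * θ)
      = Complex.exp (θ * Complex.I) ^ j * starRingEnd ℂ (Complex.exp (θ * Complex.I)) ^ l := by
    rw [← Complex.exp_conj, ← Complex.exp_nat_mul, ← Complex.exp_nat_mul, ← Complex.exp_add]
    congr 1
    simp
    ring
  rw [monWave, monWave, h2, h1, h3, map_mul]
  simp only [rot]
  ring

theorem isBlochCore_monWave (ha : a ≠ 0) (k : ℤ) (hjl : (j : ℤ) - l = m) (hφ : ContDiff ℝ ∞ φ)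
    {r : ℝ} (h0 : ∀ s, r ≤ s → φ s = 0) :
    IsBlochCore a α m (monWave j l φ (waveNumber a α k)) := by
  refine ⟨contDiff_monWave hφ, fun w z => ?_, fun θ p => ?_, max r 1, fun w z hw => ?_⟩
  · simp only [monWave, planeWave_add_period ha]
    ring
  · rw [monWave_rot, hjl]
  · have h1 : r < ‖w‖ := (le_max_left _ _).trans_lt hw
    have h2 : 1 < ‖w‖ := (le_max_right _ _).trans_lt hw
    simp [monWave, h0 (‖w‖ ^ 2) (by nlinarith)]

theorem oscExpr_monWave (hφ : ContDiff ℝ ∞ φ) (κ : ℝ) (p : ℂ × ℝ) :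
    oscExpr B (monWave j l φ κ) p = -4 * j * l * monWave (j - 1) (l - 1) φ κ p
      - 4 * (j + l + 1) * monWave j l (deriv φ) κ p
      - 4 * monWave (j + 1) (l + 1) (deriv (deriv φ)) κ p + κ ^ 2 * monWave j l φ κ p
      + B ^ 2 / 4 * monWave (j + 1) (l + 1) φ κ p := by
  have h : ((B ^ 2 / 4 * ‖p.1‖ ^ 2 : ℝ) : ℂ) * monWave j l φ κ p
      = B ^ 2 / 4 * monWave (j + 1) (l + 1) φ κ p := by
    have : ((‖p.1‖ ^ 2 : ℝ) : ℂ) = p.1 * starRingEnd ℂ p.1 := by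
      rw [Complex.mul_conj, Complex.normSq_eq_norm_sq]
    rw [Complex.ofReal_mul, this, monWave, monWave]
    push_cast
    ring
  rw [oscExpr, h, lap_monWave hφ]
  ring

/-- The inner product of a function with a monomial times a Gaussian times a plane wave. -/
def gaussMoment (a b : ℝ) (v : ℂ × ℝ → ℂ) (j l : ℕ) (κ : ℝ) : ℂ :=
  ∫ p, starRingEnd ℂ (monWave j l (fun s => Real.exp (-b * s)) κ p) * v p ∂(cellMeasure a)

theorem integral_monWave_const_mul (a b c : ℝ) (v : ℂ × ℝ → ℂ) (j l : ℕ) (κ : ℝ) :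
    ∫ p, starRingEnd ℂ (monWave j l (fun s => c * Real.exp (-b * s)) κ p) * v p ∂(cellMeasure a)
      = c * gaussMoment a b v j l κ := by
  rw [gaussMoment, ← integral_const_mul]
  refine integral_congr_ae (ae_of_all _ fun p => ?_)
  simp only [monWave, map_mul, Complex.conj_ofReal, Complex.ofReal_mul]
  ring

theorem gaussMoment_eq_zero_of_orthogonal_core (ha : a ≠ 0) {b : ℝ} (hb : 0 < b)
    {v : sector a m} (hv : v ∈ (LinearMap.range (coreVec a α m))ᗮ) (hjl : (j : ℤ) - l = m)
    (k : ℤ) : gaussMoment a b (v : BlochSpace a) j l (waveNumber a α k) = 0 := by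
  obtain ⟨φ, hφ, h0, ⟨C, hC⟩, hlim⟩ := exists_cutoff_exp hb
  have h1 := tendsto_integral_monWave hb (Lp.memLp (v : BlochSpace a)) j l (waveNumber a α k)
    (fun N => (hφ N).continuous) (fun N s => (hC N s).1) fun s => (hlim s).mono fun N h => h.1
  refine tendsto_nhds_unique h1 (tendsto_const_nhds.congr fun N => ?_)
  have h2 := hv _ ⟨⟨_, isBlochCore_monWave (α := α) ha k hjl (hφ N) (h0 N)⟩, rfl⟩
  rw [sector_inner_eq (coeFn_coreVec _) (ae_eq_refl _)] at h2
  exact h2.symm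

/-- The exponent `B/4` is chosen so that `-4 (B/4)² + B²/4 = 0`: the terms of degree `(j + 1, l +
1)` cancel. What remains of `A₀ - it` is the diagonal entry `B(j + l + 1) + κ² - it` and `-4jl`
times the function with both exponents lowered. Conjugation in the inner product changes `-it` to
`+it`. -/
theorem gaussMoment_recursion (ha : a ≠ 0) (hB : 0 < B) {t : ℝ} {v : sector a m}
    (hv : v ∈ (LinearMap.range (oscVec B a α m - (t * Complex.I : ℂ) • coreVec a α m))ᗮ)
    (hjl : (j : ℤ) - l = m) (k : ℤ) :
    (B * (j + l + 1) + waveNumber a α k ^ 2 + t * Complex.I)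
        * gaussMoment a (B / 4) (v : BlochSpace a) j l (waveNumber a α k)
      = 4 * j * l * gaussMoment a (B / 4) (v : BlochSpace a) (j - 1) (l - 1)
        (waveNumber a α k) := by
  have hb : 0 < B / 4 := by positivity
  obtain ⟨φ, hφ, h0, ⟨C, hC⟩, hlim⟩ := exists_cutoff_exp hb
  set κ := waveNumber a α k
  have hv2 := Lp.memLp (v : BlochSpace a)
  have hφ' : ∀ N, ContDiff ℝ ∞ (deriv (φ N)) := fun N => (hφ N).iterate_deriv 1
  have hφ'' : ∀ N, ContDiff ℝ ∞ (deriv (deriv (φ N))) := fun N => (hφ N).iterate_deriv 2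
  have t0 := fun j l => tendsto_integral_monWave hb hv2 j l κ
    (fun N => (hφ N).continuous) (fun N s => (hC N s).1) fun s => (hlim s).mono fun N h => h.1
  have t1 := tendsto_integral_monWave hb hv2 j l κ (fun N => (hφ' N).continuous)
    (fun N s => (hC N s).2.1) fun s => (hlim s).mono fun N h => h.2.1
  have t2 := tendsto_integral_monWave hb hv2 (j + 1) (l + 1) κ (fun N => (hφ'' N).continuous)
    (fun N s => (hC N s).2.2) fun s => (hlim s).mono fun N h => h.2.2
  rw [integral_monWave_const_mul] at t1 t2
  have t3 := (((((t0 (j - 1) (l - 1)).const_mul (-4 * j * l : ℂ)).add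
    (t1.const_mul (-4 * (j + l + 1) : ℂ))).add (t2.const_mul (-4 : ℂ))).add
    ((t0 j l).const_mul (κ ^ 2 + t * Complex.I : ℂ))).add
    ((t0 (j + 1) (l + 1)).const_mul (B ^ 2 / 4 : ℂ))
  have t4 := tendsto_nhds_unique t3 (tendsto_const_nhds (x := (0 : ℂ)) |>.congr fun N => ?_)
  · unfold gaussMoment at t4 ⊢
    push_cast at t4
    linear_combination t4
  have hcore := isBlochCore_monWave (α := α) ha k hjl (hφ N) (h0 N)
  have h2 := hv _ ⟨⟨_, hcore⟩, rfl⟩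
  have h3 : (((oscVec B a α m - (t * Complex.I : ℂ) • coreVec a α m) ⟨_, hcore⟩ : sector a m) :
      BlochSpace a) =ᵐ[cellMeasure a] fun p => oscExpr B (monWave j l (φ N) κ) p
        - t * Complex.I * monWave j l (φ N) κ p := by
    filter_upwards [Lp.coeFn_sub (oscVec B a α m ⟨_, hcore⟩ : BlochSpace a)
      ((t * Complex.I : ℂ) • (coreVec a α m ⟨_, hcore⟩ : BlochSpace a)),
      Lp.coeFn_smul (t * Complex.I : ℂ) (coreVec a α m ⟨_, hcore⟩ : BlochSpace a),
      coeFn_oscVec (B := B) ⟨_, hcore⟩, coeFn_coreVec ⟨_, hcore⟩] with p k1 k2 k3 k4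
    refine k1.trans ?_
    rw [Pi.sub_apply, k2, k3, Pi.smul_apply, k4, smul_eq_mul]
  rw [sector_inner_eq h3 (ae_eq_refl _)] at h2
  rw [← h2]
  have i0 := fun j l => (memLp_monWave a j l κ hb (hφ N).continuous
    fun s => (hC N s).1).star.integrable_mul hv2
  have i1 := (memLp_monWave a j l κ hb (hφ' N).continuous
    fun s => (hC N s).2.1).star.integrable_mul hv2
  have i2 := (memLp_monWave a (j + 1) (l + 1) κ hb (hφ'' N).continuous
    fun s => (hC N s).2.2).star.integrable_mul hv2
  have i3 := (i0 (j - 1) (l - 1)).const_mul (-4 * j * l : ℂ)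
  have i4 := i1.const_mul (-4 * (j + l + 1) : ℂ)
  have i5 := i2.const_mul (-4 : ℂ)
  have i6 := (i0 j l).const_mul (κ ^ 2 + t * Complex.I : ℂ)
  have i7 := (i0 (j + 1) (l + 1)).const_mul (B ^ 2 / 4 : ℂ)
  simp only [← integral_const_mul]
  have e1 := integral_add i3 i4
  have e2 := integral_add (i3.add i4) i5
  have e3 := integral_add ((i3.add i4).add i5) i6
  have e4 := integral_add (((i3.add i4).add i5).add i6) i7
  refine Eq.trans ?_ (e4.trans (congrArg₂ _ (e3.trans (congrArg₂ _ (e2.trans (congrArg₂ _ e1 rfl))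
    rfl)) rfl))
  refine integral_congr_ae (ae_of_all _ fun p => ?_)
  simp only [oscExpr_monWave (hφ N), Pi.add_apply, Pi.star_apply, Pi.mul_apply, map_add, map_sub,
    map_mul, map_neg, map_pow, map_one, map_natCast, Complex.conj_ofReal, Complex.conj_I,
    map_ofNat, map_div₀, RCLike.star_def]
  ring

/-- The diagonal coefficient has imaginary part `t ≠ 0`, so it can be divided out. Lowering both
exponents preserves `j - l = m` and ends when one of them is zero, where the right side of the
recursion vanishes. -/
theorem gaussMoment_eq_zero_of_orthogonal_range (ha : a ≠ 0) (hB : 0 < B) {t : ℝ} (ht : t ≠ 0)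
    {v : sector a m}
    (hv : v ∈ (LinearMap.range (oscVec B a α m - (t * Complex.I : ℂ) • coreVec a α m))ᗮ)
    (hjl : (j : ℤ) - l = m) (k : ℤ) :
    gaussMoment a (B / 4) (v : BlochSpace a) j l (waveNumber a α k) = 0 := by
  have hne : ∀ x : ℝ, (x + t * Complex.I : ℂ) ≠ 0 := fun x h => ht <| by
    simpa using congrArg Complex.im h
  have hstep : ∀ {j l : ℕ}, (j : ℤ) - l = m → (4 * j * l
      * gaussMoment a (B / 4) (v : BlochSpace a) (j - 1) (l - 1) (waveNumber a α k) : ℂ) = 0 →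
      gaussMoment a (B / 4) (v : BlochSpace a) j l (waveNumber a α k) = 0 := by
    intro j l hjl h
    have h1 := gaussMoment_recursion ha hB hv hjl k
    rw [h] at h1
    refine (mul_eq_zero.1 h1).resolve_left ?_
    have := hne (B * (j + l + 1) + waveNumber a α k ^ 2)
    push_cast at this
    exact this
  induction j generalizing l with
  | zero => exact hstep hjl (by simp)
  | succ j ih =>
    cases l with
    | zero => exact hstep hjl (by simp)
    | succ l =>
      refine hstep hjl ?_
      rw [add_tsub_cancel_right, add_tsub_cancel_right, ih (by push_cast at hjl; linarith),
        mul_zero]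

/-- A rotation by `θ` multiplies the moment by `exp(inθ)` with `n = m - (j - l) ≠ 0`, yet leaves the
integral unchanged; `θ = π/n` gives `M = -M`. -/
theorem gaussMoment_eq_zero_of_ne {v : sector a m} (b κ : ℝ) (hjl : (j : ℤ) - l ≠ m) :
    gaussMoment a b (v : BlochSpace a) j l κ = 0 := by
  set M := gaussMoment a b (v : BlochSpace a) j l κ with hM
  set n : ℤ := m - (j - l) with hn
  have hn0 : n ≠ 0 := fun h => hjl (by omega)
  have hn1 : (n : ℝ) ≠ 0 := by exact_mod_cast hn0
  have key : ∀ θ : ℝ, M = Complex.exp (Complex.I * n * θ) * M := by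
    intro θ
    have hmp := measurePreserving_rot a θ
    have hemb : MeasurableEmbedding (rot θ) := by
      have h : rot θ = ((rotation (Circle.exp θ)).toHomeomorph.prodCongr (Homeomorph.refl ℝ)) :=
        rfl
      rw [h]
      exact Homeomorph.measurableEmbedding _
    have h1 := hmp.integral_comp hemb fun p => starRingEnd ℂ
      (monWave j l (fun s => Real.exp (-b * s)) κ p) * (v : BlochSpace a) p
    refine h1.symm.trans ?_
    rw [hM, gaussMoment, ← integral_const_mul]
    refine integral_congr_ae ?_
    filter_upwards [mem_sector_iff.1 v.2 θ] with p hp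
    have e : Complex.exp (Complex.I * n * θ)
        = starRingEnd ℂ (Complex.exp (Complex.I * ((j - l : ℤ) : ℂ) * θ))
          * Complex.exp (Complex.I * m * θ) := by
      rw [← Complex.exp_conj, ← Complex.exp_add]
      congr 1
      simp [hn]
      ring
    rw [hp, monWave_rot, map_mul, e]
    ring
  have h2 := key (Real.pi / n)
  have h3 : Complex.exp (Complex.I * n * ((Real.pi / n : ℝ) : ℂ)) = -1 := by
    have hn2 : (n : ℂ) ≠ 0 := by exact_mod_cast hn0
    rw [← Complex.exp_pi_mul_I]
    congr 1
    push_cast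
    field_simp
  rw [h3] at h2
  linear_combination h2 / 2

end

/-! ### Completeness of the Gaussians -/

section

open scoped FourierTransform

/-- An integrable function with vanishing Fourier transform vanishes. -/
theorem ae_eq_zero_of_forall_integral_exp_inner {f : ℂ → ℂ} (hf : Integrable f)
    (h : ∀ ξ : ℂ, ∫ w, Complex.exp (Complex.I * (inner ℝ w ξ : ℝ)) * f w = 0) :
    ∀ᵐ w, f w = 0 := by
  have h0 : VectorFourier.fourierIntegral Real.fourierChar volume (innerₗ ℂ) f = 0 := by
    funext η
    have e := Real.fourier_eq' f η
    change VectorFourier.fourierIntegral Real.fourierChar volume (innerₗ ℂ) f η = _ at e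
    rw [e, Pi.zero_apply, ← h ((-2 * Real.pi : ℝ) • η)]
    refine integral_congr_ae (ae_of_all _ fun w => ?_)
    simp only [smul_eq_mul]
    rw [inner_smul_right, mul_comm Complex.I]
  -- Each test function `g` is the Fourier transform of a Schwartz function, so moving the transform
  -- onto `f` makes `∫ g f` vanish.
  refine ae_eq_zero_of_integral_contDiff_smul_eq_zero hf.locallyIntegrable fun g hg hgc => ?_
  have hgc' : HasCompactSupport fun w => (g w : ℂ) := hgc.comp_left (g := Complex.ofReal) rfl
  set G : SchwartzMap ℂ ℂ := hgc'.toSchwartzMap (Complex.ofRealCLM.contDiff.comp hg)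
  let Gi : SchwartzMap ℂ ℂ := 𝓕⁻ G
  have e1 := VectorFourier.integral_fourierIntegral_smul_eq_flip (L := innerₗ ℂ)
    (μ := volume) (ν := volume) (g := ⇑Gi) Real.continuous_fourierChar continuous_inner hf
    Gi.integrable
  rw [h0] at e1
  simp only [Pi.zero_apply, zero_smul, integral_zero, flip_innerₗ] at e1
  have e2 : ∀ w, VectorFourier.fourierIntegral Real.fourierChar volume (innerₗ ℂ) Gi w
      = (g w : ℂ) := fun w => by
    change 𝓕 (⇑Gi) w = _
    rw [← SchwartzMap.fourier_coe, FourierTransform.fourier_fourierInv_eq]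
    rfl
  rw [e1]
  refine integral_congr_ae (ae_of_all _ fun w => ?_)
  simp only [e2, smul_eq_mul, Complex.real_smul]
  ring

end

section

variable {a b : ℝ} {v : ℂ × ℝ → ℂ}

theorem inner_eq_half (w ξ : ℂ) : ((inner ℝ w ξ : ℝ) : ℂ)
    = (ξ * starRingEnd ℂ w + starRingEnd ℂ ξ * w) / 2 := by
  apply Complex.ext <;> simp [Complex.inner]
  ring

/-- The real inner product is `(ξ conj w + conj ξ w) / 2`, so by the binomial theorem its powers are
combinations of the monomials whose moments vanish. -/
theorem integral_inner_pow_eq_zero (hb : 0 < b) (hv : MemLp v 2 (cellMeasure a)) {κ : ℝ}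
    (h : ∀ j l, gaussMoment a b v j l κ = 0) (ξ : ℂ) (n : ℕ) :
    ∫ p, (Complex.I * (inner ℝ p.1 ξ : ℝ)) ^ n * (starRingEnd ℂ
      (monWave 0 0 (fun s => Real.exp (-b * s)) κ p) * v p) ∂(cellMeasure a) = 0 := by
  have hint : ∀ j l, Integrable (fun p => starRingEnd ℂ
      (monWave j l (fun s => Real.exp (-b * s)) κ p) * v p) (cellMeasure a) := fun j l =>
    (memLp_monWave a j l (C := 1) κ hb (by fun_prop)
      fun s => by rw [one_mul, Real.abs_exp]).star.integrable_mul hv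
  have e : ∀ p : ℂ × ℝ, (Complex.I * (inner ℝ p.1 ξ : ℝ)) ^ n * (starRingEnd ℂ
      (monWave 0 0 (fun s => Real.exp (-b * s)) κ p) * v p)
      = ∑ i ∈ Finset.range (n + 1), ((Complex.I / 2) ^ n * ξ ^ i * starRingEnd ℂ ξ ^ (n - i)
        * n.choose i) * (starRingEnd ℂ
          (monWave i (n - i) (fun s => Real.exp (-b * s)) κ p) * v p) := fun p => by
    have e1 : Complex.I * ((inner ℝ p.1 ξ : ℝ) : ℂ)
        = Complex.I / 2 * (ξ * starRingEnd ℂ p.1 + starRingEnd ℂ ξ * p.1) := by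
      rw [inner_eq_half]; ring
    rw [e1, mul_pow, add_pow, Finset.mul_sum, Finset.sum_mul]
    refine Finset.sum_congr rfl fun i _ => ?_
    simp only [monWave, map_mul, map_pow, Complex.conj_conj]
    ring
  simp only [e]
  rw [integral_finsetSum _ fun i _ => (hint _ _).const_mul _]
  refine Finset.sum_eq_zero fun i _ => ?_
  rw [integral_const_mul]
  exact mul_eq_zero_of_right _ (h i (n - i))

/-- Expand the exponential in its power series. The sum of absolute values is `exp(|ξ| r_⊥ - b r_⊥²)
|v|`, which is integrable, so sum and integral may be exchanged. -/
theorem integral_exp_inner_eq_zero (hb : 0 < b) (hv : MemLp v 2 (cellMeasure a)) {κ : ℝ}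
    (h : ∀ j l, gaussMoment a b v j l κ = 0) (ξ : ℂ) :
    ∫ p, Complex.exp (Complex.I * (inner ℝ p.1 ξ : ℝ)) * (starRingEnd ℂ
      (monWave 0 0 (fun s => Real.exp (-b * s)) κ p) * v p) ∂(cellMeasure a) = 0 := by
  set E := fun p => starRingEnd ℂ (monWave 0 0 (fun s => Real.exp (-b * s)) κ p) * v p with hE
  have hEi : Integrable E (cellMeasure a) :=
    (memLp_monWave a 0 0 (C := 1) κ hb (by fun_prop)
      fun s => by rw [one_mul, Real.abs_exp]).star.integrable_mul hv
  have hEn : ∀ p, ‖E p‖ = Real.exp (-b * ‖p.1‖ ^ 2) * ‖v p‖ := fun p => by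
    simp only [hE, monWave, norm_mul, Complex.norm_conj, Complex.norm_real, norm_planeWave]
    simp [abs_of_pos (Real.exp_pos _)]
  have hsum : ∀ p : ℂ × ℝ, HasSum (fun n : ℕ => (‖ξ‖ * ‖p.1‖) ^ n / n.factorial * ‖E p‖)
      (Real.exp (‖ξ‖ * ‖p.1‖) * ‖E p‖) := fun p => by
    have := NormedSpace.expSeries_div_hasSum_exp (‖ξ‖ * ‖p.1‖)
    rw [← Real.exp_eq_exp_ℝ] at this
    exact this.mul_right _
  have hS := hasSum_integral_of_dominated_convergence (μ := cellMeasure a)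
    (F := fun (n : ℕ) p => ((n.factorial : ℂ))⁻¹ * ((Complex.I * (inner ℝ p.1 ξ : ℝ)) ^ n * E p))
    (f := fun p => Complex.exp (Complex.I * (inner ℝ p.1 ξ : ℝ)) * E p)
    (fun n p => (‖ξ‖ * ‖p.1‖) ^ n / n.factorial * ‖E p‖) (fun n => ?_) (fun n => ?_) ?_ ?_ ?_
  · refine hS.unique ?_
    simp only [integral_const_mul, hE, integral_inner_pow_eq_zero hb hv h, mul_zero]
    exact hasSum_zero
  · have hc : Continuous fun p : ℂ × ℝ => (Complex.I * ((inner ℝ p.1 ξ : ℝ) : ℂ)) ^ n := by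
      fun_prop
    exact (hc.aestronglyMeasurable.mul hEi.aestronglyMeasurable).const_mul _
  · refine ae_of_all _ fun p => ?_
    rw [norm_mul, norm_mul, norm_inv, norm_pow, norm_mul, Complex.norm_I, one_mul,
      Complex.norm_real, Complex.norm_natCast, div_eq_inv_mul, mul_assoc]
    have h1 : ‖(inner ℝ p.1 ξ : ℝ)‖ ≤ ‖ξ‖ * ‖p.1‖ := (norm_inner_le_norm _ _).trans_eq (mul_comm _ _)
    gcongr
  · exact ae_of_all _ fun p => (hsum p).summable
  · simp only [(hsum _).tsum_eq]
    refine (((memLp_exp_gauss a ‖ξ‖ hb)).integrable_mul hv.norm).congr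
      (ae_of_all _ fun p => ?_)
    simp only [Pi.mul_apply]
    rw [hEn, sub_eq_add_neg, Real.exp_add, neg_mul, mul_assoc]
  · refine ae_of_all _ fun p => ?_
    have := NormedSpace.expSeries_div_hasSum_exp (Complex.I * ((inner ℝ p.1 ξ : ℝ) : ℂ))
    rw [← Complex.exp_eq_exp_ℂ] at this
    refine (this.mul_right (E p)).congr_fun fun n => ?_
    rw [div_eq_inv_mul, mul_assoc]

/-- After Fubini, the Gaussian times the `k`-th coefficient, as a function of `w`, has vanishing
Fourier transform; the Gaussian has no zeros. -/
theorem ae_blochCoeff_eq_zero (ha : 0 < a) (hb : 0 < b) (hv : MemLp v 2 (cellMeasure a)) {α : ℝ}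
    {k : ℤ} (h : ∀ j l, gaussMoment a b v j l (waveNumber a α k) = 0) :
    ∀ᵐ w, blochCoeff a α k (fun z => v (w, z)) = 0 := by
  set κ := waveNumber a α k
  set E := fun p => starRingEnd ℂ (monWave 0 0 (fun s => Real.exp (-b * s)) κ p) * v p with hE
  have hEi : Integrable E (cellMeasure a) :=
    (memLp_monWave a 0 0 (C := 1) κ hb (by fun_prop)
      fun s => by rw [one_mul, Real.abs_exp]).star.integrable_mul hv
  have hEe : ∀ w z, E (w, z) = (Real.exp (-b * ‖w‖ ^ 2) : ℂ) * (planeWave (-κ) z * v (w, z)) := by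
    intro w z
    simp only [hE, monWave, map_mul, Complex.conj_ofReal, planeWave, ← Complex.exp_conj]
    simp
    ring
  have hEi' := hEi
  rw [cellMeasure_eq_prod] at hEi'
  have h1 := ae_eq_zero_of_forall_integral_exp_inner hEi'.integral_prod_left fun ξ => by
    have h2 := integral_exp_inner_eq_zero hb hv h ξ
    have h3 : Integrable (fun p : ℂ × ℝ => Complex.exp (Complex.I * (inner ℝ p.1 ξ : ℝ)) * E p)
        (cellMeasure a) := by
      refine hEi.bdd_mul (c := 1) ?_ (ae_of_all _ fun p => ?_)
      · exact Continuous.aestronglyMeasurable (by fun_prop)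
      · rw [mul_comm, Complex.norm_exp_ofReal_mul_I]
    rw [cellMeasure_eq_prod] at h2 h3
    rw [integral_prod _ h3] at h2
    rw [← h2]
    simp only [integral_const_mul]
  filter_upwards [h1] with w hw
  rw [blochCoeff, intervalIntegral.integral_of_le ha.le, ← integral_Ico_eq_integral_Ioc]
  simp only [hEe, integral_const_mul] at hw
  have := (mul_eq_zero.1 hw).resolve_left (by exact_mod_cast (Real.exp_pos _).ne')
  rw [this, smul_zero]

theorem ae_eq_zero_of_gaussMoment_eq_zero (ha : 0 < a) (hb : 0 < b)
    (hv : MemLp v 2 (cellMeasure a)) {α : ℝ}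
    (h : ∀ j l k, gaussMoment a b v j l (waveNumber a α k) = 0) : v =ᵐ[cellMeasure a] 0 := by
  have h1 : ∀ᵐ w, ∀ k, blochCoeff a α k (fun z => v (w, z)) = 0 :=
    ae_all_iff.2 fun k => ae_blochCoeff_eq_zero ha hb hv fun j l => h j l k
  have hsq : Integrable (fun p => ‖v p‖ ^ 2) (cellMeasure a) :=
    (memLp_two_iff_integrable_sq_norm hv.1).1 hv
  have hm := hv.1
  rw [cellMeasure_eq_prod] at hsq hm
  have h2 : ∀ᵐ w, ∫ z in Ico 0 a, ‖v (w, z)‖ ^ 2 = 0 := by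
    filter_upwards [h1, hm.prodMk_left, hsq.prod_right_ae] with w k1 k2 k3
    have hmem : MemLp (fun z => v (w, z)) 2 (volume.restrict (Ioc 0 a)) := by
      rw [← restrict_Ico_eq_restrict_Ioc]
      exact (memLp_two_iff_integrable_sq_norm k2).2 k3
    -- Parseval's identity on almost every line parallel to the axis.
    have h3 := hasSum_sq_blochCoeff ha α hmem
    simp only [k1, norm_zero, ne_eq, OfNat.ofNat_ne_zero, not_false_eq_true, zero_pow] at h3
    have h4 := h3.unique hasSum_zero
    rw [integral_Ico_eq_integral_Ioc, ← intervalIntegral.integral_of_le ha.le]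
    exact (mul_eq_zero.1 h4).resolve_left (inv_ne_zero ha.ne')
  have h5 : ∫ p, ‖v p‖ ^ 2 ∂(cellMeasure a) = 0 := by
    rw [cellMeasure_eq_prod, integral_prod _ hsq]
    exact integral_eq_zero_of_ae h2
  rw [← cellMeasure_eq_prod] at hsq
  rw [integral_eq_zero_iff_of_nonneg (fun p => sq_nonneg _) hsq] at h5
  filter_upwards [h5] with p hp
  simpa using hp

end

/-! ### Density of the core and of the ranges of the oscillator -/

section

variable {B a α : ℝ} {m : ℤ}

theorem sector_eq_zero_of_gaussMoment (ha : 0 < a) {b : ℝ} (hb : 0 < b) {v : sector a m}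
    (h : ∀ (j l : ℕ) k, (j : ℤ) - l = m →
      gaussMoment a b (v : BlochSpace a) j l (waveNumber a α k) = 0) : v = 0 := by
  refine Subtype.ext (Lp.ext ?_)
  refine (ae_eq_zero_of_gaussMoment_eq_zero ha hb (Lp.memLp _) (α := α) fun j l k => ?_).trans
    (Lp.coeFn_zero _ _ _).symm
  by_cases hjl : (j : ℤ) - l = m
  · exact h j l k hjl
  · exact gaussMoment_eq_zero_of_ne _ _ hjl

theorem dense_range_coreVec (ha : 0 < a) (α : ℝ) (m : ℤ) :
    Dense (LinearMap.range (coreVec a α m) : Set (sector a m)) := by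
  rw [Submodule.dense_iff_topologicalClosure_eq_top,
    Submodule.topologicalClosure_eq_top_iff, Submodule.eq_bot_iff]
  exact fun v hv => sector_eq_zero_of_gaussMoment (α := α) ha one_pos fun j l k hjl =>
    gaussMoment_eq_zero_of_orthogonal_core ha.ne' one_pos hv hjl k

theorem oscVec_range_orthogonal (ha : 0 < a) (hB : 0 < B) {t : ℝ} (ht : t ≠ 0) :
    (LinearMap.range (oscVec B a α m - (t * Complex.I : ℂ) • coreVec a α m))ᗮ = ⊥ := by
  rw [Submodule.eq_bot_iff]
  exact fun v hv => sector_eq_zero_of_gaussMoment (α := α) ha (by positivity) fun j l k hjl =>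
    gaussMoment_eq_zero_of_orthogonal_range ha.ne' hB ht hv hjl k

end

/-! ### Compactness and the main theorem -/

section

variable {B a α t : ℝ} {m : ℤ} {V : ℝ → ℝ → ℝ}

theorem norm_hamVec_sub_sq (ha : 0 < a) (hV : LocallySquareIntegrable V) (t : ℝ)
    (ψ : core a α m) :
    ‖(hamVec B a α m hV - (t * Complex.I : ℂ) • coreVec a α m) ψ‖ ^ 2
      = ‖hamVec B a α m hV ψ‖ ^ 2 + t ^ 2 * ‖coreVec a α m ψ‖ ^ 2 :=
  norm_sq_sub_imaginary_smul (hamVec_symmetric ha hV ψ ψ) t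

/-- The oscillator and the identity are bounded relative to `H - i t`. -/
theorem exists_graph_bound (ha : 0 < a) (hV : LocallySquareIntegrable V) (ht : 0 < t)
    {θ b : ℝ} (hθ : θ < 1) (hb : 0 ≤ b) (h : ∀ ψ : core a α m,
      ‖hamVec B a α m hV ψ - oscVec B a α m ψ‖
        ≤ θ * ‖oscVec B a α m ψ‖ + b * ‖coreVec a α m ψ‖) :
    ∃ c, 0 ≤ c ∧ ∀ ψ : core a α m,
      ‖oscVec B a α m ψ‖ ≤ c * ‖(hamVec B a α m hV - (t * Complex.I : ℂ) • coreVec a α m) ψ‖ ∧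
      ‖coreVec a α m ψ‖ ≤ c * ‖(hamVec B a α m hV - (t * Complex.I : ℂ) • coreVec a α m) ψ‖ := by
  have h1θ : 0 < 1 - θ := by linarith
  -- Symmetry gives `‖Hψ‖ ≤ u` and `t ‖ψ‖ ≤ u`. The first summand arises by absorbing `θ ‖A₀ψ‖` in
  -- `‖A₀ψ‖ ≤ ‖Hψ‖ + θ ‖A₀ψ‖ + b ‖ψ‖`.
  refine ⟨(1 + b / t) / (1 - θ) + 1 / t, by positivity, fun ψ => ?_⟩
  have e := norm_hamVec_sub_sq (B := B) ha hV t ψ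
  set u := ‖(hamVec B a α m hV - (t * Complex.I : ℂ) • coreVec a α m) ψ‖
  have hu : 0 ≤ u := norm_nonneg _
  have h1 : ‖hamVec B a α m hV ψ‖ ≤ u := 
    (abs_le_of_sq_le_sq' (by nlinarith [sq_nonneg (t * ‖coreVec a α m ψ‖)]) hu).2
  have h2 : t * ‖coreVec a α m ψ‖ ≤ u := 
    (abs_le_of_sq_le_sq' (by nlinarith [sq_nonneg ‖hamVec B a α m hV ψ‖]) hu).2
  have h3 : ‖coreVec a α m ψ‖ ≤ 1 / t * u := by
    rw [div_mul_eq_mul_div, one_mul, le_div_iff₀ ht, mul_comm]; exact h2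
  have h4 : ‖oscVec B a α m ψ‖ ≤ (1 + b / t) / (1 - θ) * u := by
    rw [div_mul_eq_mul_div, le_div_iff₀ h1θ]
    have k1 : ‖oscVec B a α m ψ‖ ≤ ‖hamVec B a α m hV ψ‖
        + ‖hamVec B a α m hV ψ - oscVec B a α m ψ‖ := by
      have := norm_sub_le (hamVec B a α m hV ψ) (hamVec B a α m hV ψ - oscVec B a α m ψ)
      rwa [sub_sub_cancel] at this
    have k2 := h ψ
    have k3 : b * ‖coreVec a α m ψ‖ ≤ b / t * u := by
      have := mul_le_mul_of_nonneg_left h3 hb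
      calc _ ≤ _ := this
        _ = _ := by ring
    linarith
  have h5 : 0 ≤ 1 / t * u := by positivity
  have h6 : 0 ≤ (1 + b / t) / (1 - θ) * u := by positivity
  constructor <;> linarith

/-- Point evaluations of `ψ` are bounded by `‖G ψ‖`, so summing over an orthonormal family in the
range gives a bound independent of its length. Integrated over a bounded region this makes the mass
there small off a finite dimensional space, and outside the region the bound on `r_⊥² ψ` takes over.
-/
theorem exists_small_of_graph_bound (ha : 0 < a) (hB : 0 < B) {G : core a α m →ₗ[ℂ] sector a m}
    {c : ℝ} (hc : 0 ≤ c) (h : ∀ ψ, ‖oscVec B a α m ψ‖ ≤ c * ‖G ψ‖ ∧ ‖coreVec a α m ψ‖ ≤ c * ‖G ψ‖)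
    {ε : ℝ} (hε : 0 < ε) :
    ∃ W ≤ LinearMap.range G, FiniteDimensional ℂ W ∧
      ∀ ψ, G ψ ∈ Wᗮ → ‖coreVec a α m ψ‖ ≤ ε * ‖G ψ‖ := by
  -- A linear section of `G`, extended arbitrarily off the range so that the quadratic expression
  -- `N` is defined on the whole space.
  obtain ⟨S₀, hS₀⟩ := G.rangeRestrict.exists_rightInverse_of_surjective
    (LinearMap.range_eq_top.2 G.surjective_rangeRestrict)
  obtain ⟨S, hS⟩ := S₀.exists_extend
  have hGS : ∀ u ∈ LinearMap.range G, G (S u) = u := fun u hu => by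
    have h1 : S u = S₀ ⟨u, hu⟩ := LinearMap.congr_fun hS ⟨u, hu⟩
    have h2 := LinearMap.congr_fun hS₀ ⟨u, hu⟩
    rw [h1]
    exact congrArg Subtype.val h2
  set c₁ := sobolevConst a α 1 * (c + (B + 1) * c) with hc₁
  have hc₁0 : 0 ≤ c₁ := mul_nonneg (sobolevConst_nonneg _ _ _) (by positivity)
  have hsup : ∀ (ψ : core a α m) p, ‖(ψ : ℂ × ℝ → ℂ) p‖ ≤ c₁ * ‖G ψ‖ := fun ψ p => by
    refine (norm_apply_le ha hB.le one_pos ψ p).trans ?_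
    rw [hc₁, mul_assoc]
    refine mul_le_mul_of_nonneg_left ?_ (sobolevConst_nonneg _ _ _)
    obtain ⟨k1, k2⟩ := h ψ
    nlinarith
  have hquad : ∀ ψ : core a α m,
      cellNorm a (fun p => ((B ^ 2 / 4 * ‖p.1‖ ^ 2 : ℝ) : ℂ) * (ψ : ℂ × ℝ → ℂ) p)
        ≤ (1 + B) * c * ‖G ψ‖ := fun ψ => by
    refine (cellNorm_quadratic_le ha hB.le ψ).trans ?_
    obtain ⟨k1, k2⟩ := h ψ
    nlinarith
  -- Chosen so that `4 / (B² r) * (1 + B) c ≤ ε / 2`: this controls the mass where `r_⊥² ≥ r`.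
  set r := 8 * ((1 + B) * c) / (B ^ 2 * ε) + 1 with hr
  have hr1 : 1 ≤ r := by
    rw [hr]
    have : 0 ≤ 8 * ((1 + B) * c) / (B ^ 2 * ε) := by positivity
    linarith
  set U : Set (ℂ × ℝ) := {p | ‖p.1‖ ^ 2 < r} with hU
  have hUm : MeasurableSet U := measurableSet_lt (by fun_prop) measurable_const
  have hUfin : (cellMeasure a) U ≠ ⊤ := by
    have hK : IsCompact (Metric.closedBall (0 : ℂ) r ×ˢ Icc (0 : ℝ) a) :=
      (isCompact_closedBall _ _).prod isCompact_Icc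
    rw [cellMeasure, Measure.restrict_apply hUm]
    refine ((measure_mono ?_).trans_lt hK.measure_lt_top).ne
    rintro ⟨w, z⟩ ⟨h1, h2⟩
    refine ⟨?_, Ico_subset_Icc_self h2.2⟩
    have h1' : ‖w‖ ^ 2 < r := h1
    rw [mem_closedBall_zero_iff]
    by_contra hw
    rw [not_le] at hw
    nlinarith
  have hUf : IsFiniteMeasure ((cellMeasure a).restrict U) :=
    ⟨by rw [Measure.restrict_apply_univ]; exact hUfin.lt_top⟩
  have hsq : ∀ ψ : core a α m, Integrable (fun p => ‖(ψ : ℂ × ℝ → ℂ) p‖ ^ 2) (cellMeasure a) :=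
    fun ψ => (memLp_two_iff_integrable_sq_norm ψ.2.memLp.1).1 ψ.2.memLp
  set N : sector a m → ℝ := fun u => ∫ p in U, ‖(S u : ℂ × ℝ → ℂ) p‖ ^ 2 ∂(cellMeasure a) with hN
  have hN1 : ∀ (x : ℂ) (u : sector a m), N (x • u) = ‖x‖ ^ 2 * N u := fun x u => by
    simp only [hN]
    rw [← integral_const_mul]
    refine integral_congr_ae (ae_of_all _ fun p => ?_)
    simp [mul_pow]
  have hN2 : ∀ (n : ℕ) (f : Fin n → sector a m), Orthonormal ℂ f →
      (∀ i, f i ∈ LinearMap.range G) → ∑ i, N (f i) ≤ c₁ ^ 2 * (cellMeasure a).real U := by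
    intro n f hf hfD
    simp only [hN]
    rw [← integral_finsetSum _ fun i _ => (hsq _).integrableOn]
    -- Duality: for `x = ∑ conj((S f_i) p) f_i` both `(S x) p` and `‖x‖²` equal the sum `σ`, so the
    -- sup bound reads `σ ≤ c₁ √σ`.
    have hpt : ∀ p, ∑ i, ‖(S (f i) : ℂ × ℝ → ℂ) p‖ ^ 2 ≤ c₁ ^ 2 := by
      intro p
      set σ := ∑ i, ‖(S (f i) : ℂ × ℝ → ℂ) p‖ ^ 2 with hσ
      have hσ0 : 0 ≤ σ := Finset.sum_nonneg fun i _ => sq_nonneg _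
      set g : Fin n → ℂ := fun i => starRingEnd ℂ ((S (f i) : ℂ × ℝ → ℂ) p)
      set x : sector a m := ∑ i, g i • f i with hx
      have hxD : x ∈ LinearMap.range G :=
        Submodule.sum_mem _ fun i _ => Submodule.smul_mem _ _ (hfD i)
      have hxn : ‖x‖ ^ 2 = σ := by
        have h1 := hf.inner_sum g g Finset.univ
        rw [← hx, inner_self_eq_norm_sq_to_K] at h1
        have h2 : ((‖x‖ ^ 2 : ℝ) : ℂ) = (σ : ℂ) := by
          push_cast
          refine h1.trans ?_
          rw [hσ]
          push_cast
          refine Finset.sum_congr rfl fun i _ => ?_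
          simp only [g, Complex.conj_conj]
          rw [Complex.mul_conj, Complex.normSq_eq_norm_sq]
          push_cast
          rfl
        exact_mod_cast h2
      have hxp : (S x : ℂ × ℝ → ℂ) p = σ := by
        have h1 : S x = ∑ i, g i • S (f i) := by simp [hx]
        rw [h1, Submodule.coe_sum, Finset.sum_apply, hσ]
        push_cast
        refine Finset.sum_congr rfl fun i _ => ?_
        simp only [Pi.smul_apply, smul_eq_mul, g]
        rw [mul_comm, Complex.mul_conj, Complex.normSq_eq_norm_sq]
        push_cast
        rfl
      have h3 := hsup (S x) p
      rw [hxp, hGS x hxD, Complex.norm_real, Real.norm_of_nonneg hσ0] at h3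
      have h4 : σ ^ 2 ≤ c₁ ^ 2 * σ := by
        calc σ ^ 2 ≤ (c₁ * ‖x‖) ^ 2 := pow_le_pow_left₀ hσ0 h3 2
          _ = _ := by rw [mul_pow, hxn]
      rcases hσ0.eq_or_lt with h5 | h5
      · rw [← h5]; positivity
      · nlinarith
    calc _ ≤ ∫ _ in U, c₁ ^ 2 ∂(cellMeasure a) :=
          integral_mono (integrable_finsetSum _ fun i _ => (hsq _).integrableOn)
            (integrable_const _) hpt
      _ = _ := by rw [setIntegral_const, smul_eq_mul, mul_comm]
  -- The inner share `ε² / 2` and the outer share `(ε / 2)²` together stay below `ε²`.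
  obtain ⟨W, hWD, hWfin, hW⟩ := exists_finiteDimensional_small (LinearMap.range G) N
    (c₁ ^ 2 * (cellMeasure a).real U) hN1 hN2 (show 0 < ε ^ 2 / 2 by positivity)
  refine ⟨W, hWD, hWfin, fun ψ hψ => ?_⟩
  set u := G ψ with hu
  have huD : u ∈ LinearMap.range G := ⟨ψ, rfl⟩
  -- The difference `ψ - S u` lies in the kernel of `G`, where the bound `h` forces the vector to
  -- vanish.
  have hJ : coreVec a α m ψ = coreVec a α m (S u) := by
    have h0 : G (ψ - S u) = 0 := by rw [map_sub, hGS u huD, sub_self]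
    have h1 := (h (ψ - S u)).2
    rw [h0, norm_zero, mul_zero, norm_le_zero_iff, map_sub, sub_eq_zero] at h1
    exact h1
  set φ := S u with hφ
  have hGφ : G φ = u := hGS u huD
  have hin := hW u huD hψ
  have hq := hquad φ
  rw [hGφ] at hq
  have hqm : MemLp (fun p => ((B ^ 2 / 4 * ‖p.1‖ ^ 2 : ℝ) : ℂ) * (φ : ℂ × ℝ → ℂ) p) 2
      (cellMeasure a) := by
    refine memLp_cell a ?_ ?_
    · have := φ.2.smooth.continuous
      fun_prop
    · obtain ⟨ρ, hρ⟩ := φ.2.support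
      exact ⟨ρ, fun w z hw => by simp [hρ w z hw]⟩
  have hqi := (memLp_two_iff_integrable_sq_norm hqm.1).1 hqm
  have hout : ∫ p in Uᶜ, ‖(φ : ℂ × ℝ → ℂ) p‖ ^ 2 ∂(cellMeasure a)
      ≤ (4 / (B ^ 2 * r)) ^ 2 * ((1 + B) * c * ‖u‖) ^ 2 := by
    calc _ ≤ ∫ p in Uᶜ, (4 / (B ^ 2 * r)) ^ 2 *
          ‖((B ^ 2 / 4 * ‖p.1‖ ^ 2 : ℝ) : ℂ) * (φ : ℂ × ℝ → ℂ) p‖ ^ 2 ∂(cellMeasure a) := by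
          refine setIntegral_mono_on (hsq φ).integrableOn (hqi.const_mul _).integrableOn
            hUm.compl fun p hp => ?_
          have hp' : r ≤ ‖p.1‖ ^ 2 := not_lt.1 hp
          have hr0 : 0 < r := by linarith
          rw [norm_mul, ← mul_pow, Complex.norm_real, Real.norm_of_nonneg (by positivity)]
          refine pow_le_pow_left₀ (norm_nonneg _) ?_ 2
          rw [← mul_assoc]
          refine le_mul_of_one_le_left (norm_nonneg _) ?_
          have : 4 / (B ^ 2 * r) * (B ^ 2 / 4 * ‖p.1‖ ^ 2) = ‖p.1‖ ^ 2 / r := by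
            field_simp
          rw [this, one_le_div hr0]
          exact hp'
      _ ≤ ∫ p, (4 / (B ^ 2 * r)) ^ 2 *
          ‖((B ^ 2 / 4 * ‖p.1‖ ^ 2 : ℝ) : ℂ) * (φ : ℂ × ℝ → ℂ) p‖ ^ 2 ∂(cellMeasure a) :=
          setIntegral_le_integral (hqi.const_mul _) (ae_of_all _ fun p => by positivity)
      _ ≤ _ := by
          rw [integral_const_mul, ← cellNorm_sq hqm]
          exact mul_le_mul_of_nonneg_left (pow_le_pow_left₀ (cellNorm_nonneg _) hq 2)
            (sq_nonneg _)
  have hsmall : 4 / (B ^ 2 * r) * ((1 + B) * c) ≤ ε / 2 := by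
    have hr0 : 0 < r := by linarith
    rw [div_mul_eq_mul_div, div_le_div_iff₀ (by positivity) two_pos]
    have : ε * (B ^ 2 * r) = 8 * ((1 + B) * c) + B ^ 2 * ε := by
      rw [hr]
      field_simp
    rw [this]
    have : 0 ≤ B ^ 2 * ε := by positivity
    linarith
  have htot : ‖coreVec a α m φ‖ ^ 2 = N u
      + ∫ p in Uᶜ, ‖(φ : ℂ × ℝ → ℂ) p‖ ^ 2 ∂(cellMeasure a) := by
    rw [norm_eq_cellNorm (coeFn_coreVec φ), cellNorm_sq φ.2.memLp]
    exact (integral_add_compl hUm (hsq φ)).symm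
  rw [hJ]
  refine abs_le_of_sq_le_sq' ?_ (by positivity) |>.2
  have hε2 : (4 / (B ^ 2 * r)) ^ 2 * ((1 + B) * c * ‖u‖) ^ 2 ≤ (ε / 2) ^ 2 * ‖u‖ ^ 2 := by
    rw [mul_pow _ ‖u‖, ← mul_assoc, ← mul_pow]
    refine mul_le_mul_of_nonneg_right (pow_le_pow_left₀ (by positivity) hsmall 2) (sq_nonneg _)
  rw [htot, mul_pow]
  nlinarith [sq_nonneg (ε * ‖u‖)]

end

end BlochLandau

end

theorem mainTheorem8 (B a R C C_V K : ℝ) (hB : 0 < B) (ha : 0 < a) (hR : 0 < R)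
    (V : ℝ → ℝ → ℝ)
    -- `V` is locally square integrable on three-dimensional space
    (hloc : ∀ s : Set (ℂ × ℝ), IsCompact s →
      MeasureTheory.MemLp (fun p : ℂ × ℝ => V ‖p.1‖ p.2) 2 (MeasureTheory.volume.restrict s))
    -- uniform local square integrability inside the cylinder `r_⊥ < R`
    (hcyl : ∀ n : ℤ,
      ∫⁻ p in {p : ℂ × ℝ | ‖p.1‖ < R ∧ p.2 ∈ Set.Ioo (n : ℝ) (n + 1)}, ‖V ‖p.1‖ p.2‖ₑ ^ 2
        ≤ ENNReal.ofReal (K ^ 2))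
    -- growth bound outside of the cylinder
    (hCV : C_V < B ^ 2 / 4)
    (hgrow : ∀ r z : ℝ, R < r → |V r z| ≤ C + C_V * r ^ 2)
    -- periodicity
    (hper : ∀ r z : ℝ, 0 ≤ r → V r (z + a) = V r z)
    (α : ℝ) (m : ℤ) :
    IsSelfAdjoint (BlochLandau.blochHam B a V α m) ∧
      BlochLandau.HasDiscreteSpectrum (BlochLandau.blochHam B a V α m) := by
  have hV : BlochLandau.LocallySquareIntegrable V := hloc
  obtain ⟨θ, b, hθ0, hθ1, hb, hrel⟩ :=
    BlochLandau.exists_relative_bound (α := α) (m := m) ha hB hV hCV hgrow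
  -- Large enough that `θ + b / t < 1`, as the perturbation argument needs at both `it` and `-it`.
  set t : ℝ := b / (1 - θ) + 1 with ht
  have h1θ : 0 < 1 - θ := by linarith
  have ht0 : 0 < t := by positivity
  have hlt : θ + b / t < 1 := by
    have : b < (1 - θ) * t := by
      rw [ht, mul_add, mul_div_cancel₀ _ h1θ.ne']
      linarith
    have : b / t < 1 - θ := by rwa [div_lt_iff₀ ht0]
    linarith
  obtain ⟨c, hc0, hc⟩ := BlochLandau.exists_graph_bound ha hV ht0 hθ1 hb hrel
  refine BlochLandau.isSelfAdjoint_and_hasDiscreteSpectrum_of_core (t := t) _ _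
    (BlochLandau.minimalHam_graph ha hV)
    (BlochLandau.dense_range_coreVec ha α m) (BlochLandau.hamVec_symmetric ha hV) ht0 ?_ ?_
    fun ε hε => BlochLandau.exists_small_of_graph_bound ha hB hc0 hc hε
  · exact BlochLandau.range_orthogonal_eq_bot_of_relatively_bounded _ _ _
      (fun ψ => BlochLandau.hamVec_symmetric ha _ ψ ψ) hθ0 hb ht0.ne' hrel
      (by rwa [abs_of_pos ht0]) (BlochLandau.oscVec_range_orthogonal ha hB ht0.ne')
  · exact BlochLandau.range_orthogonal_eq_bot_of_relatively_bounded _ _ _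
      (fun ψ => BlochLandau.hamVec_symmetric ha _ ψ ψ) hθ0 hb (neg_ne_zero.2 ht0.ne') hrel
      (by rwa [abs_neg, abs_of_pos ht0])
      (BlochLandau.oscVec_range_orthogonal ha hB (neg_ne_zero.2 ht0.ne'))
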